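/- Consider a central spin $0$ coupled to $n\ge 1$ bath spins $1,\dots,n$ (all spin-$\tfrac12$), with traceless Hamiltonian on $(\mathbb C^2)^{\otimes(n+1)}$ $$H=H_0+\sum_{j=1}^n H_{0,j},\qquad H_0=\sum_{\alpha=1}^{3}h_\alpha P^\alpha_0,\qquad H_{0,j}=\sum_{\alpha=0}^{3}\sum_{\beta=1}^{3}c_{j,\alpha\beta}\,P^\alpha_0\otimes P^\beta_j ,$$ where $P^0=1$ and $P^1,P^2,P^3$ are the Pauli matrices $X,Y,Z$. Thus $H_0$ is a linear term on the central spin, and $H_{0,j}$ consists of the quadratic terms of the edge $(0,j)$ and the linear terms of the bath spin $j$. The coefficients are rational numbers whose numerators and denominators have at most $m$ bits. Let $\lambda(H)$ be the smallest eigenvalue of $H$ and $\|\cdot\|$ the operator norm. Let $0<a\le b$ be constants. There are an algorithm and a constant $C$, depending only on $a$ and $b$, such that for every $0<\varepsilon\le\frac12$ and every such $H$ with $a\le\|H_{0,j}\|\le b$ for all $j$, the algorithm, given $n$, $\lceil 1/\varepsilon\rceil$ and the coefficients of $H$, outputs a rational number $\tilde\lambda$ with $$|\tilde\lambda-\lambda(H)|\le\varepsilon\,|\lambda(H)|$$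 in time at most $m^{C}\,(n+1)^{\varepsilon^{-C}}$, where time is measured on a random access machine with logarithmic (bit) cost. In particular, for coefficients with $\mathrm{poly}(n)$ bits and $n\ge 2$ the time is $n^{\varepsilon^{-O(1)}}$. -/

import Mathlib

open scoped Kronecker

noncomputable section

/-! ### Quantum Ising spin glass on a star graph -/

/-- The identity and the Pauli matrices `X`, `Y`, `Z`. -/
def pauli : Fin 4 → Matrix (Fin 2) (Fin 2) ℂ :=
  ![1, !![0, 1; 1, 0], !![0, -Complex.I; Complex.I, 0], !![1, 0; 0, -1]]

/-- The operator norm of a matrix with respect to the Euclidean (Hilbert space) norm. -/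
def l2OpNorm {ι : Type*} [Fintype ι] [DecidableEq ι] (A : Matrix ι ι ℂ) : ℝ :=
  ‖Matrix.toEuclideanCLM (n := ι) (𝕜 := ℂ) A‖

/-- The standard basis of the Hilbert space of a central spin (vertex `0`) and `n` bath spins
(vertices `1, …, n`) is labelled by the functions from vertices to `{0, 1}`. -/
abbrev Config (n : ℕ) : Type := Fin (n + 1) → Fin 2

/-- A one-spin operator acting on the central spin (tensored with the identity elsewhere). -/
def onCentral {n : ℕ} (A : Matrix (Fin 2) (Fin 2) ℂ) : Matrix (Config n) (Config n) ℂ :=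
  fun s t => if ∀ v, v ≠ 0 → s v = t v then A (s 0) (t 0) else 0

/-- A two-spin operator acting on the central spin (first factor) and on the bath spin `j`
(second factor), tensored with the identity elsewhere. -/
def onPair {n : ℕ} (j : Fin n) (A : Matrix (Fin 2 × Fin 2) (Fin 2 × Fin 2) ℂ) :
    Matrix (Config n) (Config n) ℂ :=
  fun s t => if ∀ v, v ≠ 0 → v ≠ j.succ → s v = t v then
    A (s 0, s j.succ) (t 0, t j.succ) else 0

/-- The coefficients of a traceless Hamiltonian with one- and two-spin Pauli terms on the star
with centre `0` and `n` leaves. -/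
structure StarIsing (n : ℕ) where
  /-- coefficients of `X, Y, Z` in the linear term on the central spin -/
  field : Fin 3 → ℚ
  /-- `coupling j α β` is the coefficient of `P_α ⊗ P_{β+1}`, with `(P_0, …, P_3) = (1, X, Y, Z)`,
  the first factor acting on the central spin and the second one on the bath spin `j`: the
  quadratic terms are those with `α ≠ 0`, the linear terms of the bath spin those with `α = 0`. -/
  coupling : Fin n → Fin 4 → Fin 3 → ℚ

namespace StarIsing

variable {n : ℕ}

/-- The linear term `H₀` of the central spin, on the space of that spin. -/
def centralTerm (I : StarIsing n) : Matrix (Fin 2) (Fin 2) ℂ :=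
  ∑ α : Fin 3, (I.field α : ℂ) • pauli α.succ

/-- The interaction `H_{0,j}`, on the space of the central spin and the bath spin `j`. -/
def interaction (I : StarIsing n) (j : Fin n) : Matrix (Fin 2 × Fin 2) (Fin 2 × Fin 2) ℂ :=
  ∑ α : Fin 4, ∑ β : Fin 3, (I.coupling j α β : ℂ) • (pauli α ⊗ₖ pauli β.succ)

/-- `H = H₀ + ∑ⱼ H_{0,j}` on the space of all `n + 1` spins. -/
def hamiltonian (I : StarIsing n) : Matrix (Config n) (Config n) ℂ :=
  onCentral I.centralTerm + ∑ j : Fin n, onPair j (I.interaction j)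

/-- `lam` is the smallest eigenvalue of the Hamiltonian. -/
def IsGroundEnergy (I : StarIsing n) (lam : ℝ) : Prop :=
  IsLeast {x : ℝ | Module.End.HasEigenvalue (Matrix.toLin' I.hamiltonian) (x : ℂ)} lam

end StarIsing

/-- The rational `q` is written with at most `m` binary digits in its numerator (without the
sign) and at most `m` in its denominator. -/
def RatBits (m : ℕ) (q : ℚ) : Prop :=
  q.num.natAbs.size ≤ m ∧ q.den.size ≤ m

/-- All coefficients are `m`-bit rationals. -/
def StarIsing.HasBits {n : ℕ} (I : StarIsing n) (m : ℕ) : Prop :=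
  (∀ α, RatBits m (I.field α)) ∧ ∀ j α β, RatBits m (I.coupling j α β)

/-! ### Random access machine with logarithmic cost

Programs work on integers of unbounded size, held in unbounded arrays numbered `0, 1, 2, …` (a
program mentions finitely many arrays, by their numbers).  Each elementary operation on integers
is charged the number of binary digits of its result, in addition to the charges for computing its
operands, so that the running time is a bit complexity. -/

/-- Memory: array number, then index, then content. -/
abbrev Store : Type := ℕ → ℕ → ℤ

/-- Number of binary digits of an integer (without its sign). -/
def bitLen (z : ℤ) : ℕ := z.natAbs.size

/-- Arithmetic expressions. `get a i` reads the array `a` at the index given by `i`. -/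
inductive RamExp : Type
  | const (c : ℤ)
  | get (a : ℕ) (i : RamExp)
  | add (e f : RamExp)
  | sub (e f : RamExp)
  | mul (e f : RamExp)
  | div (e f : RamExp)

namespace RamExp

/-- Value of an expression. A negative index is read as `0`; `div` is integer division with
nonnegative remainder, and gives `0` if the divisor is `0`. -/
def eval (s : Store) : RamExp → ℤ
  | const c => c
  | get a i => s a (eval s i).toNat
  | add e f => eval s e + eval s f
  | sub e f => eval s e - eval s f
  | mul e f => eval s e * eval s f
  | div e f => eval s e / eval s f

/-- Cost of evaluating an expression: every node is charged `1` plus the length of its value. -/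
def cost (s : Store) : RamExp → ℕ
  | const c => 1 + bitLen c
  | get a i => cost s i + 1 + bitLen (s a (eval s i).toNat)
  | add e f => cost s e + cost s f + 1 + bitLen (eval s e + eval s f)
  | sub e f => cost s e + cost s f + 1 + bitLen (eval s e - eval s f)
  | mul e f => cost s e + cost s f + 1 + bitLen (eval s e * eval s f)
  | div e f => cost s e + cost s f + 1 + bitLen (eval s e / eval s f)

end RamExp

/-- Programs. `set a i e` writes the value of `e` into the array `a` at the index given by `i`;
`ite e p q` runs `p` if the value of `e` is positive and `q` otherwise; `loop e p` repeats `p` as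
long as the value of `e` is positive. -/
inductive RamProg : Type
  | skip
  | set (a : ℕ) (i e : RamExp)
  | seq (p q : RamProg)
  | ite (e : RamExp) (p q : RamProg)
  | loop (e : RamExp) (p : RamProg)

/-- Overwriting one cell of the memory. -/
def Store.write (s : Store) (a i : ℕ) (z : ℤ) : Store :=
  Function.update s a (Function.update (s a) i z)

/-- `RamRun p s t s'`: the program `p`, started with memory `s`, halts after total time `t` with
memory `s'`. -/
inductive RamRun : RamProg → Store → ℕ → Store → Prop
  | skip (s : Store) : RamRun .skip s 1 s
  | set (s : Store) (a : ℕ) (i e : RamExp) :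
      RamRun (.set a i e) s (i.cost s + e.cost s + 1) (s.write a (i.eval s).toNat (e.eval s))
  | seq {p q : RamProg} {s s' s'' : Store} {t t' : ℕ} :
      RamRun p s t s' → RamRun q s' t' s'' → RamRun (.seq p q) s (t + t') s''
  | ite_pos {e : RamExp} {p q : RamProg} {s s' : Store} {t : ℕ} :
      0 < e.eval s → RamRun p s t s' → RamRun (.ite e p q) s (e.cost s + 1 + t) s'
  | ite_neg {e : RamExp} {p q : RamProg} {s s' : Store} {t : ℕ} :
      ¬ 0 < e.eval s → RamRun q s t s' → RamRun (.ite e p q) s (e.cost s + 1 + t) s'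
  | loop_step {e : RamExp} {p : RamProg} {s s' s'' : Store} {t t' : ℕ} :
      0 < e.eval s → RamRun p s t s' → RamRun (.loop e p) s' t' s'' →
      RamRun (.loop e p) s (e.cost s + 1 + t + t') s''
  | loop_done {e : RamExp} {p : RamProg} {s : Store} :
      ¬ 0 < e.eval s → RamRun (.loop e p) s (e.cost s + 1) s

/-- The coefficients in the order in which they are handed to a program: the three coefficients
of the central spin, then for each bath spin `j` the coefficient `coupling j α β` at position
`3 + 12 j + 3 α + β`. -/
def StarIsing.coeff {n : ℕ} (I : StarIsing n) (i : ℕ) : ℚ :=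
  if h : i < 3 then I.field ⟨i, h⟩
  else if h' : (i - 3) / 12 < n then
    I.coupling ⟨(i - 3) / 12, h'⟩ ⟨(i - 3) % 12 / 3, by omega⟩ ⟨(i - 3) % 3, by omega⟩
  else 0

/-- Input: the number `n` of bath spins and the accuracy parameter `k` in array `0` (cells `0` and
`1`), the numerators of the coefficients in array `1`, and their denominators in array `2`. All
other cells hold `0`. -/
def StarIsing.input {n : ℕ} (I : StarIsing n) (k : ℕ) : Store := fun a i =>
  if a = 0 then (if i = 0 then (n : ℤ) else if i = 1 then (k : ℤ) else 0)
  else if a = 1 ∧ i < 3 + 12 * n then (I.coeff i).num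
  else if a = 2 ∧ i < 3 + 12 * n then ((I.coeff i).den : ℤ)
  else 0

end

/-! Put G = Q⌈1/ε⌉ with a constant Q that depends only on b/a. All errors are compared with |λ|.
Product trial states show that |λ| is at least every central field coefficient in absolute value and
at least a fixed multiple of n·a (`le_neg_abs_field`, `le_neg_mul_of_coupling`). So an error of
order (F + n·b)/G, with F the size of the central field, is a relative error of order 1/G.

If n ≥ G³, product states suffice. View the ground state as a positive functional and put δ = 1/G.
While some bath spin is δ-correlated with the central spin, measure the correlated component of that
bath spin, keep both outcomes as unnormalised functionals, and give up its interaction. The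
measurement commutes with the rest of the Hamiltonian, so only that one interaction is lost, at a
cost O(b). In exchange the average purity (squared Bloch length) of the central spin grows by δ²
(`purity_le_conditioned`). Purity never exceeds 1, so the total loss is O(b/δ²) no matter how many
spins there are. Once the correlations are small, the energy is that of a product state up to
O(bδn). `le_apply_partialHamiltonian` carries this out by induction, with the purity as potential.
Since n ≥ G³, the loss O(bδn + b/δ²) is O(bn/G). For a fixed central Bloch vector the bath vectors
can be optimised one at a time, so a grid search is cheap.

If n < G³, time exponential in a power of G is affordable, because (n+1)^E ≥ 2^E. With S the sum of
the absolute values of the coefficients, S − H is nonnegative with largest eigenvalue S − λ, and S =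
O(|λ|). The ratio of the traces of its powers N+1 and N approximates S − λ to relative error 1/G for
a suitable N polynomial in n and G (`power_sum_ratio`). The traces are computed as sums over closed
paths, with integer entries after clearing denominators and replacing complex numbers by real 2×2
blocks.

Both algorithms are terms of a small language with bounded iteration. `Tm.run_compile` bounds the
running time of the compiled term by B·T^w, where B bounds the input lengths, T the ranges of the
loops, and w depends on the term alone. Then `loop_bounds` shows that T = (n+1)^poly(1/ε) is enough.
-/

section StarGroundEnergy

open Matrix
open scoped ComplexOrder

/-! ### A language of bounded sums, products and minima, compiled to RAM programs -/

/-- Binary operations of terms. -/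
inductive BinOp : Type
  | plus | minus | times | quot

namespace BinOp

/-- Value of a binary operation. -/
def app : BinOp → ℤ → ℤ → ℤ
  | plus, x, y => x + y
  | minus, x, y => x - y
  | times, x, y => x * y
  | quot, x, y => x / y

/-- The machine instruction of a binary operation. -/
def toExp : BinOp → RamExp → RamExp → RamExp
  | plus, e, f => .add e f
  | minus, e, f => .sub e f
  | times, e, f => .mul e f
  | quot, e, f => .div e f

end BinOp

/-- Operations that are iterated over a range. -/
inductive FoldOp : Type
  | sum | prod | min

namespace FoldOp

/-- Value of the empty iteration. -/
def init : FoldOp → ℤ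
  | sum => 0
  | prod => 1
  -- Starting the minimum at 0 is harmless in the grid search: the ground energy is at most 0, and
  -- zero Bloch vectors have energy 0.
  | min => 0

/-- One step of the iteration. -/
def app : FoldOp → ℤ → ℤ → ℤ
  | sum, x, y => x + y
  | prod, x, y => x * y
  | min, x, y => if 0 < x - y then y else x

/-- Iteration over `0, …, N - 1`. -/
def iter (o : FoldOp) (f : ℕ → ℤ) : ℕ → ℤ
  | 0 => o.init
  | N + 1 => o.app (iter o f N) (f N)

theorem iter_sum (f : ℕ → ℤ) (N : ℕ) : iter sum f N = ∑ i ∈ Finset.range N, f i := by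
  induction N with
  | zero => rfl
  | succ N ih => rw [Finset.sum_range_succ, ← ih]; rfl

theorem iter_prod (f : ℕ → ℤ) (N : ℕ) : iter prod f N = ∏ i ∈ Finset.range N, f i := by
  induction N with
  | zero => rfl
  | succ N ih => rw [Finset.prod_range_succ, ← ih]; rfl

theorem app_min (x y : ℤ) : app min x y = x ⊓ y := by
  simp only [app]; split_ifs <;> omega

theorem iter_min_succ (f : ℕ → ℤ) (N : ℕ) : iter min f (N + 1) = iter min f N ⊓ f N :=
  app_min _ _

theorem iter_min_le (f : ℕ → ℤ) {N i : ℕ} (hi : i < N) : iter min f N ≤ f i := by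
  induction N with
  | zero => omega
  | succ N ih =>
    rw [iter_min_succ]
    rcases Nat.lt_succ_iff_lt_or_eq.1 hi with h | rfl
    · exact inf_le_left.trans (ih h)
    · exact inf_le_right

theorem iter_min_mem (f : ℕ → ℤ) (N : ℕ) :
    iter min f N = 0 ∨ ∃ i < N, iter min f N = f i := by
  induction N with
  | zero => exact Or.inl rfl
  | succ N ih =>
    rw [iter_min_succ]
    rcases le_total (iter min f N) (f N) with h | h
    · rw [inf_eq_left.2 h]
      rcases ih with h0 | ⟨i, hi, h1⟩
      · exact Or.inl h0
      · exact Or.inr ⟨i, hi.trans N.lt_succ_self, h1⟩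
    · rw [inf_eq_right.2 h]
      exact Or.inr ⟨N, N.lt_succ_self, rfl⟩

end FoldOp

/-- Terms with named integer variables: reading one of the three input arrays, arithmetic, case
distinction, and iteration of an operation over a range of values of a variable. -/
inductive Tm : Type
  | const (c : ℤ)
  | var (x : ℕ)
  | inp (a : Fin 3) (e : Tm)
  | bin (o : BinOp) (e f : Tm)
  | ite (c e f : Tm)
  | fold (o : FoldOp) (x : ℕ) (N e : Tm)

namespace Tm

/-- Value of a term. -/
def eval (inp : Store) : Tm → (ℕ → ℤ) → ℤ
  | const c, _ => c
  | var x, env => env x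
  | .inp a e, env => inp a (eval inp e env).toNat
  | bin o e f, env => o.app (eval inp e env) (eval inp f env)
  | ite c e f, env => if 0 < eval inp c env then eval inp e env else eval inp f env
  | fold o x N e, env =>
      o.iter (fun i => eval inp e (Function.update env x i)) (eval inp N env).toNat

/-- All ranges that occur in the evaluation of a term have length at most `T`. -/
def LoopsLE (inp : Store) (T : ℕ) : Tm → (ℕ → ℤ) → Prop
  | const _, _ => True
  | var _, _ => True
  | .inp _ e, env => LoopsLE inp T e env
  | bin _ e f, env => LoopsLE inp T e env ∧ LoopsLE inp T f env
  -- Only the branch that is taken is constrained. This matters because the path sums have ranges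
  -- exponential in `n`, and that branch is entered only for small `n`.
  | ite c e f, env => LoopsLE inp T c env ∧
      (0 < eval inp c env → LoopsLE inp T e env) ∧ (¬ 0 < eval inp c env → LoopsLE inp T f env)
  | fold _ x N e, env => LoopsLE inp T N env ∧ (eval inp N env).toNat ≤ T ∧
      ∀ i < (eval inp N env).toNat, LoopsLE inp T e (Function.update env x i)

/-- The exponent in the time bound of a term. -/
def weight : Tm → ℕ
  | const c => 2 + bitLen c
  | var _ => 4
  | .inp _ e => weight e + 4
  | bin _ e f => weight e + weight f + 4
  | ite c e f => weight c + weight e + weight f + 4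
  | fold _ _ N e => weight N + weight e + 8

end Tm

/-- The scalar register in array `a`. -/
def RamExp.reg (a : ℕ) : RamExp := .get a (.const 0)

/-- Assignment to the scalar register in array `a`. -/
def RamProg.assign (a : ℕ) (e : RamExp) : RamProg := .set a (.const 0) e

/-- Adding a value in register `b` to the accumulator in register `a`. -/
def FoldOp.toProg (a b : ℕ) : FoldOp → RamProg
  | sum => .assign a (.add (.reg a) (.reg b))
  | prod => .assign a (.mul (.reg a) (.reg b))
  | min => .ite (.sub (.reg a) (.reg b)) (.assign a (.reg b)) .skip

/-- Compilation of a term. The variable `x` is in the register `ρ x`, the result goes to the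
register `d`, and only arrays from `d` on are changed. -/
def Tm.compile (ρ : ℕ → ℕ) (d : ℕ) : Tm → RamProg
  | const c => .assign d (.const c)
  | var x => .assign d (.reg (ρ x))
  | inp a e => .seq (compile ρ d e) (.assign d (.get a (.reg d)))
  | bin o e f => .seq (compile ρ d e) (.seq (compile ρ (d + 1) f)
      (.assign d (o.toExp (.reg d) (.reg (d + 1)))))
  | ite c e f => .seq (compile ρ d c) (.ite (.reg d) (compile ρ d e) (compile ρ d f))
  -- Register `d` holds the number of rounds, `d + 1` the counter (which is also the variable `x`),
  -- `d + 2` the accumulator, and `d + 3` the value of the body.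
  | fold o x N e => .seq (compile ρ d N) (.seq (.assign (d + 1) (.const 0))
      (.seq (.assign (d + 2) (.const o.init))
      (.seq (.loop (.sub (.reg d) (.reg (d + 1)))
          (.seq (compile (Function.update ρ x (d + 1)) (d + 3) e)
          (.seq (o.toProg (d + 2) (d + 3))
            (.assign (d + 1) (.add (.reg (d + 1)) (.const 1))))))
        (.assign d (.reg (d + 2))))))

/-! ### Lengths of integers -/

theorem bitLen_le {z : ℤ} {b : ℕ} : bitLen z ≤ b ↔ z.natAbs < 2 ^ b := Nat.size_le

theorem natAbs_lt_two_pow_bitLen (z : ℤ) : z.natAbs < 2 ^ bitLen z := Nat.lt_size_self _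

theorem bitLen_zero : bitLen 0 = 0 := rfl

theorem bitLen_one : bitLen 1 = 1 := rfl

theorem bitLen_natCast_le (i : ℕ) : bitLen i ≤ i := by
  rw [bitLen_le]; simpa using Nat.lt_two_pow_self

theorem bitLen_add_le_max (x y : ℤ) : bitLen (x + y) ≤ max (bitLen x) (bitLen y) + 1 := by
  rw [bitLen_le, pow_succ]
  have hx := (natAbs_lt_two_pow_bitLen x).trans_le
    (Nat.pow_le_pow_right two_pos (le_max_left (bitLen x) (bitLen y)))
  have hy := (natAbs_lt_two_pow_bitLen y).trans_le
    (Nat.pow_le_pow_right two_pos (le_max_right (bitLen x) (bitLen y)))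
  have := Int.natAbs_add_le x y
  omega

theorem bitLen_neg (x : ℤ) : bitLen (-x) = bitLen x := by simp [bitLen]

theorem bitLen_add_le (x y : ℤ) : bitLen (x + y) ≤ bitLen x + bitLen y + 1 :=
  (bitLen_add_le_max x y).trans (by omega)

theorem bitLen_sub_le (x y : ℤ) : bitLen (x - y) ≤ bitLen x + bitLen y + 1 := by
  rw [sub_eq_add_neg, ← bitLen_neg y]; exact bitLen_add_le _ _

theorem bitLen_mul_le (x y : ℤ) : bitLen (x * y) ≤ bitLen x + bitLen y := by
  rw [bitLen_le, Int.natAbs_mul, pow_add]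
  exact Nat.mul_lt_mul'' (natAbs_lt_two_pow_bitLen x) (natAbs_lt_two_pow_bitLen y)

theorem bitLen_div_le (x y : ℤ) : bitLen (x / y) ≤ bitLen x :=
  Nat.size_le_size (Int.natAbs_ediv_le_natAbs x y)

theorem BinOp.bitLen_app_le (o : BinOp) (x y : ℤ) :
    bitLen (o.app x y) ≤ bitLen x + bitLen y + 1 := by
  cases o
  · exact bitLen_add_le x y
  · exact bitLen_sub_le x y
  · exact (bitLen_mul_le x y).trans (by omega)
  · exact (bitLen_div_le x y).trans (by omega)

theorem FoldOp.bitLen_init_le (o : FoldOp) : bitLen o.init ≤ 1 := by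
  cases o <;> simp [FoldOp.init, bitLen_zero, bitLen_one]

theorem FoldOp.bitLen_app_le (o : FoldOp) (x y : ℤ) :
    bitLen (o.app x y) ≤ bitLen x + bitLen y + 1 := by
  cases o
  · exact bitLen_add_le x y
  · exact (bitLen_mul_le x y).trans (by omega)
  · simp only [app]; split_ifs <;> omega

theorem FoldOp.bitLen_iter_le (o : FoldOp) (f : ℕ → ℤ) (b N : ℕ) (h : ∀ i < N, bitLen (f i) ≤ b) :
    bitLen (o.iter f N) ≤ 1 + N * (b + 1) := by
  induction N with
  | zero => simpa [iter] using o.bitLen_init_le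
  | succ N ih =>
    have h1 := ih fun i hi => h i (hi.trans N.lt_succ_self)
    have h2 := h N N.lt_succ_self
    have h3 := o.bitLen_app_le (o.iter f N) (f N)
    simp only [iter]
    rw [add_mul]; omega

/-! ### Runs of compiled terms -/

theorem RamExp.eval_reg (s : Store) (a : ℕ) : (RamExp.reg a).eval s = s a 0 := rfl

theorem RamExp.cost_reg (s : Store) (a : ℕ) : (RamExp.reg a).cost s = 2 + bitLen (s a 0) := rfl

/-- The effect of an assignment to a register. -/
abbrev Store.put (s : Store) (a : ℕ) (z : ℤ) : Store := s.write a 0 z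

theorem Store.put_same (s : Store) (a : ℕ) (z : ℤ) : s.put a z a 0 = z := by
  simp [Store.put, Store.write]

theorem Store.put_of_ne (s : Store) {a b : ℕ} (z : ℤ) (h : b ≠ a) : s.put a z b = s b := by
  simp [Store.put, Store.write, Function.update_of_ne h]

theorem RamRun.assign (s : Store) (a : ℕ) (e : RamExp) :
    RamRun (.assign a e) s (e.cost s + 2) (s.put a (e.eval s)) := by
  have := RamRun.set s a (.const 0) e
  have h : (RamExp.const 0).cost s + e.cost s + 1 = e.cost s + 2 := by
    simp only [RamExp.cost, bitLen_zero]; omega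
  rw [h] at this
  exact this

theorem BinOp.eval_toExp (o : BinOp) (s : Store) (e f : RamExp) :
    (o.toExp e f).eval s = o.app (e.eval s) (f.eval s) := by cases o <;> rfl

theorem BinOp.cost_toExp (o : BinOp) (s : Store) (e f : RamExp) :
    (o.toExp e f).cost s = e.cost s + f.cost s + 1 + bitLen (o.app (e.eval s) (f.eval s)) := by
  cases o <;> rfl

theorem FoldOp.run_toProg (o : FoldOp) (s : Store) (a b : ℕ) :
    ∃ t s', RamRun (o.toProg a b) s t s' ∧ s' a 0 = o.app (s a 0) (s b 0) ∧
      (∀ c, c ≠ a → s' c = s c) ∧ t ≤ 3 * (bitLen (s a 0) + bitLen (s b 0)) + 12 := by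
  cases o
  · refine ⟨_, _, RamRun.assign s a _, Store.put_same _ _ _, fun c hc => s.put_of_ne _ hc, ?_⟩
    have := bitLen_add_le (s a 0) (s b 0)
    simp only [RamExp.cost, RamExp.cost_reg, RamExp.eval_reg]; omega
  · refine ⟨_, _, RamRun.assign s a _, Store.put_same _ _ _, fun c hc => s.put_of_ne _ hc, ?_⟩
    have := bitLen_mul_le (s a 0) (s b 0)
    simp only [RamExp.cost, RamExp.cost_reg, RamExp.eval_reg]; omega
  · have hs := bitLen_sub_le (s a 0) (s b 0)
    by_cases h : 0 < ((RamExp.reg a).sub (.reg b)).eval s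
    · refine ⟨_, _, RamRun.ite_pos h (RamRun.assign s a _), ?_, fun c hc => s.put_of_ne _ hc, ?_⟩
      · rw [Store.put_same]; exact (if_pos h).symm
      · simp only [RamExp.cost, RamExp.cost_reg, RamExp.eval_reg]; omega
    · refine ⟨_, _, RamRun.ite_neg h (RamRun.skip s), ?_, fun c hc => rfl, ?_⟩
      · exact (if_neg h).symm
      · simp only [RamExp.cost, RamExp.cost_reg, RamExp.eval_reg]; omega

namespace Tm

/-- Since `T ≥ 2`, four extra units of weight pay for any constant factor up to 16. This is why most
constructors add 4 to the weight. -/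
theorem sixteen_mul_le {T : ℕ} (hT : 2 ≤ T) (X w : ℕ) : 16 * (X * T ^ w) ≤ X * T ^ (w + 4) := by
  have h : 2 ^ 4 ≤ T ^ 4 := Nat.pow_le_pow_left hT 4
  calc 16 * (X * T ^ w) = X * T ^ w * 2 ^ 4 := by ring
    _ ≤ X * T ^ w * T ^ 4 := Nat.mul_le_mul_left _ h
    _ = X * T ^ (w + 4) := by ring

theorem mul_pow_le_mul_pow {T : ℕ} (hT : 2 ≤ T) (X : ℕ) {w w' : ℕ} (h : w ≤ w') :
    X * T ^ w ≤ X * T ^ w' :=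
  Nat.mul_le_mul_left _ (Nat.pow_le_pow_right (by omega) h)

/-- The loop of a compiled iteration, provided that every execution of its body that starts with
admissible registers succeeds within time `tE` and yields values of length at most `bE`. -/
theorem run_loop (o : FoldOp) (s₀ : Store) (d : ℕ) (z : ℤ) (f : ℕ → ℤ) (p : RamProg)
    (T bN bE tE : ℕ) (hT : z.toNat ≤ T) (hz : bitLen z ≤ bN)
    (hf : ∀ i < z.toNat, bitLen (f i) ≤ bE)
    (hp : ∀ i < z.toNat, ∀ s : Store, (∀ a < d, s a = s₀ a) → s (d + 1) 0 = i →
      ∃ t s', RamRun p s t s' ∧ s' (d + 3) 0 = f i ∧ (∀ a < d + 3, s' a = s a) ∧ t ≤ tE)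
    (r i : ℕ) (hir : i + r = z.toNat) (s : Store) (hs : ∀ a < d, s a = s₀ a)
    (h0 : s d 0 = z) (h1 : s (d + 1) 0 = i) (h2 : s (d + 2) 0 = o.iter f i) :
    ∃ t s', RamRun (.loop (.sub (.reg d) (.reg (d + 1))) (.seq p (.seq (o.toProg (d + 2) (d + 3))
        (.assign (d + 1) (.add (.reg (d + 1)) (.const 1)))))) s t s' ∧
      (∀ a < d, s' a = s₀ a) ∧ s' (d + 2) 0 = o.iter f z.toNat ∧
      t ≤ r * (2 * bN + 4 * T + tE + 3 * (T * (bE + 1) + bE) + 40) + (2 * bN + 2 * T + 7) := by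
  induction r generalizing i s with
  | zero =>
    have hev : ¬ 0 < ((RamExp.reg d).sub (.reg (d + 1))).eval s := by
      simp only [RamExp.eval, RamExp.eval_reg, h0, h1]; omega
    refine ⟨_, _, RamRun.loop_done hev, hs, ?_, ?_⟩
    · rw [h2]; congr 1
    · have e1 := bitLen_sub_le z i
      have e2 := bitLen_natCast_le i
      simp only [RamExp.cost, RamExp.cost_reg, RamExp.eval_reg, h0, h1]
      omega
  | succ r ih =>
    have hi : i < z.toNat := by omega
    have hev : 0 < ((RamExp.reg d).sub (.reg (d + 1))).eval s := by
      simp only [RamExp.eval, RamExp.eval_reg, h0, h1]; omega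
    obtain ⟨t₁, s₁, run₁, val₁, frame₁, time₁⟩ := hp i hi s hs h1
    obtain ⟨t₂, s₂, run₂, val₂, frame₂, time₂⟩ := o.run_toProg s₁ (d + 2) (d + 3)
    have run₃ := RamRun.assign s₂ (d + 1) (.add (.reg (d + 1)) (.const 1))
    have k1 : s₂ (d + 1) 0 = i := by
      rw [frame₂ _ (by omega), frame₁ _ (by omega), h1]
    have k2 : s₂ (d + 2) 0 = o.iter f (i + 1) := by
      rw [val₂, val₁, frame₁ _ (by omega), h2]; rfl
    set s₃ := s₂.put (d + 1) ((RamExp.add (.reg (d + 1)) (.const 1)).eval s₂) with hs₃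
    obtain ⟨t₄, s₄, run₄, frame₄, val₄, time₄⟩ := ih (i + 1) (by omega) s₃
      (fun a ha => by
        rw [hs₃, Store.put_of_ne _ _ (by omega), frame₂ _ (by omega), frame₁ _ (by omega), hs a ha])
      (by rw [hs₃, Store.put_of_ne _ _ (by omega), frame₂ _ (by omega), frame₁ _ (by omega), h0])
      (by
        rw [hs₃, Store.put_same]
        simp only [RamExp.eval, RamExp.eval_reg, k1]; push_cast; ring)
      (by rw [hs₃, Store.put_of_ne _ _ (by omega), k2])
    refine ⟨_, s₄, RamRun.loop_step hev (.seq run₁ (.seq run₂ run₃)) run₄, frame₄, val₄, ?_⟩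
    have e1 := bitLen_sub_le z i
    have e2 := bitLen_natCast_le i
    have e3 := bitLen_add_le (i : ℤ) 1
    have e4 : bitLen (s₁ (d + 2) 0) ≤ 1 + T * (bE + 1) := by
      rw [frame₁ _ (by omega), h2]
      refine (o.bitLen_iter_le f bE i fun j hj => hf j (hj.trans hi)).trans ?_
      have := Nat.mul_le_mul_right (bE + 1) (hi.le.trans hT)
      omega
    have e5 : bitLen (s₁ (d + 3) 0) ≤ bE := by rw [val₁]; exact hf i hi
    rw [bitLen_one] at e3
    simp only [RamExp.cost, RamExp.cost_reg, RamExp.eval, RamExp.eval_reg, h0, h1, k1, bitLen_one]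
    rw [Nat.succ_mul]
    omega

/-- A compiled term computes the value of the term. If all ranges have length at most `T` and all
inputs have at most `B` digits, then it runs in time `B * T ^ weight`. -/
theorem run_compile (inp : Store) {B T : ℕ} (hT : 2 ≤ T) (hTB : T ≤ B)
    (hinp : ∀ a < 3, ∀ i, bitLen (inp a i) ≤ B) (e : Tm) (ρ : ℕ → ℕ) (d : ℕ) (s : Store)
    (env : ℕ → ℤ) (hd : 3 ≤ d) (hρ : ∀ x, ρ x < d) (hs : ∀ a < 3, s a = inp a)
    (henv : ∀ x, s (ρ x) 0 = env x) (hB : ∀ x, bitLen (env x) ≤ B) (hl : LoopsLE inp T e env) :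
    bitLen (eval inp e env) ≤ B * T ^ weight e ∧
    ∃ t s', RamRun (compile ρ d e) s t s' ∧ s' d 0 = eval inp e env ∧ (∀ a < d, s' a = s a) ∧
      t ≤ B * T ^ weight e := by
  induction e generalizing ρ d s env with
  | const c =>
    have h1 : 4 * 2 ^ bitLen c ≤ T ^ (2 + bitLen c) := by
      rw [pow_add]
      exact Nat.mul_le_mul (Nat.pow_le_pow_left hT 2) (Nat.pow_le_pow_left hT _)
    have h2 : bitLen c < 2 ^ bitLen c := Nat.lt_two_pow_self
    have h3 : 1 * T ^ (2 + bitLen c) ≤ B * T ^ (2 + bitLen c) := Nat.mul_le_mul_right _ (by omega)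
    simp only [weight, eval, compile]
    refine ⟨by omega, _, _, RamRun.assign s d _, Store.put_same _ _ _,
      fun a ha => s.put_of_ne _ (by omega), ?_⟩
    simp only [RamExp.cost]
    omega
  | var x =>
    have h1 := sixteen_mul_le hT B 0
    have h2 := hB x
    simp only [weight, eval, compile]
    simp only [pow_zero, zero_add, mul_one] at h1
    refine ⟨by omega, _, _, RamRun.assign s d _, ?_,
      fun a ha => s.put_of_ne _ (by omega), ?_⟩
    · rw [Store.put_same]; exact henv x
    · simp only [RamExp.cost_reg, henv]; omega
  | inp a e ih =>
    obtain ⟨b₁, t₁, s₁, run₁, val₁, frame₁, time₁⟩ := ih ρ d s env hd hρ hs henv hB hl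
    have h1 := sixteen_mul_le hT B (weight e)
    have h2 := hinp a a.2 (eval inp e env).toNat
    have h3 := mul_pow_le_mul_pow hT B (Nat.zero_le (weight e))
    rw [pow_zero, mul_one] at h3
    have key : s₁ a (eval inp e env).toNat = inp a (eval inp e env).toNat := by
      rw [frame₁ a (by omega), hs a a.2]
    simp only [weight, eval, compile]
    refine ⟨by omega, _, _, .seq run₁ (RamRun.assign s₁ d _), ?_,
      fun b hb => by rw [Store.put_of_ne _ _ (by omega), frame₁ b hb], ?_⟩
    · rw [Store.put_same, RamExp.eval, RamExp.eval_reg, val₁, key]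
    · simp only [RamExp.cost, RamExp.cost_reg, RamExp.eval_reg, val₁, key]; omega
  | bin o e f ih₁ ih₂ =>
    obtain ⟨b₁, t₁, s₁, run₁, val₁, frame₁, time₁⟩ := ih₁ ρ d s env hd hρ hs henv hB hl.1
    obtain ⟨b₂, t₂, s₂, run₂, val₂, frame₂, time₂⟩ := ih₂ ρ (d + 1) s₁ env (by omega)
      (fun x => (hρ x).trans d.lt_succ_self) (fun a ha => by rw [frame₁ a (by omega), hs a ha])
      (fun x => by rw [frame₁ _ (hρ x), henv]) hB hl.2
    have h1 := sixteen_mul_le hT B (weight e + weight f)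
    have h2 := mul_pow_le_mul_pow hT B (Nat.le_add_right (weight e) (weight f))
    have h3 := mul_pow_le_mul_pow hT B (Nat.le_add_left (weight f) (weight e))
    have h4 := mul_pow_le_mul_pow hT B (Nat.zero_le (weight e + weight f))
    rw [pow_zero, mul_one] at h4
    have h5 := o.bitLen_app_le (eval inp e env) (eval inp f env)
    have key : s₂ d 0 = eval inp e env := by rw [frame₂ d (by omega), val₁]
    simp only [weight, eval, compile]
    refine ⟨by omega, _, _, .seq run₁ (.seq run₂ (RamRun.assign s₂ d _)), ?_,
      fun b hb => by
        rw [Store.put_of_ne _ _ (by omega), frame₂ b (by omega), frame₁ b hb], ?_⟩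
    · rw [Store.put_same, BinOp.eval_toExp, RamExp.eval_reg, RamExp.eval_reg, key, val₂]
    · simp only [BinOp.cost_toExp, RamExp.cost_reg, RamExp.eval_reg, key, val₂]; omega
  | ite c e f ih₀ ih₁ ih₂ =>
    obtain ⟨b₀, t₀, s₀, run₀, val₀, frame₀, time₀⟩ := ih₀ ρ d s env hd hρ hs henv hB hl.1
    have h1 := sixteen_mul_le hT B (weight c + weight e + weight f)
    have h2 := mul_pow_le_mul_pow hT B
      (show weight c ≤ weight c + weight e + weight f by omega)
    have h3 := mul_pow_le_mul_pow hT B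
      (show weight e ≤ weight c + weight e + weight f by omega)
    have h4 := mul_pow_le_mul_pow hT B
      (show weight f ≤ weight c + weight e + weight f by omega)
    have h5 := mul_pow_le_mul_pow hT B (Nat.zero_le (weight c + weight e + weight f))
    rw [pow_zero, mul_one] at h5
    have hs' : ∀ a < 3, s₀ a = inp a := fun a ha => by rw [frame₀ a (by omega), hs a ha]
    have henv' : ∀ x, s₀ (ρ x) 0 = env x := fun x => by rw [frame₀ _ (hρ x), henv]
    simp only [weight, eval, compile]
    by_cases hc : 0 < eval inp c env
    · obtain ⟨b₁, t₁, s₁, run₁, val₁, frame₁, time₁⟩ :=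
        ih₁ ρ d s₀ env hd hρ hs' henv' hB (hl.2.1 hc)
      have hc' : 0 < (RamExp.reg d).eval s₀ := by rw [RamExp.eval_reg, val₀]; exact hc
      simp only [if_pos hc]
      refine ⟨by omega, _, _, .seq run₀ (.ite_pos hc' run₁), val₁,
        fun a ha => by rw [frame₁ a ha, frame₀ a ha], ?_⟩
      simp only [RamExp.cost_reg, val₀]; omega
    · obtain ⟨b₁, t₁, s₁, run₁, val₁, frame₁, time₁⟩ :=
        ih₂ ρ d s₀ env hd hρ hs' henv' hB (hl.2.2 hc)
      have hc' : ¬ 0 < (RamExp.reg d).eval s₀ := by rw [RamExp.eval_reg, val₀]; exact hc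
      simp only [if_neg hc]
      refine ⟨by omega, _, _, .seq run₀ (.ite_neg hc' run₁), val₁,
        fun a ha => by rw [frame₁ a ha, frame₀ a ha], ?_⟩
      simp only [RamExp.cost_reg, val₀]; omega
  | fold o x N e ihN ihE =>
    obtain ⟨hlN, hNT, hlE⟩ := hl
    obtain ⟨b₀, t₀, s₀, run₀, val₀, frame₀, time₀⟩ := ihN ρ d s env hd hρ hs henv hB hlN
    set z := eval inp N env with hz
    set f : ℕ → ℤ := fun i => eval inp e (Function.update env x i) with hf
    have body : ∀ i < z.toNat, ∀ s' : Store, (∀ a < d, s' a = s a) → s' (d + 1) 0 = i →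
        bitLen (f i) ≤ B * T ^ weight e ∧
        ∃ t s'', RamRun (compile (Function.update ρ x (d + 1)) (d + 3) e) s' t s'' ∧
          s'' (d + 3) 0 = f i ∧ (∀ a < d + 3, s'' a = s' a) ∧ t ≤ B * T ^ weight e := by
      intro i hi s' hs' h1
      refine ihE (Function.update ρ x (d + 1)) (d + 3) s' (Function.update env x i) (by omega)
        ?_ (fun a ha => by rw [hs' a (by omega), hs a ha]) ?_ ?_ (hlE i hi)
      · intro y
        rcases eq_or_ne y x with rfl | hy
        · rw [Function.update_self]; omega
        · rw [Function.update_of_ne hy]; exact (hρ y).trans (by omega)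
      · intro y
        rcases eq_or_ne y x with rfl | hy
        · rw [Function.update_self, Function.update_self, h1]
        · rw [Function.update_of_ne hy, Function.update_of_ne hy, hs' _ (hρ y), henv]
      · intro y
        rcases eq_or_ne y x with rfl | hy
        · rw [Function.update_self]
          exact (bitLen_natCast_le i).trans (by omega)
        · rw [Function.update_of_ne hy]; exact hB y
    have bits : ∀ i < z.toNat, bitLen (f i) ≤ B * T ^ weight e := fun i hi =>
      (body i hi (s.put (d + 1) i) (fun a ha => s.put_of_ne _ (by omega))
        (Store.put_same _ _ _)).1
    set s₁ := s₀.put (d + 1) 0 with hs₁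
    set s₂ := s₁.put (d + 2) o.init with hs₂
    have run₁ : RamRun (.assign (d + 1) (.const 0)) s₀ _ s₁ := RamRun.assign s₀ (d + 1) (.const 0)
    have run₂ : RamRun (.assign (d + 2) (.const o.init)) s₁ _ s₂ :=
      RamRun.assign s₁ (d + 2) (.const o.init)
    obtain ⟨t₃, s₃, run₃, frame₃, val₃, time₃⟩ := run_loop o s d z f
      (compile (Function.update ρ x (d + 1)) (d + 3) e) T (B * T ^ weight N) (B * T ^ weight e)
      (B * T ^ weight e) hNT b₀ bits (fun i hi s' hs' h1 => (body i hi s' hs' h1).2) z.toNat 0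
      (zero_add _) s₂
      (fun a ha => by
        rw [hs₂, Store.put_of_ne _ _ (by omega), hs₁, Store.put_of_ne _ _ (by omega),
          frame₀ a ha])
      (by
        rw [hs₂, Store.put_of_ne _ _ (by omega), hs₁, Store.put_of_ne _ _ (by omega), val₀])
      (by rw [hs₂, Store.put_of_ne _ _ (by omega), hs₁, Store.put_same]; rfl)
      (by rw [hs₂, Store.put_same]; rfl)
    set X := B * T ^ (weight N + weight e) with hX
    have x1 : B * T ^ weight N ≤ X := mul_pow_le_mul_pow hT B (by omega)
    have x2 : B * T ^ weight e ≤ X := mul_pow_le_mul_pow hT B (by omega)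
    have x3 : B * T ^ 0 ≤ X := mul_pow_le_mul_pow hT B (by omega)
    rw [pow_zero, mul_one] at x3
    have y1 : T * (B * T ^ weight e + 1) ≤ T * X + T := by
      have := Nat.mul_le_mul_left T x2
      rw [mul_add, mul_one]; omega
    have y2 : 2 * X ≤ T * X := Nat.mul_le_mul_right X hT
    have y3 : 2 * (T * X) ≤ T * (T * X) := Nat.mul_le_mul_right _ hT
    have y4 : X * T ^ 8 = B * T ^ (weight N + weight e + 8) := by rw [hX]; ring
    -- Of the eight units of weight of a loop, one pays for the number of rounds and one for the
    -- accumulator, whose length can grow by the length of the summand in every round. The remaining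
    -- six give the constant 64.
    have y5 : 64 * (T * (T * X)) ≤ X * T ^ 8 := by
      have h : 2 ^ 6 ≤ T ^ 6 := Nat.pow_le_pow_left hT 6
      calc 64 * (T * (T * X)) = X * T ^ 2 * 2 ^ 6 := by ring
        _ ≤ X * T ^ 2 * T ^ 6 := Nat.mul_le_mul_left _ h
        _ = X * T ^ 8 := by ring
    have acc : bitLen (o.iter f z.toNat) ≤ 1 + (T * X + T) := by
      refine (o.bitLen_iter_le f _ _ bits).trans ?_
      have := Nat.mul_le_mul_right (B * T ^ weight e + 1) hNT
      omega
    simp only [weight, eval, compile]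
    rw [← y4]
    refine ⟨acc.trans (by omega), _, _, .seq run₀ (.seq run₁ (.seq run₂ (.seq run₃ (RamRun.assign s₃ d _)))),
      ?_, fun a ha => by rw [Store.put_of_ne _ _ (by omega), frame₃ a ha], ?_⟩
    · rw [Store.put_same, RamExp.eval_reg, val₃]
    · have h1 := o.bitLen_init_le
      have h2 : z.toNat * (2 * (B * T ^ weight N) + 4 * T + B * T ^ weight e +
          3 * (T * (B * T ^ weight e + 1) + B * T ^ weight e) + 40) ≤ T * (38 * (T * X)) :=
        Nat.mul_le_mul hNT (by omega)
      have h3 : T * (38 * (T * X)) = 38 * (T * (T * X)) := by ring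
      simp only [RamExp.cost, RamExp.cost_reg, val₃, bitLen_zero]
      omega

end Tm

/-! ### Programs with a rational output -/

namespace Tm

/-- The program that writes the values of two terms to the cells `0` and `1` of array `3`. -/
def toProg (num den : Tm) : RamProg :=
  .seq (compile (fun _ => 0) 4 num) (.seq (.set 3 (.const 0) (.reg 4))
    (.seq (compile (fun _ => 0) 4 den) (.set 3 (.const 1) (.reg 4))))

/-- The scratch registers start at 4, so the second computation finds the input in arrays 0 to 2 and
the first result in array 3 intact. Before any loop binds a variable, all variables share the
register of array 0, hence the environment `fun _ => inp 0 0`. -/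
theorem run_toProg (inp : Store) {B T : ℕ} (hT : 2 ≤ T) (hTB : T ≤ B)
    (hinp : ∀ a < 3, ∀ i, bitLen (inp a i) ≤ B) (num den : Tm)
    (hnum : LoopsLE inp T num fun _ => inp 0 0) (hden : LoopsLE inp T den fun _ => inp 0 0) :
    ∃ t s, RamRun (toProg num den) inp t s ∧ s 3 0 = eval inp num (fun _ => inp 0 0) ∧
      s 3 1 = eval inp den (fun _ => inp 0 0) ∧ t ≤ B * T ^ (weight num + weight den + 4) := by
  obtain ⟨b₁, t₁, s₁, run₁, val₁, frame₁, time₁⟩ := run_compile inp hT hTB hinp num (fun _ => 0) 4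
    inp (fun _ => inp 0 0) (by omega) (fun _ => by omega) (fun _ _ => rfl) (fun _ => rfl)
    (fun _ => hinp 0 (by omega) 0) hnum
  have run₂ := RamRun.set s₁ 3 (.const 0) (.reg 4)
  set s₂ := s₁.write 3 ((RamExp.const 0).eval s₁).toNat ((RamExp.reg 4).eval s₁) with hs₂
  have h2 : ∀ a, a ≠ 3 → s₂ a = s₁ a := fun a ha => by
    rw [hs₂]; simp [Store.write, Function.update_of_ne ha]
  have h20 : s₂ 3 0 = eval inp num (fun _ => inp 0 0) := by
    rw [hs₂, ← val₁]; simp [Store.write, RamExp.eval, RamExp.eval_reg]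
  obtain ⟨b₃, t₃, s₃, run₃, val₃, frame₃, time₃⟩ := run_compile inp hT hTB hinp den (fun _ => 0) 4
    s₂ (fun _ => inp 0 0) (by omega) (fun _ => by omega)
    (fun a ha => by rw [h2 a (by omega), frame₁ a (by omega)])
    (fun _ => by rw [h2 0 (by omega), frame₁ 0 (by omega)])
    (fun _ => hinp 0 (by omega) 0) hden
  have run₄ := RamRun.set s₃ 3 (.const 1) (.reg 4)
  refine ⟨_, _, .seq run₁ (.seq run₂ (.seq run₃ run₄)), ?_, ?_, ?_⟩
  · rw [← h20, ← frame₃ 3 (by omega)]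
    simp [Store.write, RamExp.eval]
  · rw [← val₃]
    simp [Store.write, RamExp.eval, RamExp.eval_reg]
  · have h1 := sixteen_mul_le hT B (weight num + weight den)
    have h2 := mul_pow_le_mul_pow hT B (Nat.le_add_right (weight num) (weight den))
    have h3 := mul_pow_le_mul_pow hT B (Nat.le_add_left (weight den) (weight num))
    have h4 := mul_pow_le_mul_pow hT B (Nat.zero_le (weight num + weight den))
    rw [pow_zero, mul_one] at h4
    simp only [RamExp.cost, RamExp.cost_reg, bitLen_zero, bitLen_one, val₁, val₃]
    omega

end Tm

/-- Bounds polynomial in the size of the coefficients and in `(n + 1) ^ poly(⌈1 / ε⌉)`. -/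
theorem exists_time_exponent (A w : ℕ) : ∃ C : ℕ, ∀ ε : ℝ, 0 < ε → ε ≤ 1 / 2 → ∀ n m : ℕ, 1 ≤ m →
    ∀ t : ℕ, t ≤ m * (n + 1) ^ (A * ⌈1 / ε⌉₊ ^ A) * ((n + 1) ^ (A * ⌈1 / ε⌉₊ ^ A)) ^ w →
      (t : ℝ) ≤ (m : ℝ) ^ C * ((n : ℝ) + 1) ^ ((1 / ε) ^ C) := by
  refine ⟨(w + 1) * A + 2 * A + 1, fun ε hε hε2 n m hm t ht => ?_⟩
  set k := ⌈1 / ε⌉₊ with hk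
  set C := (w + 1) * A + 2 * A + 1 with hC
  -- Because 1/ε ≥ 2, a constant c is at most (1/ε)^c and ⌈1/ε⌉ is at most (1/ε)^2, so constants and
  -- rounding both disappear into the exponent `C`.
  have hx : (2 : ℝ) ≤ 1 / ε := by rw [le_div_iff₀ hε]; linarith
  have hkx : (k : ℝ) ≤ (1 / ε) ^ 2 := by
    have := (Nat.ceil_lt_add_one (by positivity : (0 : ℝ) ≤ 1 / ε)).le
    nlinarith
  have hm' : (1 : ℝ) ≤ m := by exact_mod_cast hm
  have hexp : (((w + 1) * (A * k ^ A) : ℕ) : ℝ) ≤ (1 / ε) ^ C := by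
    have h1 : (((w + 1) * A : ℕ) : ℝ) ≤ (1 / ε) ^ ((w + 1) * A) := by
      calc (((w + 1) * A : ℕ) : ℝ) ≤ ((2 ^ ((w + 1) * A) : ℕ) : ℝ) := by
            exact_mod_cast (Nat.lt_two_pow_self).le
        _ = (2 : ℝ) ^ ((w + 1) * A) := by push_cast; rfl
        _ ≤ _ := pow_le_pow_left₀ (by norm_num) hx _
    have h2 : (k : ℝ) ^ A ≤ (1 / ε) ^ (2 * A) := by
      rw [pow_mul]; exact pow_le_pow_left₀ (by positivity) hkx _
    calc (((w + 1) * (A * k ^ A) : ℕ) : ℝ) = (((w + 1) * A : ℕ) : ℝ) * (k : ℝ) ^ A := by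
          push_cast; ring
      _ ≤ (1 / ε) ^ ((w + 1) * A) * (1 / ε) ^ (2 * A) := by gcongr
      _ = (1 / ε) ^ ((w + 1) * A + 2 * A) := by rw [pow_add]
      _ ≤ (1 / ε) ^ C := pow_le_pow_right₀ (by linarith) (by omega)
  calc (t : ℝ) ≤ ((m * (n + 1) ^ (A * k ^ A) * ((n + 1) ^ (A * k ^ A)) ^ w : ℕ) : ℝ) := by
        exact_mod_cast ht
    _ = (m : ℝ) * ((n : ℝ) + 1) ^ ((w + 1) * (A * k ^ A)) := by push_cast; ring
    _ = (m : ℝ) * ((n : ℝ) + 1) ^ ((((w + 1) * (A * k ^ A) : ℕ)) : ℝ) := by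
        rw [Real.rpow_natCast]
    _ ≤ (m : ℝ) ^ C * ((n : ℝ) + 1) ^ ((1 / ε) ^ C) := by
        gcongr
        · exact le_self_pow₀ hm' (by omega)
        · linarith [Nat.cast_nonneg (α := ℝ) n]

/-! ### Product operators -/

section ProdMat

variable {V : Type*} [Fintype V]

/-- The tensor product of one-spin operators. -/
def prodMat (Q : V → Matrix (Fin 2) (Fin 2) ℂ) : Matrix (V → Fin 2) (V → Fin 2) ℂ :=
  fun s t => ∏ v, Q v (s v) (t v)

theorem prodMat_mul [DecidableEq V] (Q R : V → Matrix (Fin 2) (Fin 2) ℂ) :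
    prodMat Q * prodMat R = prodMat fun v => Q v * R v := by
  ext s t
  simp only [prodMat, Matrix.mul_apply, ← Finset.prod_mul_distrib]
  rw [Finset.prod_univ_sum, Fintype.piFinset_univ]

theorem trace_prodMat [DecidableEq V] (Q : V → Matrix (Fin 2) (Fin 2) ℂ) :
    (prodMat Q).trace = ∏ v, (Q v).trace := by
  simp only [prodMat, Matrix.trace, Matrix.diag]
  rw [Finset.prod_univ_sum, Fintype.piFinset_univ]

theorem prodMat_one : prodMat (fun _ : V => 1) = 1 := by
  ext s t
  simp only [prodMat, Matrix.one_apply, funext_iff]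
  rw [Finset.prod_ite_zero]; simp

theorem prodMat_conjTranspose (Q : V → Matrix (Fin 2) (Fin 2) ℂ) :
    (prodMat Q)ᴴ = prodMat fun v => (Q v)ᴴ := by
  ext s t
  simp [prodMat, Matrix.conjTranspose_apply]

end ProdMat

/-! ### Pauli matrices and spin operators -/

theorem pauli_zero : pauli 0 = 1 := rfl

theorem pauli_conjTranspose (α : Fin 4) : (pauli α)ᴴ = pauli α := by
  fin_cases α <;> ext s t <;> fin_cases s <;> fin_cases t <;>
    simp [pauli, Matrix.conjTranspose_apply]

theorem pauli_mul_self (α : Fin 4) : pauli α * pauli α = 1 := by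
  fin_cases α <;> ext s t <;> fin_cases s <;> fin_cases t <;>
    simp [pauli, Matrix.mul_apply]

theorem pauli_anticomm {α β : Fin 3} (h : α ≠ β) :
    pauli α.succ * pauli β.succ = - (pauli β.succ * pauli α.succ) := by
  revert h
  fin_cases α <;> fin_cases β <;> intro h <;> first
    | exact absurd rfl h
    | (ext s t; fin_cases s <;> fin_cases t <;> simp [pauli, Matrix.mul_apply])

theorem trace_pauli_succ (α : Fin 3) : (pauli α.succ).trace = 0 := by
  fin_cases α <;> simp [pauli, Matrix.trace]

theorem trace_pauli_mul (α β : Fin 4) :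
    (pauli α * pauli β).trace = if α = β then 2 else 0 := by
  fin_cases α <;> fin_cases β <;> simp [pauli, Matrix.trace] <;> norm_num

/-- A tensor product of Pauli matrices. -/
def pauliString {n : ℕ} (l : Fin (n + 1) → Fin 4) : Matrix (Config n) (Config n) ℂ :=
  prodMat fun v => pauli (l v)

/-- A Pauli matrix acting on the spin `v`. -/
def spin {n : ℕ} (v : Fin (n + 1)) (α : Fin 4) : Matrix (Config n) (Config n) ℂ :=
  pauliString (Pi.single v α)

section Spin

variable {n : ℕ}

theorem pauliString_conjTranspose (l : Fin (n + 1) → Fin 4) :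
    (pauliString l)ᴴ = pauliString l := by
  simp only [pauliString, prodMat_conjTranspose, pauli_conjTranspose]

theorem pauliString_mul_self (l : Fin (n + 1) → Fin 4) : pauliString l * pauliString l = 1 := by
  simp only [pauliString, prodMat_mul, pauli_mul_self, prodMat_one]

theorem spin_conjTranspose (v : Fin (n + 1)) (α : Fin 4) : (spin v α)ᴴ = spin v α :=
  pauliString_conjTranspose _

theorem spin_mul_self (v : Fin (n + 1)) (α : Fin 4) : spin v α * spin v α = 1 :=
  pauliString_mul_self _

theorem spin_zero (v : Fin (n + 1)) : spin v 0 = 1 := by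
  simp [spin, pauliString, pauli_zero, prodMat_one]

theorem spin_mul_spin {v w : Fin (n + 1)} (h : v ≠ w) (α β : Fin 4) :
    spin v α * spin w β = pauliString (Function.update (Pi.single v α) w β) := by
  rw [spin, spin, pauliString, pauliString, prodMat_mul, pauliString]
  congr 1; funext u
  rcases eq_or_ne u w with rfl | hu
  · rw [Pi.single_eq_of_ne h.symm, Function.update_self, Pi.single_eq_same, pauli_zero, one_mul]
  · rw [Function.update_of_ne hu, Pi.single_eq_of_ne hu, pauli_zero, mul_one]

theorem spin_comm {v w : Fin (n + 1)} (h : v ≠ w) (α β : Fin 4) :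
    spin v α * spin w β = spin w β * spin v α := by
  rw [spin_mul_spin h, spin_mul_spin h.symm]
  congr 1; funext u
  simp only [Function.update_apply, Pi.single_apply]
  split_ifs <;> simp_all

theorem spin_anticomm (v : Fin (n + 1)) {α β : Fin 3} (h : α ≠ β) :
    spin v α.succ * spin v β.succ = - (spin v β.succ * spin v α.succ) := by
  simp only [spin, pauliString, prodMat_mul]
  ext s t
  rw [Matrix.neg_apply]
  simp only [prodMat]
  rw [← Finset.mul_prod_erase _ _ (Finset.mem_univ v), ← Finset.mul_prod_erase _ _
    (Finset.mem_univ v), Pi.single_eq_same, Pi.single_eq_same, pauli_anticomm h,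
    Matrix.neg_apply, neg_mul]
  congr 2
  refine Finset.prod_congr rfl fun u hu => ?_
  rw [Pi.single_eq_of_ne (Finset.ne_of_mem_erase hu), Pi.single_eq_of_ne (Finset.ne_of_mem_erase hu)]

theorem onCentral_pauli (α : Fin 4) : onCentral (n := n) (pauli α) = spin 0 α := by
  ext s t
  simp only [onCentral, spin, pauliString, prodMat]
  rw [← Finset.mul_prod_erase _ _ (Finset.mem_univ 0), Pi.single_eq_same]
  rw [Finset.prod_congr rfl (g := fun v => if s v = t v then (1 : ℂ) else 0) fun u hu => by
    rw [Pi.single_eq_of_ne (Finset.ne_of_mem_erase hu), pauli_zero, Matrix.one_apply]]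
  rw [Finset.prod_ite_zero]
  simp

theorem onPair_pauli (j : Fin n) (α β : Fin 4) :
    onPair j (pauli α ⊗ₖ pauli β) = spin 0 α * spin j.succ β := by
  have h0 : (0 : Fin (n + 1)) ≠ j.succ := (Fin.succ_ne_zero j).symm
  rw [spin_mul_spin h0]
  ext s t
  simp only [onPair, pauliString, prodMat, Matrix.kroneckerMap_apply]
  have hj : j.succ ∈ Finset.univ.erase (0 : Fin (n + 1)) := by simp [h0.symm]
  rw [← Finset.mul_prod_erase _ _ (Finset.mem_univ 0), ← Finset.mul_prod_erase _ _ hj,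
    Function.update_self, Function.update_of_ne h0, Pi.single_eq_same]
  rw [Finset.prod_congr rfl (g := fun v => if s v = t v then (1 : ℂ) else 0) fun u hu => by
    have h1 := Finset.ne_of_mem_erase hu
    have h2 := Finset.ne_of_mem_erase (Finset.mem_of_mem_erase hu)
    rw [Function.update_of_ne h1, Pi.single_eq_of_ne h2, pauli_zero, Matrix.one_apply]]
  rw [Finset.prod_ite_zero]
  simp only [Finset.mem_erase, Finset.mem_univ, and_true, and_imp, mul_ite, Finset.prod_const_one,
    mul_one, mul_zero]
  congr 1
  exact propext ⟨fun h i h1 h2 => h i h2 h1, fun h i h1 h2 => h i h2 h1⟩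

theorem StarIsing.hamiltonian_eq (I : StarIsing n) :
    I.hamiltonian = ∑ α, (I.field α : ℂ) • spin 0 α.succ +
      ∑ j : Fin n, ∑ α, ∑ β, (I.coupling j α β : ℂ) • (spin 0 α * spin j.succ β.succ) := by
  rw [StarIsing.hamiltonian]
  congr 1
  · simp only [← onCentral_pauli]
    ext s t
    simp only [onCentral, StarIsing.centralTerm, Matrix.sum_apply, Matrix.smul_apply]
    split_ifs <;> simp
  · refine Finset.sum_congr rfl fun j _ => ?_
    simp only [← onPair_pauli]
    ext s t
    simp only [onPair, StarIsing.interaction, Matrix.sum_apply, Matrix.smul_apply]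
    split_ifs <;> simp

end Spin

/-! ### Positive functionals and product states -/

section Functional

variable {V : Type*} [Fintype V] [DecidableEq V]

/-- The functional `A ↦ Re tr (Bᴴ A B)`. -/
noncomputable def traceFunctional {W : Type*} [Fintype W] (B : Matrix V W ℂ) :
    Matrix V V ℂ →ₗ[ℝ] ℝ where
  toFun A := (Bᴴ * A * B).trace.re
  map_add' A A' := by simp [Matrix.mul_add, Matrix.add_mul]
  map_smul' c A := by simp

/-- Positivity of a functional on matrices. -/
def IsPositiveFunctional (ω : Matrix V V ℂ →ₗ[ℝ] ℝ) : Prop := ∀ A, 0 ≤ ω (Aᴴ * A)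

omit [DecidableEq V] in
theorem isPositiveFunctional_traceFunctional {W : Type*} [Fintype W]
    (B : Matrix V W ℂ) : IsPositiveFunctional (traceFunctional B) := by
  intro A
  have h := (posSemidef_conjTranspose_mul_self (A * B)).trace_nonneg
  rw [conjTranspose_mul] at h
  have h2 := (Complex.le_def.1 h).1
  simpa [traceFunctional, Matrix.mul_assoc] using h2

open scoped MatrixOrder in
theorem Matrix.PosSemidef.exists_eq_conjTranspose_mul_self {A : Matrix V V ℂ}
    (hA : A.PosSemidef) : ∃ B : Matrix V V ℂ, A = Bᴴ * B := by
  obtain ⟨B, hB⟩ := CStarAlgebra.nonneg_iff_eq_star_mul_self.mp hA.nonneg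
  exact ⟨B, hB⟩

theorem IsPositiveFunctional.nonneg_of_posSemidef {ω : Matrix V V ℂ →ₗ[ℝ] ℝ}
    (hω : IsPositiveFunctional ω) {A : Matrix V V ℂ} (hA : A.PosSemidef) : 0 ≤ ω A := by
  obtain ⟨B, rfl⟩ := hA.exists_eq_conjTranspose_mul_self
  exact hω B

omit [Fintype V] [DecidableEq V] in
theorem real_smul_of_ratCast (c : ℚ) (A : Matrix V V ℂ) : (c : ℂ) • A = (c : ℝ) • A := by
  ext s t
  simp [Matrix.smul_apply]

end Functional

/-- Two-by-two density matrix with given Bloch vector. -/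
noncomputable def blochMatrix (x : Fin 3 → ℝ) : Matrix (Fin 2) (Fin 2) ℂ :=
  (1 / 2 : ℂ) • (1 + ∑ α, (x α : ℂ) • pauli α.succ)

theorem blochMatrix_eq (x : Fin 3 → ℝ) : blochMatrix x =
    !![(1 + x 2 : ℂ) / 2, (x 0 - x 1 * Complex.I) / 2;
      (x 0 + x 1 * Complex.I) / 2, (1 - x 2) / 2] := by
  ext s t
  fin_cases s <;> fin_cases t <;>
    simp [blochMatrix, pauli, Fin.sum_univ_three] <;> ring

/-- The quadratic form at a vector y is half of |y|² plus the inner product of `x` with the Bloch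
vector of y, which has length |y|². Cauchy–Schwarz gives the sign. -/
theorem blochMatrix_posSemidef {x : Fin 3 → ℝ} (hx : ∑ α, x α ^ 2 ≤ 1) :
    (blochMatrix x).PosSemidef := by
  rw [Fin.sum_univ_three] at hx
  refine PosSemidef.of_dotProduct_mulVec_nonneg ?_ fun y => ?_
  · rw [blochMatrix_eq]
    ext s t
    fin_cases s <;> fin_cases t <;> simp [Matrix.conjTranspose_apply, sub_eq_add_neg]
  · rw [blochMatrix_eq, Complex.le_def]
    simp only [dotProduct, mulVec, Fin.sum_univ_two]
    simp
    constructor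
    · set a₁ := (y 0).re
      set a₂ := (y 0).im
      set b₁ := (y 1).re
      set b₂ := (y 1).im
      -- `u`, `v`, `w` are the expectations of X, Y, Z in the unnormalised vector `y`, and `p` is
      -- its squared norm.
      set u := 2 * (a₁ * b₁ + a₂ * b₂) with hu
      set v := 2 * (a₁ * b₂ - a₂ * b₁) with hv
      set w := a₁ ^ 2 + a₂ ^ 2 - b₁ ^ 2 - b₂ ^ 2 with hw
      set p := a₁ ^ 2 + a₂ ^ 2 + b₁ ^ 2 + b₂ ^ 2 with hp
      have h1 : u ^ 2 + v ^ 2 + w ^ 2 = p ^ 2 := by rw [hu, hv, hw, hp]; ring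
      have hp0 : 0 ≤ p := by positivity
      have h2 : (x 0 * u + x 1 * v + x 2 * w) ^ 2 ≤ p ^ 2 := by
        have h3 : (x 0 * u + x 1 * v + x 2 * w) ^ 2 ≤
            (x 0 ^ 2 + x 1 ^ 2 + x 2 ^ 2) * (u ^ 2 + v ^ 2 + w ^ 2) := by
          linarith [sq_nonneg (x 0 * v - x 1 * u), sq_nonneg (x 0 * w - x 2 * u),
            sq_nonneg (x 1 * w - x 2 * v)]
        rw [h1] at h3
        exact h3.trans (mul_le_of_le_one_left (sq_nonneg p) hx)
      have h4 := (abs_le_of_sq_le_sq' h2 hp0).1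
      have h5 : 0 ≤ (p + (x 0 * u + x 1 * v + x 2 * w)) / 2 := by linarith
      refine h5.trans_eq ?_
      rw [hu, hv, hw, hp]; ring
    · ring

theorem trace_blochMatrix_mul (x : Fin 3 → ℝ) (l : Fin 4) :
    (pauli l * blochMatrix x).trace = (Fin.cons 1 x : Fin 4 → ℝ) l := by
  simp only [blochMatrix, Matrix.mul_smul, Matrix.mul_add, Matrix.mul_one, Matrix.trace_smul,
    Matrix.trace_add, Matrix.mul_sum, Matrix.trace_sum, trace_pauli_mul]
  refine Fin.cases ?_ (fun β => ?_) l
  · simp [pauli_zero, (Fin.succ_ne_zero _).symm]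
  · simp [trace_pauli_succ, Fin.succ_inj]
    ring

/-- The density matrix is the tensor product of the Bloch matrices. Factoring each as `(C v)ᴴ * C v`
exhibits the state as a `traceFunctional`, which makes positivity automatic, and on Pauli strings
the trace factorises over the vertices. -/
theorem exists_productState {n : ℕ} (x : Fin (n + 1) → Fin 3 → ℝ)
    (hx : ∀ v, ∑ α, x v α ^ 2 ≤ 1) :
    ∃ ω : Matrix (Config n) (Config n) ℂ →ₗ[ℝ] ℝ, IsPositiveFunctional ω ∧ ω 1 = 1 ∧
      (∀ v α, ω (spin v α.succ) = x v α) ∧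
      ∀ v w α β, v ≠ w → ω (spin v α.succ * spin w β.succ) = x v α * x w β := by
  choose C hC using fun v => (blochMatrix_posSemidef (hx v)).exists_eq_conjTranspose_mul_self
  have key : ∀ l : Fin (n + 1) → Fin 4, traceFunctional (prodMat fun v => (C v)ᴴ) (pauliString l) =
      ∏ v, (Fin.cons 1 (x v) : Fin 4 → ℝ) (l v) := by
    intro l
    have h : ((prodMat fun v => (C v)ᴴ)ᴴ * pauliString l * prodMat fun v => (C v)ᴴ).trace =
        ∏ v, ((Fin.cons 1 (x v) : Fin 4 → ℝ) (l v) : ℂ) := by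
      rw [Matrix.trace_mul_comm, ← Matrix.mul_assoc, Matrix.trace_mul_comm, prodMat_conjTranspose,
        prodMat_mul, pauliString, prodMat_mul, trace_prodMat]
      refine Finset.prod_congr rfl fun v _ => ?_
      rw [conjTranspose_conjTranspose, ← hC, trace_blochMatrix_mul]
    change Complex.re (Matrix.trace ((prodMat fun v => (C v)ᴴ)ᴴ * pauliString l *
      prodMat fun v => (C v)ᴴ)) = _
    rw [h, ← Complex.ofReal_prod, Complex.ofReal_re]
  refine ⟨_, isPositiveFunctional_traceFunctional (prodMat fun v => (C v)ᴴ), ?_, ?_, ?_⟩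
  · rw [← spin_zero (0 : Fin (n + 1)), spin, key]
    simp
  · intro v α
    rw [spin, key, Finset.prod_eq_single v]
    · simp
    · intro w _ hw
      rw [Pi.single_eq_of_ne hw, Fin.cons_zero]
    · simp
  · intro v w α β hvw
    rw [spin_mul_spin hvw, key, Finset.prod_eq_mul v w hvw]
    · rw [Function.update_of_ne hvw, Function.update_self, Pi.single_eq_same]; simp
    · intro u _ hu
      rw [Function.update_of_ne hu.2, Pi.single_eq_of_ne hu.1, Fin.cons_zero]
    · simp
    · simp

/-! ### The Hamiltonian and its classical energy -/

namespace StarIsing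

variable {n : ℕ} (I : StarIsing n)

/-- The Hamiltonian with the bath spins outside `U` removed. -/
noncomputable def partialHamiltonian (U : Finset (Fin n)) : Matrix (Config n) (Config n) ℂ :=
  ∑ α, (I.field α : ℝ) • spin 0 α.succ + ∑ j ∈ U, ∑ β : Fin 3,
    ((I.coupling j 0 β : ℝ) • spin j.succ β.succ +
      ∑ α : Fin 3, (I.coupling j α.succ β : ℝ) • (spin 0 α.succ * spin j.succ β.succ))

theorem hamiltonian_eq_partialHamiltonian : I.hamiltonian = I.partialHamiltonian Finset.univ := by
  simp only [hamiltonian_eq, partialHamiltonian, real_smul_of_ratCast]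
  congr 1
  refine Finset.sum_congr rfl fun j _ => ?_
  rw [Finset.sum_comm]
  refine Finset.sum_congr rfl fun β _ => ?_
  rw [Fin.sum_univ_succ, spin_zero, one_mul]

/-- The energy of a product state in terms of the Bloch vectors `r` of the central spin and `q j` of
the bath spins. -/
noncomputable def classicalEnergy (r : Fin 3 → ℝ) (q : Fin n → Fin 3 → ℝ) : ℝ :=
  ∑ α, (I.field α : ℝ) * r α + ∑ j, ∑ β : Fin 3,
    ((I.coupling j 0 β : ℝ) + ∑ α : Fin 3, (I.coupling j α.succ β : ℝ) * r α) * q j β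

theorem exists_functional_eq_classicalEnergy (r : Fin 3 → ℝ) (q : Fin n → Fin 3 → ℝ)
    (hr : ∑ α, r α ^ 2 ≤ 1) (hq : ∀ j, ∑ β, q j β ^ 2 ≤ 1) :
    ∃ ω : Matrix (Config n) (Config n) ℂ →ₗ[ℝ] ℝ, IsPositiveFunctional ω ∧ ω 1 = 1 ∧
      ω I.hamiltonian = I.classicalEnergy r q := by
  obtain ⟨ω, h, h1, h2, h3⟩ := exists_productState (Fin.cons r q : Fin (n + 1) → Fin 3 → ℝ)
    (Fin.cases (by simpa using hr) (fun j => by simpa using hq j))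
  refine ⟨ω, h, h1, ?_⟩
  rw [hamiltonian_eq_partialHamiltonian, partialHamiltonian, classicalEnergy]
  simp only [map_add, map_sum, map_smul, smul_eq_mul, h2, h3 _ _ _ _ (Fin.succ_ne_zero _).symm,
    Fin.cons_zero, Fin.cons_succ, add_mul, Finset.sum_mul, mul_assoc]

theorem le_classicalEnergy {lam : ℝ} (h : (I.hamiltonian - lam • 1).PosSemidef) (r : Fin 3 → ℝ)
    (q : Fin n → Fin 3 → ℝ) (hr : ∑ α, r α ^ 2 ≤ 1) (hq : ∀ j, ∑ β, q j β ^ 2 ≤ 1) :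
    lam ≤ I.classicalEnergy r q := by
  obtain ⟨ω, hω, h1, h2⟩ := I.exists_functional_eq_classicalEnergy r q hr hq
  have := hω.nonneg_of_posSemidef h
  rw [map_sub, map_smul, h1, h2, smul_eq_mul] at this
  linarith

end StarIsing

/-! ### Conditioning a positive functional on the measurement of a spin -/

section Conditioning

variable {V : Type*} [Fintype V] [DecidableEq V] {ω : Matrix V V ℂ →ₗ[ℝ] ℝ}

/-- For a self-adjoint involution, (1 ± A)² = 2(1 ± A), so both 1 + A and 1 − A have nonnegative
value. -/
theorem IsPositiveFunctional.abs_apply_le (hω : IsPositiveFunctional ω) {A : Matrix V V ℂ}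
    (hA : Aᴴ = A) (hAA : A * A = 1) : |ω A| ≤ ω 1 := by
  have h1 := hω (1 + A)
  have h2 := hω (1 - A)
  have e1 : (1 + A)ᴴ * (1 + A) = (2 : ℝ) • (1 + A) := by
    rw [conjTranspose_add, conjTranspose_one, hA, add_mul, mul_add, mul_add, hAA, two_smul]
    simp only [one_mul, mul_one]; abel
  have e2 : (1 - A)ᴴ * (1 - A) = (2 : ℝ) • (1 - A) := by
    rw [conjTranspose_sub, conjTranspose_one, hA, sub_mul, mul_sub, mul_sub, hAA, two_smul]
    simp only [one_mul, mul_one]; abel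
  rw [e1, map_smul, map_add, smul_eq_mul] at h1
  rw [e2, map_smul, map_sub, smul_eq_mul] at h2
  rw [abs_le]; constructor <;> linarith

theorem IsPositiveFunctional.one_nonneg (hω : IsPositiveFunctional ω) : 0 ≤ ω 1 := by
  simpa using hω 1

/-- The functional `A ↦ ω (M A M)` with `M = (1 + σ X) / 2`. -/
noncomputable def conditioned (ω : Matrix V V ℂ →ₗ[ℝ] ℝ) (X : Matrix V V ℂ) (σ : ℝ) :
    Matrix V V ℂ →ₗ[ℝ] ℝ :=
  ω.comp ((LinearMap.mulLeft ℝ ((1 / 2 : ℝ) • (1 + σ • X))).comp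
    (LinearMap.mulRight ℝ ((1 / 2 : ℝ) • (1 + σ • X))))

theorem conditioned_isPositive (hω : IsPositiveFunctional ω) {X : Matrix V V ℂ} (hX : Xᴴ = X)
    (σ : ℝ) : IsPositiveFunctional (conditioned ω X σ) := by
  intro A
  have h := hω (A * ((1 / 2 : ℝ) • (1 + σ • X)))
  rw [conjTranspose_mul, conjTranspose_smul, conjTranspose_add, conjTranspose_smul, hX,
    conjTranspose_one, star_trivial, star_trivial] at h
  simpa [conditioned, Matrix.mul_assoc] using h

/-- For σ = ±1 the matrix M = (1 + σX)/2 is idempotent and commutes with `A`, so MAM = AM. In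
particular the two outcomes add up to `ω` on everything commuting with `X`. -/
theorem conditioned_apply {X : Matrix V V ℂ} (hXX : X * X = 1) {σ : ℝ} (hσ : σ * σ = 1)
    {A : Matrix V V ℂ} (hA : Commute A X) :
    conditioned ω X σ A = (ω A + σ * ω (A * X)) / 2 := by
  have e : ((1 / 2 : ℝ) • (1 + σ • X)) * (A * ((1 / 2 : ℝ) • (1 + σ • X))) =
      (1 / 2 : ℝ) • (A + σ • (A * X)) := by
    have h1 : (1 + σ • X) * (1 + σ • X) = (2 : ℝ) • (1 + σ • X) := by
      rw [add_mul, mul_add, mul_add, smul_mul_smul_comm, hσ, hXX, two_smul, one_smul]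
      simp only [one_mul, mul_one]; abel
    have h2 : Commute A (1 + σ • X) := (Commute.one_right A).add_right (hA.smul_right σ)
    rw [smul_mul_assoc, mul_smul_comm, mul_smul_comm, ← mul_assoc, ← h2.eq, mul_assoc, h1,
      mul_smul_comm, smul_smul, smul_smul, mul_add, mul_one, mul_smul_comm]
    norm_num
  rw [conditioned, LinearMap.comp_apply, LinearMap.comp_apply, LinearMap.mulLeft_apply,
    LinearMap.mulRight_apply, e, map_smul, map_add, map_smul, smul_eq_mul, smul_eq_mul]
  ring

end Conditioning

/-! ### The Bloch ball and the purity of a spin -/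

theorem smul_add_smul_add_smul_sq {R : Type*} [Ring R] [Algebra ℝ R] {A B C : R} (hA : A * A = 1)
    (hB : B * B = 1) (hC : C * C = 1) (hAB : A * B = -(B * A)) (hAC : A * C = -(C * A))
    (hBC : B * C = -(C * B)) (a b c : ℝ) :
    (a • A + b • B + c • C) * (a • A + b • B + c • C) = (a ^ 2 + b ^ 2 + c ^ 2) • (1 : R) := by
  simp only [add_mul, mul_add, smul_mul_smul_comm, hA, hB, hC, hAB, hAC, hBC, add_smul, pow_two,
    smul_neg]
  rw [mul_comm b a, mul_comm c a, mul_comm c b]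
  abel

theorem IsPositiveFunctional.sum_sq_spin_le {n : ℕ} {ω : Matrix (Config n) (Config n) ℂ →ₗ[ℝ] ℝ}
    (hω : IsPositiveFunctional ω) (v : Fin (n + 1)) :
    ∑ α : Fin 3, ω (spin v α.succ) ^ 2 ≤ ω 1 ^ 2 := by
  set x : Fin 3 → ℝ := fun α => ω (spin v α.succ) with hx
  set S : Matrix (Config n) (Config n) ℂ := ∑ α : Fin 3, x α • spin v α.succ with hS
  have hSS : S * S = (∑ α, x α ^ 2) • 1 := by
    rw [hS, Fin.sum_univ_three, Fin.sum_univ_three]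
    exact smul_add_smul_add_smul_sq (spin_mul_self _ _) (spin_mul_self _ _) (spin_mul_self _ _)
      (spin_anticomm _ (by decide)) (spin_anticomm _ (by decide)) (spin_anticomm _ (by decide)) _ _ _
  have hSH : Sᴴ = S := by
    rw [hS, conjTranspose_sum]
    simp only [conjTranspose_smul, spin_conjTranspose, star_trivial]
  have hωS : ω S = ∑ α, x α ^ 2 := by
    rw [hS, map_sum]
    simp only [map_smul, smul_eq_mul, pow_two, hx]
  set s := ∑ α, x α ^ 2 with hs
  -- By anticommutation the spin component `S` along the Bloch vector squares to the scalar `s`, so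
  -- this is positivity of `ω` on the square of t − S. Taking t = ω 1 gives the bound. If ω 1 = 0,
  -- then t = 1 forces `s` to vanish.
  have key : ∀ t : ℝ, 0 ≤ t ^ 2 * ω 1 - 2 * t * s + s * ω 1 := by
    intro t
    have h := hω (t • 1 - S)
    have e : (t • (1 : Matrix (Config n) (Config n) ℂ) - S)ᴴ * (t • 1 - S) =
        t ^ 2 • 1 - (2 * t) • S + s • 1 := by
      rw [conjTranspose_sub, conjTranspose_smul, conjTranspose_one, hSH, star_trivial, sub_mul,
        mul_sub, mul_sub, hSS, smul_mul_smul_comm, smul_mul_assoc, mul_smul_comm, pow_two, two_mul,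
        add_smul]
      simp only [one_mul, mul_one]; abel
    rw [e, map_add, map_sub, map_smul, map_smul, map_smul, hωS] at h
    simpa only [smul_eq_mul] using h
  rcases hω.one_nonneg.eq_or_lt with h0 | h0
  · have := key 1
    rw [← h0] at this ⊢
    linarith
  · have h1 := key (ω 1)
    have h2 : 0 ≤ ω 1 * (ω 1 ^ 2 - s) := by linarith
    linarith [nonneg_of_mul_nonneg_right h2 h0]

/-- The purity gained by conditioning. -/
theorem purity_identity {p q : ℝ} (hp : 0 < p) (h1 : 0 < p + q) (h2 : 0 < p - q) (u w : ℝ) :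
    ((u + w) / 2) ^ 2 / ((p + q) / 2) + ((u - w) / 2) ^ 2 / ((p - q) / 2) =
      u ^ 2 / p + (w * p - u * q) ^ 2 / (p * ((p + q) * (p - q))) := by
  field_simp
  ring

/-! ### Mean-field decoupling by measurements -/

namespace StarIsing

variable {n : ℕ} (I : StarIsing n)

/-- This is what makes measuring a bath spin free once its interaction has been discarded: the
energy of the rest splits exactly between the two outcomes. -/
theorem commute_partialHamiltonian {U : Finset (Fin n)} {j : Fin n} (hj : j ∉ U) (γ : Fin 4) :
    Commute (I.partialHamiltonian U) (spin j.succ γ) := by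
  have h0 : ∀ α, Commute (spin (n := n) 0 α) (spin j.succ γ) := fun α =>
    spin_comm (Fin.succ_ne_zero j).symm α γ
  refine .add_left (.sum_left _ _ _ fun α _ => (h0 _).smul_left _)
    (.sum_left _ _ _ fun i hi => .sum_left _ _ _ fun β _ => ?_)
  have hij : i.succ ≠ j.succ := fun h => hj (Fin.succ_injective _ h ▸ hi)
  have h1 : Commute (spin (n := n) i.succ β.succ) (spin j.succ γ) := spin_comm hij _ _
  exact .add_left (h1.smul_left _) (.sum_left _ _ _ fun α _ => ((h0 _).mul_left h1).smul_left _)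

theorem conjTranspose_spin_mul_spin {v w : Fin (n + 1)} (h : v ≠ w) (α β : Fin 4) :
    (spin v α * spin w β)ᴴ = spin v α * spin w β := by
  rw [spin_mul_spin h, pauliString_conjTranspose]

theorem spin_mul_spin_mul_self {v w : Fin (n + 1)} (h : v ≠ w) (α β : Fin 4) :
    (spin v α * spin w β) * (spin v α * spin w β) = 1 := by
  rw [spin_mul_spin h, pauliString_mul_self]

variable {I} {ω : Matrix (Config n) (Config n) ℂ →ₗ[ℝ] ℝ}

/-- If the central spin is nearly uncorrelated with the bath spins in `U`, the energy is nearly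
classical. -/
theorem le_apply_of_uncorrelated {b δ L : ℝ} (hδ : 0 < δ) (hb0 : 0 ≤ b)
    (hb : ∀ j α β, |(I.coupling j α β : ℝ)| ≤ b)
    (hL : ∀ r q, ∑ α, r α ^ 2 ≤ 1 → (∀ j, ∑ β, q j β ^ 2 ≤ 1) → L ≤ I.classicalEnergy r q)
    (hω : IsPositiveFunctional ω) (h1 : 0 < ω 1) (U : Finset (Fin n))
    (hU : ∀ j ∈ U, ∀ α β : Fin 3, |ω (spin 0 α.succ * spin j.succ β.succ) * ω 1 -
      ω (spin 0 α.succ) * ω (spin j.succ β.succ)| ≤ δ * ω 1 ^ 2) :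
    ω 1 * (L - 9 * b * δ * n) ≤ ω (I.partialHamiltonian U) := by
  set p := ω 1 with hp
  set r : Fin 3 → ℝ := fun α => ω (spin 0 α.succ) / p with hr
  -- A discarded bath spin gets Bloch vector 0, so it contributes nothing to the classical energy,
  -- which can then be compared with `L`.
  set q : Fin n → Fin 3 → ℝ := fun j β => if j ∈ U then ω (spin j.succ β.succ) / p else 0 with hq
  have ball : ∀ v : Fin (n + 1), ∑ α : Fin 3, (ω (spin v α.succ) / p) ^ 2 ≤ 1 := by
    intro v
    simp only [div_pow, ← Finset.sum_div]
    exact (div_le_one (by positivity)).2 (hω.sum_sq_spin_le v)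
  have hLrq := hL r q (ball 0) fun j => by
    by_cases hj : j ∈ U
    · simp only [hq, if_pos hj]; exact ball _
    · simp [hq, if_neg hj]
  have hcl : I.classicalEnergy r q = ∑ α, (I.field α : ℝ) * r α + ∑ j ∈ U, ∑ β : Fin 3,
      ((I.coupling j 0 β : ℝ) + ∑ α : Fin 3, (I.coupling j α.succ β : ℝ) * r α) *
        (ω (spin j.succ β.succ) / p) := by
    rw [classicalEnergy]
    congr 1
    rw [← Finset.sum_subset (Finset.subset_univ U) fun j _ hj => ?_]
    · refine Finset.sum_congr rfl fun j hj => ?_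
      simp only [hq, if_pos hj]
    · simp [hq, if_neg hj]
  -- Factorising one quadratic term costs at most `b * δ * p`. A bath spin has three such terms for
  -- each of three `β`, which is the constant 9 in the conclusion.
  have hterm : ∀ j ∈ U, ∀ β : Fin 3,
      p * (((I.coupling j 0 β : ℝ) + ∑ α : Fin 3, (I.coupling j α.succ β : ℝ) * r α) *
        (ω (spin j.succ β.succ) / p)) - 3 * (b * (δ * p)) ≤
      (I.coupling j 0 β : ℝ) * ω (spin j.succ β.succ) + ∑ α : Fin 3,
        (I.coupling j α.succ β : ℝ) * ω (spin 0 α.succ * spin j.succ β.succ) := by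
    intro j hj β
    have h2 : ∀ α : Fin 3, (I.coupling j α.succ β : ℝ) * r α * ω (spin j.succ β.succ) -
        b * (δ * p) ≤
        (I.coupling j α.succ β : ℝ) * ω (spin 0 α.succ * spin j.succ β.succ) := by
      intro α
      have h3 := hU j hj α β
      have h4 : |ω (spin 0 α.succ * spin j.succ β.succ) - r α * ω (spin j.succ β.succ)| ≤
          δ * p := by
        rw [← mul_le_mul_iff_left₀ h1, ← abs_of_pos h1, ← abs_mul, abs_of_pos h1]
        refine (le_of_eq ?_).trans (h3.trans_eq (by ring))
        congr 1; rw [hr]; field_simp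
      have h5 := abs_le.1 ((abs_mul _ _).trans_le
        (mul_le_mul (hb j α.succ β) h4 (abs_nonneg _) hb0))
      linarith [h5.1, h5.2]
    have h6 := Finset.sum_le_sum fun α (_ : α ∈ (Finset.univ : Finset (Fin 3))) => h2 α
    rw [Finset.sum_sub_distrib, Finset.sum_const, Finset.card_univ, Fintype.card_fin,
      ← Finset.sum_mul, nsmul_eq_mul] at h6
    have h7 : p * (((I.coupling j 0 β : ℝ) + ∑ α : Fin 3, (I.coupling j α.succ β : ℝ) * r α) *
        (ω (spin j.succ β.succ) / p)) = (I.coupling j 0 β : ℝ) * ω (spin j.succ β.succ) +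
        (∑ α : Fin 3, (I.coupling j α.succ β : ℝ) * r α) * ω (spin j.succ β.succ) := by
      field_simp
    rw [h7]
    push_cast at h6
    linarith
  have hsum := Finset.sum_le_sum fun j hj => Finset.sum_le_sum fun β
    (_ : β ∈ (Finset.univ : Finset (Fin 3))) => hterm j hj β
  have hcard : (U.card : ℝ) ≤ n := by exact_mod_cast (card_finset_fin_le U)
  simp only [Finset.sum_sub_distrib, Finset.sum_const, Finset.card_univ, Fintype.card_fin,
    nsmul_eq_mul, ← Finset.mul_sum] at hsum
  have hfield : p * ∑ α, (I.field α : ℝ) * r α = ∑ α, (I.field α : ℝ) * ω (spin 0 α.succ) := by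
    rw [Finset.mul_sum]
    refine Finset.sum_congr rfl fun α _ => ?_
    rw [hr]; field_simp
  have hH : ω (I.partialHamiltonian U) = ∑ α, (I.field α : ℝ) * ω (spin 0 α.succ) +
      ∑ j ∈ U, ∑ β : Fin 3, ((I.coupling j 0 β : ℝ) * ω (spin j.succ β.succ) + ∑ α : Fin 3,
        (I.coupling j α.succ β : ℝ) * ω (spin 0 α.succ * spin j.succ β.succ)) := by
    simp only [partialHamiltonian, map_add, map_sum, map_smul, smul_eq_mul]
  rw [hH]
  have hLp := mul_le_mul_of_nonneg_left hLrq h1.le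
  rw [hcl, mul_add, hfield] at hLp
  have hn : (U.card : ℝ) * (3 * (3 * (b * (δ * p)))) ≤ n * (3 * (3 * (b * (δ * p)))) := by gcongr
  push_cast at hsum
  linarith

end StarIsing

namespace StarIsing

variable {n : ℕ} {I : StarIsing n} {ω : Matrix (Config n) (Config n) ℂ →ₗ[ℝ] ℝ}

theorem partialHamiltonian_eq_erase_add (I : StarIsing n) {U : Finset (Fin n)} {j : Fin n}
    (hj : j ∈ U) :
    I.partialHamiltonian U = I.partialHamiltonian (U.erase j) + ∑ β : Fin 3,
      ((I.coupling j 0 β : ℝ) • spin j.succ β.succ +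
        ∑ α : Fin 3, (I.coupling j α.succ β : ℝ) • (spin 0 α.succ * spin j.succ β.succ)) := by
  rw [partialHamiltonian, partialHamiltonian, ← Finset.sum_erase_add _ _ hj, add_assoc]

/-- The price of discarding a bath spin: twelve Pauli terms, each with coefficient at most `b` and
expectation at most `ω 1` in absolute value. -/
theorem le_apply_interaction {b : ℝ} (hb : ∀ j α β, |(I.coupling j α β : ℝ)| ≤ b)
    (hω : IsPositiveFunctional ω) (j : Fin n) :
    -(12 * b * ω 1) ≤ ω (∑ β : Fin 3, ((I.coupling j 0 β : ℝ) • spin j.succ β.succ +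
      ∑ α : Fin 3, (I.coupling j α.succ β : ℝ) • (spin 0 α.succ * spin j.succ β.succ))) := by
  have h1 : ∀ (c : ℝ) (A : Matrix (Config n) (Config n) ℂ), |c| ≤ b → |ω A| ≤ ω 1 →
      -(b * ω 1) ≤ c * ω A := fun c A hc hA =>
    (abs_le.1 ((abs_mul c (ω A)).trans_le
      (mul_le_mul hc hA (abs_nonneg _) ((abs_nonneg _).trans hc)))).1
  have h2 : ∀ β : Fin 3, -(b * ω 1) ≤ (I.coupling j 0 β : ℝ) * ω (spin j.succ β.succ) := fun β =>
    h1 _ _ (hb j 0 β) (hω.abs_apply_le (spin_conjTranspose _ _) (spin_mul_self _ _))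
  have h3 : ∀ α β : Fin 3, -(b * ω 1) ≤
      (I.coupling j α.succ β : ℝ) * ω (spin 0 α.succ * spin j.succ β.succ) := fun α β =>
    h1 _ _ (hb j _ β) (hω.abs_apply_le
      (conjTranspose_spin_mul_spin (Fin.succ_ne_zero j).symm _ _)
      (spin_mul_spin_mul_self (Fin.succ_ne_zero j).symm _ _))
  simp only [map_add, map_smul, smul_eq_mul, Fin.sum_univ_three]
  linarith [h2 0, h2 1, h2 2, h3 0 0, h3 0 1, h3 0 2, h3 1 0, h3 1 1, h3 1 2, h3 2 0, h3 2 1,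
    h3 2 2]

/-- The purity of the central spin increases when a correlated bath spin is measured. -/
theorem purity_le_conditioned {δ : ℝ} (hδ : 0 < δ) (hω : IsPositiveFunctional ω) (h0 : 0 < ω 1)
    {j : Fin n} {α β : Fin 3} (h : δ * ω 1 ^ 2 < |ω (spin 0 α.succ * spin j.succ β.succ) * ω 1 -
      ω (spin 0 α.succ) * ω (spin j.succ β.succ)|) :
    (∑ α : Fin 3, ω (spin 0 α.succ) ^ 2) / ω 1 + δ ^ 2 * ω 1 ≤
      (∑ α : Fin 3, conditioned ω (spin j.succ β.succ) 1 (spin 0 α.succ) ^ 2) /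
        conditioned ω (spin j.succ β.succ) 1 1 +
      (∑ α : Fin 3, conditioned ω (spin j.succ β.succ) (-1) (spin 0 α.succ) ^ 2) /
        conditioned ω (spin j.succ β.succ) (-1) 1 := by
  set X := spin j.succ β.succ with hX
  have hXX : X * X = 1 := spin_mul_self _ _
  have hXH : Xᴴ = X := spin_conjTranspose _ _
  have hc : ∀ γ, Commute (spin 0 γ) X := fun γ => spin_comm (Fin.succ_ne_zero j).symm _ _
  have e1 : ∀ γ, conditioned ω X 1 (spin 0 γ) = (ω (spin 0 γ) + ω (spin 0 γ * X)) / 2 := fun γ => by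
    rw [conditioned_apply hXX (by norm_num) (hc γ), one_mul]
  have e2 : ∀ γ, conditioned ω X (-1) (spin 0 γ) = (ω (spin 0 γ) - ω (spin 0 γ * X)) / 2 :=
    fun γ => by
      rw [conditioned_apply hXX (by norm_num) (hc γ)]; ring
  have p1 : conditioned ω X 1 1 = (ω 1 + ω X) / 2 := by
    rw [conditioned_apply hXX (by norm_num) (Commute.one_left X), one_mul, one_mul]
  have p2 : conditioned ω X (-1) 1 = (ω 1 - ω X) / 2 := by
    rw [conditioned_apply hXX (by norm_num) (Commute.one_left X), one_mul]; ring
  have b1 := (conditioned_isPositive hω hXH 1).abs_apply_le (spin_conjTranspose 0 α.succ)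
    (spin_mul_self 0 α.succ)
  have b2 := (conditioned_isPositive hω hXH (-1)).abs_apply_le (spin_conjTranspose 0 α.succ)
    (spin_mul_self 0 α.succ)
  have n1 := (conditioned_isPositive hω hXH 1).one_nonneg
  have n2 := (conditioned_isPositive hω hXH (-1)).one_nonneg
  rw [e1, p1] at b1
  rw [e2, p2] at b2
  rw [p1] at n1
  rw [p2] at n2
  have hpos : 0 < δ * ω 1 ^ 2 := by positivity
  -- Both outcomes have positive weight: if one had weight zero, its conditioned functional would
  -- kill the central spin component and the correlation in `h` would vanish.
  have q1 : 0 < ω 1 + ω X := by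
    by_contra hq
    have hq' : ω X = - ω 1 := by linarith
    rw [hq'] at b1 h
    have := abs_nonpos_iff.1 (b1.trans_eq (by ring))
    have hw : ω (spin 0 α.succ * X) = - ω (spin 0 α.succ) := by linarith
    rw [hw] at h
    have : -ω (spin 0 α.succ) * ω 1 - ω (spin 0 α.succ) * -ω 1 = 0 := by ring
    rw [this, abs_zero] at h
    linarith
  have q2 : 0 < ω 1 - ω X := by
    by_contra hq
    have hq' : ω X = ω 1 := by linarith
    rw [hq'] at b2 h
    have := abs_nonpos_iff.1 (b2.trans_eq (by ring))
    have hw : ω (spin 0 α.succ * X) = ω (spin 0 α.succ) := by linarith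
    rw [hw] at h
    rw [sub_self, abs_zero] at h
    linarith
  have hterm : ∀ γ : Fin 3, conditioned ω X 1 (spin 0 γ.succ) ^ 2 / conditioned ω X 1 1 +
      conditioned ω X (-1) (spin 0 γ.succ) ^ 2 / conditioned ω X (-1) 1 =
      ω (spin 0 γ.succ) ^ 2 / ω 1 + (ω (spin 0 γ.succ * X) * ω 1 - ω (spin 0 γ.succ) * ω X) ^ 2 /
        (ω 1 * ((ω 1 + ω X) * (ω 1 - ω X))) := fun γ => by
    rw [e1, e2, p1, p2, purity_identity h0 q1 q2]
  rw [Finset.sum_div, Finset.sum_div, Finset.sum_div, ← Finset.sum_add_distrib]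
  simp only [hterm]
  rw [Finset.sum_add_distrib]
  gcongr
  have hden : 0 < ω 1 * ((ω 1 + ω X) * (ω 1 - ω X)) := by positivity
  have hnn : ∀ γ ∈ (Finset.univ : Finset (Fin 3)), 0 ≤
      (ω (spin 0 γ.succ * X) * ω 1 - ω (spin 0 γ.succ) * ω X) ^ 2 /
        (ω 1 * ((ω 1 + ω X) * (ω 1 - ω X))) := fun γ _ => by positivity
  refine le_trans ?_ (Finset.single_le_sum hnn (Finset.mem_univ α))
  rw [le_div_iff₀ hden]
  have hsq : (δ * ω 1 ^ 2) ^ 2 ≤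
      (ω (spin 0 α.succ * X) * ω 1 - ω (spin 0 α.succ) * ω X) ^ 2 := by
    rw [← sq_abs (ω (spin 0 α.succ * X) * ω 1 - ω (spin 0 α.succ) * ω X)]
    exact pow_le_pow_left₀ hpos.le h.le 2
  refine le_trans ?_ hsq
  -- The denominator is `ω 1 * (ω 1 ^ 2 - ω X ^ 2)`, so omitting the square of `ω X` only weakens
  -- the gain.
  have : 0 ≤ δ ^ 2 * ω 1 ^ 2 * ω X ^ 2 := by positivity
  nlinarith

/-- Mean-field lower bound: repeatedly measuring correlated bath spins decouples the central spin
from the others. -/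
theorem le_apply_partialHamiltonian {b δ L : ℝ} (hδ : 0 < δ) (hb0 : 0 ≤ b)
    (hb : ∀ j α β, |(I.coupling j α β : ℝ)| ≤ b)
    (hL : ∀ r q, ∑ α, r α ^ 2 ≤ 1 → (∀ j, ∑ β, q j β ^ 2 ≤ 1) → L ≤ I.classicalEnergy r q)
    (U : Finset (Fin n)) (hω : IsPositiveFunctional ω) :
    ω 1 * (L - 9 * b * δ * n - 12 * b / δ ^ 2) +
      12 * b / δ ^ 2 * ((∑ α : Fin 3, ω (spin 0 α.succ) ^ 2) / ω 1) ≤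
      ω (I.partialHamiltonian U) := by
  induction U using Finset.strongInduction generalizing ω with
  | H U ih =>
  have hK : 0 ≤ 12 * b / δ ^ 2 := by positivity
  set K := 12 * b / δ ^ 2 with hKdef
  rcases hω.one_nonneg.eq_or_lt with h0 | h0
  -- A functional of mass zero vanishes on all Pauli terms, and the purity quotient is then a
  -- division by 0 with value 0.
  · have hz : ∀ A : Matrix (Config n) (Config n) ℂ, Aᴴ = A → A * A = 1 → ω A = 0 :=
      fun A h1 h2 => abs_nonpos_iff.1 ((hω.abs_apply_le h1 h2).trans_eq h0.symm)
    have h1 : ω (I.partialHamiltonian U) = 0 := by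
      simp only [partialHamiltonian, map_add, map_sum, map_smul, hz _ (spin_conjTranspose _ _)
        (spin_mul_self _ _), hz _ (conjTranspose_spin_mul_spin (Fin.succ_ne_zero _).symm _ _)
        (spin_mul_spin_mul_self (Fin.succ_ne_zero _).symm _ _), smul_zero,
        Finset.sum_const_zero, add_zero]
    rw [h1, ← h0]; simp
  by_cases hcorr : ∀ j ∈ U, ∀ α β : Fin 3, |ω (spin 0 α.succ * spin j.succ β.succ) * ω 1 -
      ω (spin 0 α.succ) * ω (spin j.succ β.succ)| ≤ δ * ω 1 ^ 2
  · have h1 := le_apply_of_uncorrelated hδ hb0 hb hL hω h0 U hcorr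
    have h2 : (∑ α : Fin 3, ω (spin 0 α.succ) ^ 2) / ω 1 ≤ ω 1 := by
      rw [div_le_iff₀ h0, ← pow_two]; exact hω.sum_sq_spin_le 0
    have h3 := mul_le_mul_of_nonneg_left h2 hK
    linarith
  · push Not at hcorr
    obtain ⟨j, hj, α, β, h⟩ := hcorr
    have hpur := mul_le_mul_of_nonneg_left (purity_le_conditioned hδ hω h0 h) hK
    set X := spin j.succ β.succ with hX
    have hXX : X * X = 1 := spin_mul_self _ _
    have hXH : Xᴴ = X := spin_conjTranspose _ _
    have hsplit : ∀ A, Commute A X → ω A = conditioned ω X 1 A + conditioned ω X (-1) A := by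
      intro A hA
      rw [conditioned_apply hXX (by norm_num) hA, conditioned_apply hXX (by norm_num) hA]; ring
    have i1 := ih _ (Finset.erase_ssubset hj) (conditioned_isPositive hω hXH 1)
    have i2 := ih _ (Finset.erase_ssubset hj) (conditioned_isPositive hω hXH (-1))
    have hH := hsplit _ (I.commute_partialHamiltonian (Finset.notMem_erase j U) β.succ)
    have h1 := hsplit 1 (Commute.one_left X)
    have hint := le_apply_interaction hb hω j
    rw [partialHamiltonian_eq_erase_add I hj, map_add, hH]
    -- `K` is chosen so that the gain in purity pays exactly for the discarded interaction. Adding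
    -- the induction hypotheses of the two outcomes then closes the step.
    have hKδ : K * (δ ^ 2 * ω 1) = 12 * b * ω 1 := by rw [hKdef]; field_simp
    rw [mul_add, hKδ, mul_add] at hpur
    have hsum : ω 1 * (L - 9 * b * δ * n - K) =
        conditioned ω X 1 1 * (L - 9 * b * δ * n - K) +
        conditioned ω X (-1) 1 * (L - 9 * b * δ * n - K) := by rw [h1]; ring
    linarith

end StarIsing

/-! ### The spectrum of the Hamiltonian -/

namespace StarIsing

variable {n : ℕ} (I : StarIsing n)

theorem hamiltonian_isHermitian : I.hamiltonian.IsHermitian := by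
  rw [IsHermitian, hamiltonian_eq_partialHamiltonian, partialHamiltonian]
  simp only [conjTranspose_add, conjTranspose_sum, conjTranspose_smul, star_trivial,
    spin_conjTranspose, conjTranspose_spin_mul_spin (Fin.succ_ne_zero _).symm]

/-- Spectral data of the Hamiltonian. -/
theorem exists_spectrum : ∃ (μ : Config n → ℝ) (s₀ : Config n), (∀ s, μ s₀ ≤ μ s) ∧
    I.IsGroundEnergy (μ s₀) ∧ (∀ c : ℝ, (∀ s, c ≤ μ s) → (I.hamiltonian - c • 1).PosSemidef) ∧
    (∀ c d : ℝ, ∀ N : ℕ, ((d • (c • 1 - I.hamiltonian)) ^ N).trace =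
      ((∑ s, (d * (c - μ s)) ^ N : ℝ) : ℂ)) ∧
    ∀ s, ∃ ω : Matrix (Config n) (Config n) ℂ →ₗ[ℝ] ℝ, IsPositiveFunctional ω ∧ 0 < ω 1 ∧
      ω I.hamiltonian = μ s * ω 1 := by
  obtain ⟨U, μ, hUU, hUU', hspec, hrange⟩ : ∃ (U : Matrix (Config n) (Config n) ℂ)
      (μ : Config n → ℝ), U * Uᴴ = 1 ∧ Uᴴ * U = 1 ∧
      I.hamiltonian = U * diagonal (fun s => (μ s : ℂ)) * Uᴴ ∧
      spectrum ℂ I.hamiltonian = (fun x : ℝ => (x : ℂ)) '' Set.range μ := by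
    have hA := I.hamiltonian_isHermitian
    exact ⟨hA.eigenvectorUnitary.1, hA.eigenvalues,
      Unitary.coe_mul_star_self hA.eigenvectorUnitary,
      Unitary.coe_star_mul_self hA.eigenvectorUnitary, hA.spectral_theorem,
      hA.spectrum_eq_image_range⟩
  obtain ⟨s₀, hs₀⟩ := Finite.exists_min μ
  have hshift : ∀ c d : ℝ, d • (c • 1 - I.hamiltonian) =
      U * diagonal (fun s => ((d * (c - μ s) : ℝ) : ℂ)) * Uᴴ := by
    intro c d
    have h1 : diagonal (fun s => ((d * (c - μ s) : ℝ) : ℂ)) =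
        d • (c • 1 - diagonal (fun s => (μ s : ℂ))) := by
      ext s t
      rcases eq_or_ne s t with rfl | h
      · simp
      · simp [h]
    rw [h1, mul_smul_comm, smul_mul_assoc, mul_sub, sub_mul, mul_smul_comm, smul_mul_assoc,
      mul_one, hUU, ← hspec]
  refine ⟨μ, s₀, hs₀, ⟨?_, ?_⟩, ?_, ?_, ?_⟩
  · have : ((μ s₀ : ℝ) : ℂ) ∈ spectrum ℂ I.hamiltonian := by
      rw [hrange]
      exact ⟨_, ⟨s₀, rfl⟩, rfl⟩
    rw [Set.mem_ofPred_eq, Module.End.hasEigenvalue_iff_mem_spectrum, Matrix.spectrum_toLin']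
    exact this
  · intro x hx
    rw [Set.mem_ofPred_eq, Module.End.hasEigenvalue_iff_mem_spectrum, Matrix.spectrum_toLin',
      hrange] at hx
    obtain ⟨_, ⟨s, rfl⟩, hs⟩ := hx
    have : μ s = x := Complex.ofReal_injective hs
    exact this ▸ hs₀ s
  · intro c hc
    have h1 : I.hamiltonian - c • 1 = (-1 : ℝ) • (c • 1 - I.hamiltonian) := by
      rw [neg_smul, one_smul, neg_sub]
    rw [h1, hshift]
    refine PosSemidef.mul_mul_conjTranspose_same (PosSemidef.diagonal fun s => ?_) U
    rw [Pi.zero_apply, Complex.zero_le_real]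
    linarith [hc s]
  · intro c d N
    have hpow : ∀ N : ℕ, (d • (c • 1 - I.hamiltonian)) ^ N =
        U * diagonal (fun s => ((d * (c - μ s) : ℝ) : ℂ)) ^ N * Uᴴ := by
      intro N
      induction N with
      | zero => rw [pow_zero, pow_zero, mul_one, hUU]
      | succ N ih =>
        rw [pow_succ, ih, hshift, pow_succ]
        generalize diagonal (fun s => ((d * (c - μ s) : ℝ) : ℂ)) = D
        calc U * D ^ N * Uᴴ * (U * D * Uᴴ) = U * D ^ N * (Uᴴ * U) * D * Uᴴ := by
              simp only [Matrix.mul_assoc]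
          _ = U * (D ^ N * D) * Uᴴ := by rw [hUU', Matrix.mul_one]; simp only [Matrix.mul_assoc]
    rw [hpow, Matrix.trace_mul_comm, ← Matrix.mul_assoc, hUU', Matrix.one_mul,
      Matrix.diagonal_pow, Matrix.trace_diagonal]
    push_cast
    rfl
  · intro s
    have hcol : I.hamiltonian * U = U * diagonal (fun s => (μ s : ℂ)) := by
      rw [hspec, Matrix.mul_assoc, hUU', Matrix.mul_one]
    -- Only column `s` of `U` survives, so `traceFunctional B` is the state of the eigenvector
    -- number `s`.
    set B : Matrix (Config n) (Config n) ℂ := U * diagonal (Pi.single s 1) with hB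
    have hdd : diagonal (fun s => (μ s : ℂ)) * diagonal (Pi.single s 1) =
        (μ s) • diagonal (Pi.single s (1 : ℂ)) := by
      rw [diagonal_mul_diagonal]
      ext x y
      rcases eq_or_ne x y with rfl | h
      · rcases eq_or_ne x s with rfl | h'
        · simp
        · simp [h']
      · simp [h]
    have hHB : I.hamiltonian * B = μ s • B := by
      rw [hB, ← Matrix.mul_assoc, hcol, Matrix.mul_assoc, hdd, Matrix.mul_smul]
    have h1 : traceFunctional B 1 = 1 := by
      change Complex.re (Matrix.trace (Bᴴ * 1 * B)) = 1
      rw [Matrix.mul_one, hB, conjTranspose_mul, Matrix.mul_assoc, ← Matrix.mul_assoc Uᴴ, hUU',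
        Matrix.one_mul, diagonal_conjTranspose, diagonal_mul_diagonal, trace_diagonal]
      rw [Finset.sum_eq_single s] <;> simp +contextual
    refine ⟨traceFunctional B, isPositiveFunctional_traceFunctional B, by rw [h1]; norm_num, ?_⟩
    rw [h1, mul_one]
    have h2 : traceFunctional B I.hamiltonian = μ s * traceFunctional B 1 := by
      change Complex.re (Matrix.trace (Bᴴ * I.hamiltonian * B)) =
        _ * Complex.re (Matrix.trace (Bᴴ * 1 * B))
      rw [Matrix.mul_assoc, hHB, Matrix.mul_smul, Matrix.mul_one, trace_smul, Complex.smul_re,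
        smul_eq_mul]
    rw [h2, h1, mul_one]

end StarIsing

/-! ### Coefficients and operator norm of an interaction -/

section Norm

variable {ι : Type*} [Fintype ι] [DecidableEq ι]

theorem norm_entry_le_l2OpNorm (A : Matrix ι ι ℂ) (s t : ι) : ‖A s t‖ ≤ l2OpNorm A := by
  have h1 := (Matrix.toEuclideanCLM (n := ι) (𝕜 := ℂ) A).le_opNorm (EuclideanSpace.single t 1)
  rw [PiLp.norm_single, norm_one, mul_one] at h1
  refine le_trans ?_ h1
  have h2 := PiLp.norm_apply_le
    (Matrix.toEuclideanCLM (n := ι) (𝕜 := ℂ) A (EuclideanSpace.single t 1)) s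
  rw [Matrix.ofLp_toEuclideanCLM] at h2
  simpa using h2

theorem l2OpNorm_smul (c : ℂ) (A : Matrix ι ι ℂ) : l2OpNorm (c • A) = ‖c‖ * l2OpNorm A := by
  rw [l2OpNorm, map_smul, norm_smul]; rfl

theorem l2OpNorm_sum_le {κ : Type*} (S : Finset κ) (A : κ → Matrix ι ι ℂ) :
    l2OpNorm (∑ k ∈ S, A k) ≤ ∑ k ∈ S, l2OpNorm (A k) := by
  rw [l2OpNorm, map_sum]; exact norm_sum_le _ _

theorem l2OpNorm_le_one {A : Matrix ι ι ℂ} (hA : Aᴴ * A = 1) : l2OpNorm A ≤ 1 := by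
  refine ContinuousLinearMap.opNorm_le_bound _ zero_le_one fun x => ?_
  rw [one_mul]
  refine le_of_sq_le_sq ?_ (norm_nonneg x)
  have h1 : ∀ y : EuclideanSpace ℂ ι, ((‖y‖ ^ 2 : ℝ) : ℂ) = star y.ofLp ⬝ᵥ y.ofLp := fun y => by
    rw [dotProduct_comm, ← EuclideanSpace.inner_eq_star_dotProduct, inner_self_eq_norm_sq_to_K]
    simp
  have h2 : ((‖Matrix.toEuclideanCLM (n := ι) (𝕜 := ℂ) A x‖ ^ 2 : ℝ) : ℂ) =
      ((‖x‖ ^ 2 : ℝ) : ℂ) := by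
    rw [h1, h1, Matrix.ofLp_toEuclideanCLM, star_mulVec, dotProduct_mulVec, vecMul_vecMul, hA,
      vecMul_one]
  exact (Complex.ofReal_injective h2).le

end Norm

theorem norm_pauli_le (α : Fin 4) (s t : Fin 2) : ‖pauli α s t‖ ≤ 1 := by
  fin_cases α <;> fin_cases s <;> fin_cases t <;> simp [pauli]

namespace StarIsing

variable {n : ℕ} (I : StarIsing n)

/-- Orthogonality of Pauli products under the trace isolates 4 times the coefficient. The trace is a
sum of 16 products of entries, each bounded by the norm. The resulting constant 4 is not sharp, but
only constants depending on b/a matter. -/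
theorem abs_coupling_le (j : Fin n) (α : Fin 4) (β : Fin 3) :
    |(I.coupling j α β : ℝ)| ≤ 4 * l2OpNorm (I.interaction j) := by
  have h1 : (I.interaction j * (pauli α ⊗ₖ pauli β.succ)).trace = 4 * (I.coupling j α β : ℂ) := by
    simp only [interaction, Finset.sum_mul, smul_mul_assoc, trace_sum, trace_smul,
      ← mul_kronecker_mul, trace_kronecker, trace_pauli_mul]
    rw [Finset.sum_eq_single α, Finset.sum_eq_single β]
    · simp; ring
    · intro γ _ hγ; simp [Fin.succ_inj, hγ]
    · simp
    · intro γ _ hγ; simp [hγ]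
    · simp
  have h2 : ‖(I.interaction j * (pauli α ⊗ₖ pauli β.succ)).trace‖ ≤
      16 * l2OpNorm (I.interaction j) := by
    rw [Matrix.trace]
    refine (norm_sum_le _ _).trans ?_
    have h3 : ∀ s ∈ (Finset.univ : Finset (Fin 2 × Fin 2)),
        ‖(I.interaction j * (pauli α ⊗ₖ pauli β.succ)).diag s‖ ≤
        4 * l2OpNorm (I.interaction j) := by
      intro s _
      rw [Matrix.diag_apply, Matrix.mul_apply]
      refine (norm_sum_le _ _).trans ?_
      refine (Finset.sum_le_card_nsmul _ _ (l2OpNorm (I.interaction j)) fun t _ => ?_).trans ?_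
      · rw [norm_mul, kroneckerMap_apply, norm_mul]
        exact (mul_le_of_le_one_right (norm_nonneg _) (mul_le_one₀ (norm_pauli_le _ _ _)
          (norm_nonneg _) (norm_pauli_le _ _ _))).trans (norm_entry_le_l2OpNorm _ s t)
      · simp
    refine (Finset.sum_le_card_nsmul _ _ _ h3).trans ?_
    simp
    linarith
  rw [h1, norm_mul] at h2
  have h4 : ‖((I.coupling j α β : ℚ) : ℂ)‖ = |(I.coupling j α β : ℝ)| := by
    rw [← Complex.ofReal_ratCast, Complex.norm_real, Real.norm_eq_abs]
  rw [h4] at h2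
  norm_num at h2
  linarith

/-- The interaction is a combination of twelve operators of norm at most 1, so the triangle
inequality forces one coefficient to be large. -/
theorem exists_le_abs_coupling (j : Fin n) :
    ∃ α β, l2OpNorm (I.interaction j) / 12 ≤ |(I.coupling j α β : ℝ)| := by
  by_contra! h
  have h1 : l2OpNorm (I.interaction j) ≤ ∑ α, ∑ β, |(I.coupling j α β : ℝ)| := by
    refine (l2OpNorm_sum_le _ _).trans (Finset.sum_le_sum fun α _ => ?_)
    refine (l2OpNorm_sum_le _ _).trans (Finset.sum_le_sum fun β _ => ?_)
    rw [l2OpNorm_smul, ← Complex.ofReal_ratCast, Complex.norm_real, Real.norm_eq_abs]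
    refine mul_le_of_le_one_right (abs_nonneg _) (l2OpNorm_le_one ?_)
    rw [conjTranspose_kronecker, pauli_conjTranspose, pauli_conjTranspose, ← mul_kronecker_mul,
      pauli_mul_self, pauli_mul_self, one_kronecker_one]
  have h2 : ∑ α, ∑ β, |(I.coupling j α β : ℝ)| < ∑ _α : Fin 4, ∑ _β : Fin 3,
      l2OpNorm (I.interaction j) / 12 :=
    Finset.sum_lt_sum_of_nonempty Finset.univ_nonempty fun α _ =>
      Finset.sum_lt_sum_of_nonempty Finset.univ_nonempty fun β _ => h α β
  simp at h2
  linarith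

/-! ### Size of the ground energy -/

theorem sum_single_sq (α : Fin 3) {z : ℝ} (hz : z ^ 2 ≤ 1) :
    ∑ β, (Pi.single α z : Fin 3 → ℝ) β ^ 2 ≤ 1 := by
  rw [Finset.sum_eq_single α]
  · simpa using hz
  · intro β _ hβ; simp [Pi.single_eq_of_ne hβ]
  · simp

/-- Trial state: the central spin polarised against the field component, all bath spins maximally
mixed. -/
theorem le_neg_abs_field {lam : ℝ} (h : (I.hamiltonian - lam • 1).PosSemidef) (α : Fin 3) :
    lam ≤ - |(I.field α : ℝ)| := by
  have h1 : ∀ z : ℝ, z ^ 2 ≤ 1 → lam ≤ (I.field α : ℝ) * z := by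
    intro z hz
    have h2 := I.le_classicalEnergy h (Pi.single α z) 0 (sum_single_sq α hz) (by simp)
    rw [classicalEnergy, Finset.sum_eq_single α (fun β _ hβ => by simp [Pi.single_eq_of_ne hβ])
      (by simp)] at h2
    simpa using h2
  rcases abs_cases (I.field α : ℝ) with ⟨h3, _⟩ | ⟨h3, _⟩
  · rw [h3]; linarith [h1 (-1) (by norm_num)]
  · rw [h3]; linarith [h1 1 (by norm_num)]

/-- Polarise the central spin along ±α and align each bath spin along the axis `B j` against its
effective field. Adding the two signs cancels the central field and leaves |x + y| + |x − y|, which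
is at least 2|x| and at least 2|y|. Different bath spins may need different α, so the bounds for the
three directions are added, which produces the factor 1/3. -/
theorem le_neg_mul_of_coupling {lam : ℝ} (h : (I.hamiltonian - lam • 1).PosSemidef) {a : ℝ}
    (ha : ∀ j, ∃ α β, a ≤ |(I.coupling j α β : ℝ)|) : lam ≤ - (n * a / 3) := by
  choose A B hAB using ha
  have h1 : ∀ (α : Fin 3) (σ : ℝ), σ ^ 2 ≤ 1 → lam ≤ (I.field α : ℝ) * σ -
      ∑ j, |(I.coupling j 0 (B j) : ℝ) + I.coupling j α.succ (B j) * σ| := by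
    intro α σ hσ
    set w : Fin n → ℝ := fun j => (I.coupling j 0 (B j) : ℝ) + I.coupling j α.succ (B j) * σ
    have h2 := I.le_classicalEnergy h (Pi.single α σ)
      (fun j => Pi.single (B j) (- SignType.sign (w j) : ℝ)) (sum_single_sq α hσ) fun j => by
        refine sum_single_sq _ ?_
        rcases lt_trichotomy (w j) 0 with h0 | h0 | h0
        · simp [sign_neg h0]
        · simp [h0]
        · simp [sign_pos h0]
    rw [classicalEnergy, Finset.sum_eq_single α (fun β _ hβ => by simp [Pi.single_eq_of_ne hβ])
      (by simp), Pi.single_eq_same] at h2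
    refine h2.trans_eq ?_
    rw [sub_eq_add_neg, ← Finset.sum_neg_distrib]
    congr 1
    refine Finset.sum_congr rfl fun j _ => ?_
    rw [Finset.sum_eq_single (B j) (fun β _ hβ => by simp [Pi.single_eq_of_ne hβ]) (by simp),
      Finset.sum_eq_single α (fun β _ hβ => by simp [Pi.single_eq_of_ne hβ]) (by simp),
      Pi.single_eq_same, Pi.single_eq_same]
    change w j * - (SignType.sign (w j) : ℝ) = - |w j|
    rw [mul_neg, self_mul_sign]
  have h2 : ∀ α : Fin 3, 2 * lam ≤ - ∑ j,
      (|(I.coupling j 0 (B j) : ℝ) + I.coupling j α.succ (B j)| +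
        |(I.coupling j 0 (B j) : ℝ) - I.coupling j α.succ (B j)|) := by
    intro α
    have e1 := h1 α 1 (by norm_num)
    have e2 := h1 α (-1) (by norm_num)
    simp only [mul_one, mul_neg, ← sub_eq_add_neg] at e1 e2
    rw [Finset.sum_add_distrib]
    linarith
  have h3 : (n : ℝ) * (2 * a) ≤ ∑ j, ∑ α : Fin 3,
      (|(I.coupling j 0 (B j) : ℝ) + I.coupling j α.succ (B j)| +
        |(I.coupling j 0 (B j) : ℝ) - I.coupling j α.succ (B j)|) := by
    have : (n : ℝ) * (2 * a) = ∑ _j : Fin n, 2 * a := by simp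
    rw [this]
    refine Finset.sum_le_sum fun j _ => ?_
    have hsum : ∀ x y : ℝ, 2 * |x| ≤ |x + y| + |x - y| ∧ 2 * |y| ≤ |x + y| + |x - y| := by
      intro x y
      have g1 := abs_add_le (x + y) (x - y)
      have g2 := abs_sub (x + y) (x - y)
      rw [show x + y + (x - y) = 2 * x by ring, abs_mul, abs_two] at g1
      rw [show x + y - (x - y) = 2 * y by ring, abs_mul, abs_two] at g2
      exact ⟨g1, g2⟩
    have hnn : ∀ α ∈ (Finset.univ : Finset (Fin 3)),
      0 ≤ (|(I.coupling j 0 (B j) : ℝ) + I.coupling j α.succ (B j)| +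
        |(I.coupling j 0 (B j) : ℝ) - I.coupling j α.succ (B j)|) := fun α _ => by positivity
    have hj := hAB j
    revert hj
    refine Fin.cases (fun hj => ?_) (fun α hj => ?_) (A j)
    · refine le_trans ?_ (Finset.single_le_sum hnn (Finset.mem_univ 0))
      linarith [(hsum (I.coupling j 0 (B j) : ℝ) (I.coupling j (Fin.succ 0) (B j))).1]
    · refine le_trans ?_ (Finset.single_le_sum hnn (Finset.mem_univ α))
      linarith [(hsum (I.coupling j 0 (B j) : ℝ) (I.coupling j α.succ (B j))).2]
  rw [Finset.sum_comm, Fin.sum_univ_three] at h3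
  linarith [h2 0, h2 1, h2 2]

end StarIsing

/-! ### Approximating the largest number of a family by a ratio of power sums -/

/-- Each block of q factors is at most 1/e < 1/2. Of the c + q blocks, c absorb the number of
eigenvalues, and the rest give 2^(−q) ≤ 1/q. -/
theorem one_sub_inv_pow_le (q c : ℕ) (hq : 0 < q) :
    (2 : ℝ) ^ c * (1 - 1 / (q : ℝ)) ^ (q * (c + q)) ≤ 1 / q := by
  have hq' : (1 : ℝ) ≤ q := by exact_mod_cast hq
  have h1 : (1 - 1 / (q : ℝ)) ^ q ≤ 1 / 2 := by
    refine (Real.one_sub_div_pow_le_exp_neg hq').trans ?_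
    have := Real.exp_neg_one_lt_d9
    linarith
  have h0 : (0 : ℝ) ≤ 1 - 1 / q := by
    rw [sub_nonneg, div_le_one (by linarith)]; exact hq'
  have h2 : (q : ℝ) ≤ 2 ^ q := by exact_mod_cast (Nat.lt_two_pow_self).le
  calc (2 : ℝ) ^ c * (1 - 1 / (q : ℝ)) ^ (q * (c + q))
      = 2 ^ c * ((1 - 1 / (q : ℝ)) ^ q) ^ (c + q) := by rw [pow_mul]
    _ ≤ 2 ^ c * (1 / 2) ^ (c + q) := by gcongr
    _ = 1 / 2 ^ q := by rw [pow_add, div_pow, div_pow, one_pow, one_pow]; field_simp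
    _ ≤ 1 / q := by gcongr

/-- In the lower bound, numbers above (1 − η) times the maximum M contribute with the right sign,
and each of the others loses at most (1 − η)^N M^(N+1). By `one_sub_inv_pow_le` these losses total
at most η M^(N+1), which is exactly the surplus of the term `i₀`. -/
theorem power_sum_ratio {ι : Type*} [Fintype ι] [DecidableEq ι] (x : ι → ℝ) (i₀ : ι)
    (hx : ∀ i, 0 ≤ x i) (hmax : ∀ i, x i ≤ x i₀) (hpos : 0 < x i₀) {c q : ℕ} (hq : 0 < q)
    (hc : Fintype.card ι ≤ 2 ^ c) :
    0 < ∑ i, x i ^ (q * (c + q)) ∧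
    (1 - 1 / (q : ℝ)) * x i₀ * ∑ i, x i ^ (q * (c + q)) ≤ ∑ i, x i ^ (q * (c + q) + 1) ∧
    ∑ i, x i ^ (q * (c + q) + 1) ≤ x i₀ * ∑ i, x i ^ (q * (c + q)) := by
  set N := q * (c + q) with hN
  set M := x i₀ with hM
  have hq' : (1 : ℝ) ≤ q := by exact_mod_cast hq
  set η : ℝ := 1 / q with hη
  have hη0 : 0 ≤ 1 - η := by
    rw [hη, sub_nonneg, div_le_one (by linarith)]; exact hq'
  have hηp : 0 < η := by positivity
  refine ⟨?_, ?_, ?_⟩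
  · exact Finset.sum_pos' (fun i _ => pow_nonneg (hx i) N) ⟨i₀, Finset.mem_univ _, by positivity⟩
  · rw [Finset.mul_sum, ← sub_nonneg, ← Finset.sum_sub_distrib,
      ← Finset.add_sum_erase _ _ (Finset.mem_univ i₀)]
    have h1 : ∀ i ∈ Finset.univ.erase i₀, -((1 - η) ^ N * M ^ (N + 1)) ≤
        x i ^ (N + 1) - (1 - η) * M * x i ^ N := by
      intro i _
      have e : x i ^ (N + 1) - (1 - η) * M * x i ^ N = x i ^ N * (x i - (1 - η) * M) := by ring
      rw [e]
      have hnn : 0 ≤ (1 - η) ^ N * M ^ (N + 1) := by positivity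
      rcases le_total ((1 - η) * M) (x i) with h | h
      · have : 0 ≤ x i ^ N * (x i - (1 - η) * M) :=
          mul_nonneg (pow_nonneg (hx i) N) (sub_nonneg.2 h)
        linarith
      · have h2 : x i ^ N ≤ ((1 - η) * M) ^ N := pow_le_pow_left₀ (hx i) h N
        have h3 : (1 - η) * M - x i ≤ M := by nlinarith [hx i]
        have h4 : x i ^ N * ((1 - η) * M - x i) ≤ ((1 - η) * M) ^ N * M :=
          mul_le_mul h2 h3 (sub_nonneg.2 h) (by positivity)
        have h5 : ((1 - η) * M) ^ N * M = (1 - η) ^ N * M ^ (N + 1) := by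
          rw [mul_pow, pow_succ, mul_assoc]
        linarith
    have h2 := Finset.card_nsmul_le_sum _ _ _ h1
    rw [nsmul_eq_mul] at h2
    have h3 : ((Finset.univ.erase i₀).card : ℝ) ≤ 2 ^ c := by
      have : (Finset.univ.erase i₀).card ≤ 2 ^ c :=
        (Finset.card_erase_le).trans (by rwa [Finset.card_univ])
      exact_mod_cast this
    have h4 : ((Finset.univ.erase i₀).card : ℝ) * ((1 - η) ^ N * M ^ (N + 1)) ≤
        η * M ^ (N + 1) := by
      rw [← mul_assoc]
      gcongr
      exact (mul_le_mul_of_nonneg_right h3 (by positivity)).trans (one_sub_inv_pow_le q c hq)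
    have h5 : M ^ (N + 1) - (1 - η) * M * M ^ N = η * M ^ (N + 1) := by ring
    linarith
  · rw [Finset.mul_sum]
    refine Finset.sum_le_sum fun i _ => ?_
    rw [pow_succ']
    exact mul_le_mul_of_nonneg_right (hmax i) (pow_nonneg (hx i) N)

/-! ### Rounding Bloch vectors to a grid -/

/-- Rounding every coordinate towards zero does not increase its square, so the grid point stays in
the ball. -/
theorem exists_grid_point (G : ℕ) (hG : 0 < G) (x : Fin 3 → ℝ) (hx : ∑ α, x α ^ 2 ≤ 1) :
    ∃ g : Fin 3 → ℤ, ∑ α, g α ^ 2 ≤ (G : ℤ) ^ 2 ∧ ∀ α, |(g α : ℝ) / G - x α| ≤ 1 / G := by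
  have hG' : (0 : ℝ) < G := by exact_mod_cast hG
  have key : ∀ y : ℝ, ∃ g : ℤ, (g : ℝ) ^ 2 ≤ (G * y) ^ 2 ∧ |(g : ℝ) - G * y| ≤ 1 := by
    intro y
    rcases le_total 0 (G * y) with h | h
    · have h1 := Int.floor_le (G * y)
      have h2 := Int.lt_floor_add_one (G * y)
      have h3 : (0 : ℝ) ≤ ⌊G * y⌋ := by exact_mod_cast Int.floor_nonneg.2 h
      exact ⟨⌊G * y⌋, pow_le_pow_left₀ h3 h1 2, by rw [abs_le]; constructor <;> linarith⟩
    · have h1 := Int.le_ceil (G * y)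
      have h2 := Int.ceil_lt_add_one (G * y)
      have h3 : ((⌈G * y⌉ : ℤ) : ℝ) ≤ 0 := by exact_mod_cast Int.ceil_le.2 (by simpa using h)
      refine ⟨⌈G * y⌉, ?_, by rw [abs_le]; constructor <;> linarith⟩
      nlinarith
  choose g hg1 hg2 using key
  refine ⟨fun α => g (x α), ?_, fun α => ?_⟩
  · have : ∑ α, ((g (x α) : ℤ) : ℝ) ^ 2 ≤ (G : ℝ) ^ 2 := by
      calc ∑ α, ((g (x α) : ℤ) : ℝ) ^ 2 ≤ ∑ α, (G * x α) ^ 2 :=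
            Finset.sum_le_sum fun α _ => hg1 (x α)
        _ = G ^ 2 * ∑ α, x α ^ 2 := by rw [Finset.mul_sum]; simp only [mul_pow]
        _ ≤ G ^ 2 := mul_le_of_le_one_right (by positivity) hx
    exact_mod_cast this
  · have e : (g (x α) : ℝ) / G - x α = (g (x α) - G * x α) / G := by field_simp
    rw [e, abs_div, abs_of_pos hG']
    gcongr
    exact hg2 (x α)

theorem sum_div_sq_le_one {G : ℕ} (hG : 0 < G) {g : Fin 3 → ℤ}
    (hg : ∑ α, g α ^ 2 ≤ (G : ℤ) ^ 2) : ∑ α, ((g α : ℝ) / G) ^ 2 ≤ 1 := by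
  have hG' : (0 : ℝ) < G := by exact_mod_cast hG
  simp only [div_pow, ← Finset.sum_div]
  rw [div_le_one (by positivity)]
  exact_mod_cast hg

theorem abs_le_one_of_sum_sq {x : Fin 3 → ℝ} (hx : ∑ α, x α ^ 2 ≤ 1) (α : Fin 3) : |x α| ≤ 1 := by
  have := Finset.single_le_sum (fun β _ => sq_nonneg (x β)) (Finset.mem_univ α)
  exact abs_le_one_iff_mul_self_le_one.2 (by rw [← pow_two]; exact this.trans hx)

namespace StarIsing

variable {n : ℕ} (I : StarIsing n)

/-- For each of the three components of a bath vector, moving `r` changes the effective field by at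
most 3bδ. Moving `q` costs δ times an effective field of at most 4b. Hence 21 = 3·(3 + 4). -/
theorem classicalEnergy_le_add {b δ : ℝ} (hδ : 0 ≤ δ) (hb : ∀ j α β, |(I.coupling j α β : ℝ)| ≤ b)
    {r r' : Fin 3 → ℝ} {q q' : Fin n → Fin 3 → ℝ} (hr' : ∑ α, r' α ^ 2 ≤ 1)
    (hq : ∀ j, ∑ β, q j β ^ 2 ≤ 1) (hrr : ∀ α, |r' α - r α| ≤ δ) (hqq : ∀ j α, |q' j α - q j α| ≤ δ) :
    I.classicalEnergy r' q' ≤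
      I.classicalEnergy r q + (δ * ∑ α, |(I.field α : ℝ)| + n * (21 * b * δ)) := by
  have hfield : ∑ α, (I.field α : ℝ) * r' α ≤ ∑ α, (I.field α : ℝ) * r α +
      δ * ∑ α, |(I.field α : ℝ)| := by
    rw [Finset.mul_sum, ← Finset.sum_add_distrib]
    refine Finset.sum_le_sum fun α _ => ?_
    have h1 : (I.field α : ℝ) * (r' α - r α) ≤ |(I.field α : ℝ)| * δ :=
      (le_abs_self _).trans ((abs_mul _ _).trans_le
        (mul_le_mul_of_nonneg_left (hrr α) (abs_nonneg _)))
    linarith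
  have hbath : ∀ (j : Fin n) (β : Fin 3),
      ((I.coupling j 0 β : ℝ) + ∑ α : Fin 3, (I.coupling j α.succ β : ℝ) * r' α) * q' j β ≤
      ((I.coupling j 0 β : ℝ) + ∑ α : Fin 3, (I.coupling j α.succ β : ℝ) * r α) * q j β +
        7 * b * δ := by
    intro j β
    have hb0 : 0 ≤ b := (abs_nonneg _).trans (hb j 0 β)
    set v' := (I.coupling j 0 β : ℝ) + ∑ α : Fin 3, (I.coupling j α.succ β : ℝ) * r' α with hv'
    set v := (I.coupling j 0 β : ℝ) + ∑ α : Fin 3, (I.coupling j α.succ β : ℝ) * r α with hv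
    have h1 : |v' - v| ≤ 3 * b * δ := by
      have e : v' - v = ∑ α : Fin 3, (I.coupling j α.succ β : ℝ) * (r' α - r α) := by
        rw [hv, hv', add_sub_add_left_eq_sub, ← Finset.sum_sub_distrib]
        exact Finset.sum_congr rfl fun α _ => by ring
      rw [e]
      refine (Finset.abs_sum_le_sum_abs _ _).trans ?_
      refine (Finset.sum_le_card_nsmul _ _ (b * δ) fun α _ => ?_).trans_eq ?_
      · rw [abs_mul]
        exact mul_le_mul (hb _ _ _) (hrr α) (abs_nonneg _) hb0
      · simp; ring
    have h2 : |v'| ≤ 4 * b := by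
      have h3 : |∑ α : Fin 3, (I.coupling j α.succ β : ℝ) * r' α| ≤ 3 * b := by
        refine (Finset.abs_sum_le_sum_abs _ _).trans ?_
        refine (Finset.sum_le_card_nsmul _ _ b fun α _ => ?_).trans_eq ?_
        · rw [abs_mul]
          exact (mul_le_of_le_one_right (abs_nonneg _) (abs_le_one_of_sum_sq hr' α)).trans
            (hb _ _ _)
        · simp
      have h4 := abs_add_le (I.coupling j 0 β : ℝ) (∑ α : Fin 3, (I.coupling j α.succ β : ℝ) * r' α)
      linarith [hb j 0 β]
    have h5 : (v' - v) * q j β ≤ 3 * b * δ * 1 :=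
      (le_abs_self _).trans ((abs_mul _ _).trans_le
        (mul_le_mul h1 (abs_le_one_of_sum_sq (hq j) β) (abs_nonneg _) (by positivity)))
    have h6 : v' * (q' j β - q j β) ≤ 4 * b * δ :=
      (le_abs_self _).trans ((abs_mul _ _).trans_le
        (mul_le_mul h2 (hqq j β) (abs_nonneg _) (by positivity)))
    linarith
  have hsum := Finset.sum_le_sum fun j (_ : j ∈ (Finset.univ : Finset (Fin n))) =>
    Finset.sum_le_sum fun β (_ : β ∈ (Finset.univ : Finset (Fin 3))) => hbath j β
  simp only [Finset.sum_add_distrib, Finset.sum_const, Finset.card_univ, Fintype.card_fin,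
    nsmul_eq_mul] at hsum
  push_cast at hsum
  rw [classicalEnergy, classicalEnergy]
  simp only [Finset.sum_add_distrib, add_mul] at hsum ⊢
  linarith

/-- For many bath spins, the minimum of the classical energy over a grid approximates the ground
energy. -/
theorem grid_minimum_error {lam a b E : ℝ} {G : ℕ} (ha : 0 < a) (hG : 0 < G) (hn : G ^ 3 ≤ n)
    (hb : ∀ j α β, |(I.coupling j α β : ℝ)| ≤ b) (ha' : ∀ j, ∃ α β, a ≤ |(I.coupling j α β : ℝ)|)
    (hpsd : (I.hamiltonian - lam • 1).PosSemidef)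
    (hst : ∃ ω : Matrix (Config n) (Config n) ℂ →ₗ[ℝ] ℝ, IsPositiveFunctional ω ∧ 0 < ω 1 ∧
      ω I.hamiltonian = lam * ω 1)
    (hE : ∀ (g : Fin 3 → ℤ) (f : Fin n → Fin 3 → ℤ), ∑ α, g α ^ 2 ≤ (G : ℤ) ^ 2 →
      (∀ j, ∑ α, f j α ^ 2 ≤ (G : ℤ) ^ 2) →
      E ≤ I.classicalEnergy (fun α => (g α : ℝ) / G) (fun j α => (f j α : ℝ) / G)) :
    E - lam ≤ (3 + 126 * (b / a)) / G * |lam| := by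
  have hG' : (0 : ℝ) < G := by exact_mod_cast hG
  have hn0 : 0 < n := lt_of_lt_of_le (by positivity) hn
  have hnG : (G : ℝ) ^ 3 ≤ n := by exact_mod_cast hn
  obtain ⟨ω, hω, hω1, hωH⟩ := hst
  have hb0 : 0 ≤ b := (abs_nonneg _).trans (hb ⟨0, hn0⟩ 0 0)
  set F := ∑ α, |(I.field α : ℝ)| with hF
  -- After subtracting the rounding error, the grid minimum bounds all product energies from below,
  -- as the mean-field argument requires.
  set L := E - (1 / G * F + n * (21 * b * (1 / G))) with hL
  have hLe : ∀ r q, ∑ α, r α ^ 2 ≤ 1 → (∀ j, ∑ β, q j β ^ 2 ≤ 1) → L ≤ I.classicalEnergy r q := by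
    intro r q hr hq
    obtain ⟨g, hg, hgr⟩ := exists_grid_point G hG r hr
    choose f hf hfq using fun j => exists_grid_point G hG (q j) (hq j)
    have h1 := hE g f hg hf
    have h2 := I.classicalEnergy_le_add (r' := fun α => (g α : ℝ) / G)
      (q' := fun j α => (f j α : ℝ) / G) (by positivity : (0 : ℝ) ≤ 1 / G) hb
      (sum_div_sq_le_one hG hg) hq hgr hfq
    linarith
  have h1 := le_apply_partialHamiltonian (δ := 1 / (G : ℝ)) (by positivity) hb0 hb hLe
    Finset.univ hω
  rw [← hamiltonian_eq_partialHamiltonian, hωH] at h1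
  have h2 : 0 ≤ 12 * b / (1 / (G : ℝ)) ^ 2 *
      ((∑ α : Fin 3, ω (spin 0 α.succ) ^ 2) / ω 1) := by positivity
  have h3 : L - 9 * b * (1 / G) * n - 12 * b / (1 / (G : ℝ)) ^ 2 ≤ lam := by
    rw [← mul_le_mul_iff_right₀ hω1]; linarith
  -- Here n ≥ G³ enters: the total cost of the measurements, 12bG², is at most 12bn/G.
  have h4 : 12 * b / (1 / (G : ℝ)) ^ 2 ≤ 12 * b * (n / G) := by
    have e : 12 * b / (1 / (G : ℝ)) ^ 2 = 12 * b * (G ^ 3 / G) := by field_simp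
    rw [e]; gcongr
  have hlam0 : lam ≤ 0 := (I.le_neg_abs_field hpsd 0).trans (neg_nonpos.2 (abs_nonneg _))
  have hFl : F ≤ 3 * |lam| := by
    rw [hF, Fin.sum_univ_three, abs_of_nonpos hlam0]
    linarith [I.le_neg_abs_field hpsd 0, I.le_neg_abs_field hpsd 1, I.le_neg_abs_field hpsd 2]
  have hnl : n * b ≤ 3 * (b / a) * |lam| := by
    have h5 : n * a ≤ 3 * |lam| := by
      rw [abs_of_nonpos hlam0]
      linarith [I.le_neg_mul_of_coupling hpsd ha']
    calc n * b = b / a * (n * a) := by field_simp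
      _ ≤ b / a * (3 * |lam|) := by gcongr
      _ = _ := by ring
  -- 42 = 21 + 9 + 12, for rounding, residual correlations and measurements. With `hFl` and `hnl`
  -- this gives 3 + 126 · (b/a).
  have h6 : E - lam ≤ (F + 42 * (n * b)) / G := by
    have e : (F + 42 * (n * b)) / G = 1 / G * F + n * (21 * b * (1 / G)) + 9 * b * (1 / G) * n +
      12 * b * (n / G) := by field_simp; ring
    rw [e]; linarith
  refine h6.trans ?_
  rw [div_mul_eq_mul_div]
  gcongr
  linarith

end StarIsing

/-! ### Traces of powers as sums over closed paths -/

section Paths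

variable {ι R : Type*} [Fintype ι] [DecidableEq ι] [CommRing R]

/-- The entries of a power of a matrix as sums over paths. -/
theorem pow_apply_eq_sum_paths (A : Matrix ι ι R) (N : ℕ) (s t : ι) :
    (A ^ N) s t = ∑ p : Fin (N + 1) → ι, if p 0 = s ∧ p (Fin.last N) = t then
      ∏ i : Fin N, A (p i.castSucc) (p i.succ) else 0 := by
  induction N generalizing s with
  | zero =>
    rw [pow_zero, Matrix.one_apply, ← (Equiv.funUnique (Fin 1) ι).symm.sum_comp]
    rcases eq_or_ne s t with rfl | h
    · rw [Finset.sum_eq_single s] <;> simp +contextual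
    · rw [Finset.sum_eq_zero] <;> simp +contextual [h]
  | succ N ih =>
    rw [pow_succ', Matrix.mul_apply]
    set F : (Fin (N + 2) → ι) → R := fun p => if p 0 = s ∧ p (Fin.last (N + 1)) = t then
      ∏ i : Fin (N + 1), A (p i.castSucc) (p i.succ) else 0 with hF
    have h1 : ∑ p, F p = ∑ u, ∑ p : Fin (N + 1) → ι, F (Fin.cons u p) := by
      rw [← (Fin.consEquiv fun _ => ι).sum_comp, Fintype.sum_prod_type]; rfl
    have h2 : ∑ u, ∑ p : Fin (N + 1) → ι, F (Fin.cons u p) =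
        ∑ p : Fin (N + 1) → ι, F (Fin.cons s p) := by
      refine Finset.sum_eq_single s (fun u _ hu => Finset.sum_eq_zero fun p _ => ?_) (by simp)
      simp [hF, hu]
    rw [h1, h2]
    simp only [ih, Finset.mul_sum]
    rw [Finset.sum_comm]
    refine Finset.sum_congr rfl fun p _ => ?_
    rw [Finset.sum_eq_single (p 0)]
    · simp [hF, Fin.prod_univ_succ, ← Fin.succ_last]
    · intro u _ hu; simp [hu.symm]
    · simp

theorem trace_pow_eq_sum_paths (A : Matrix ι ι R) (N : ℕ) :
    (A ^ N).trace = ∑ p : Fin (N + 1) → ι, if p 0 = p (Fin.last N) then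
      ∏ i : Fin N, A (p i.castSucc) (p i.succ) else 0 := by
  simp only [Matrix.trace, Matrix.diag, pow_apply_eq_sum_paths]
  rw [Finset.sum_comm]
  refine Finset.sum_congr rfl fun p _ => ?_
  rw [Finset.sum_eq_single (p 0)]
  · simp [eq_comm]
  · intro u _ hu; simp [hu.symm]
  · simp

/-- Sums over functions as sums over numbers, by way of their digits. -/
theorem sum_digits {M : Type*} [AddCommMonoid M] (d N : ℕ) (F : (ℕ → ℕ) → M)
    (hF : ∀ p p' : ℕ → ℕ, (∀ i < N, p i = p' i) → F p = F p') :
    ∑ x ∈ Finset.range (d ^ N), F (fun i => x / d ^ i % d) =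
      ∑ p : Fin N → Fin d, F (fun i => if h : i < N then (p ⟨i, h⟩ : ℕ) else 0) := by
  rw [Finset.sum_range, ← finFunctionFinEquiv.symm.sum_comp]
  refine Finset.sum_congr rfl fun x _ => hF _ _ fun i hi => ?_
  rw [dif_pos hi]
  rfl

/-- A path is encoded by the number whose base-`d` digits are its `N + 1` vertices, so a single
bounded loop runs over all paths. -/
theorem trace_pow_eq_sum_range (A : ℕ → ℕ → R) (d N : ℕ) :
    ((Matrix.of fun s t : Fin d => A s t) ^ N).trace = ∑ x ∈ Finset.range (d ^ (N + 1)),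
      if x / d ^ 0 % d = x / d ^ N % d then
        ∏ i ∈ Finset.range N, A (x / d ^ i % d) (x / d ^ (i + 1) % d) else 0 := by
  have h := sum_digits d (N + 1) (fun p : ℕ → ℕ => if p 0 = p N then
    ∏ i ∈ Finset.range N, A (p i) (p (i + 1)) else 0) (fun p p' hp => by
      rw [hp 0 (by omega), hp N (by omega)]
      congr 1
      refine Finset.prod_congr rfl fun i hi => ?_
      rw [Finset.mem_range] at hi
      rw [hp i (by omega), hp (i + 1) (by omega)])
  beta_reduce at h
  rw [h, trace_pow_eq_sum_paths]
  refine Finset.sum_congr rfl fun p _ => ?_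
  rw [dif_pos (by omega), dif_pos (by omega), Finset.prod_range]
  have e : p 0 = p (Fin.last N) ↔ ((p ⟨0, by omega⟩ : Fin d) : ℕ) = (p ⟨N, by omega⟩ : Fin d) := by
    rw [Fin.val_inj]; rfl
  simp only [e]
  congr 1
  refine Finset.prod_congr rfl fun i _ => ?_
  rw [dif_pos (by omega), dif_pos (by omega)]
  rfl

end Paths

/-! ### Complex matrices as real matrices of twice the size -/

/-- The real two-by-two matrix of the multiplication by a complex number. -/
noncomputable def realBlock (z : ℂ) (c d : Fin 2) : ℝ :=
  z.re * (1 - ((c : ℝ) - (d : ℝ)) ^ 2) + z.im * ((c : ℝ) - (d : ℝ))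

/-- The blocks have rows (Re z, −Im z) and (Im z, Re z). Multiplicativity is what lets powers of a
complex matrix be computed over the reals, at the price of a doubled trace. -/
theorem realBlock_mul (z w : ℂ) (c e : Fin 2) :
    ∑ d, realBlock z c d * realBlock w d e = realBlock (z * w) c e := by
  fin_cases c <;> fin_cases e <;> simp [realBlock, Fin.sum_univ_two] <;> ring

theorem realBlock_sum {κ : Type*} (S : Finset κ) (z : κ → ℂ) (c d : Fin 2) :
    realBlock (∑ k ∈ S, z k) c d = ∑ k ∈ S, realBlock (z k) c d := by
  simp only [realBlock, Complex.re_sum, Complex.im_sum, Finset.sum_mul, Finset.sum_add_distrib]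

theorem realBlock_smul (x : ℝ) (z : ℂ) (c d : Fin 2) :
    realBlock (x * z) c d = x * realBlock z c d := by
  simp [realBlock]; ring

theorem realBlock_sub (z w : ℂ) (c d : Fin 2) :
    realBlock (z - w) c d = realBlock z c d - realBlock w c d := by
  simp [realBlock]; ring

/-- A complex matrix on `n + 1` spins as a real matrix on `n + 2` bits, the first of which
distinguishes real and imaginary parts. -/
noncomputable def realMatrix {m : ℕ} (M : Matrix (Fin m → Fin 2) (Fin m → Fin 2) ℂ) :
    Matrix (Fin (m + 1) → Fin 2) (Fin (m + 1) → Fin 2) ℝ :=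
  fun f g => realBlock (M (Fin.tail f) (Fin.tail g)) (f 0) (g 0)

section RealMatrix

variable {m : ℕ}

theorem sum_fin_succ_fun {M : Type*} [AddCommMonoid M] (F : (Fin (m + 1) → Fin 2) → M) :
    ∑ f, F f = ∑ c : Fin 2, ∑ s : Fin m → Fin 2, F (Fin.cons c s) := by
  rw [← (Fin.consEquiv fun _ => Fin 2).sum_comp, Fintype.sum_prod_type]
  rfl

theorem realMatrix_mul (M M' : Matrix (Fin m → Fin 2) (Fin m → Fin 2) ℂ) :
    realMatrix M * realMatrix M' = realMatrix (M * M') := by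
  ext f g
  rw [Matrix.mul_apply, sum_fin_succ_fun, Finset.sum_comm]
  simp only [realMatrix, Fin.tail_cons, Fin.cons_zero, realBlock_mul, Matrix.mul_apply,
    realBlock_sum]

theorem realMatrix_one : realMatrix (1 : Matrix (Fin m → Fin 2) (Fin m → Fin 2) ℂ) = 1 := by
  ext f g
  rw [realMatrix, Matrix.one_apply, Matrix.one_apply]
  have e : f = g ↔ Fin.tail f = Fin.tail g ∧ f 0 = g 0 := by
    conv_lhs => rw [← Fin.cons_self_tail f, ← Fin.cons_self_tail g, Fin.cons_inj]
    exact and_comm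
  by_cases h : Fin.tail f = Fin.tail g
  · simp only [e, h, true_and, if_true]
    generalize f 0 = c
    generalize g 0 = d
    fin_cases c <;> fin_cases d <;> simp [realBlock]
  · simp only [e, h, false_and, if_false]
    simp [realBlock]

theorem realMatrix_pow (M : Matrix (Fin m → Fin 2) (Fin m → Fin 2) ℂ) (N : ℕ) :
    realMatrix M ^ N = realMatrix (M ^ N) := by
  induction N with
  | zero => rw [pow_zero, pow_zero, realMatrix_one]
  | succ N ih => rw [pow_succ, pow_succ, ih, realMatrix_mul]

theorem trace_realMatrix (M : Matrix (Fin m → Fin 2) (Fin m → Fin 2) ℂ) :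
    (realMatrix M).trace = 2 * M.trace.re := by
  rw [Matrix.trace, sum_fin_succ_fun, Fin.sum_univ_two]
  simp [realMatrix, realBlock, Matrix.trace, two_mul]

/-- The bits of a number, as a function on `Fin m`. -/
def bits (m : ℕ) (x : ℕ) : Fin m → Fin 2 := fun v => ⟨x / 2 ^ (v : ℕ) % 2, Nat.mod_lt _ two_pos⟩

theorem trace_pow_eq_trace_pow_bits (B : Matrix (Fin m → Fin 2) (Fin m → Fin 2) ℝ) (N : ℕ) :
    (B ^ N).trace =
      ((Matrix.of fun s t : Fin (2 ^ m) => B (bits m s) (bits m t)) ^ N).trace := by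
  set e : (Fin m → Fin 2) ≃ Fin (2 ^ m) := finFunctionFinEquiv
  have h : (Matrix.of fun s t : Fin (2 ^ m) => B (bits m s) (bits m t)) =
      Matrix.reindexAlgEquiv ℝ ℝ e B := rfl
  rw [h, ← map_pow]
  simp only [Matrix.trace, Matrix.diag]
  rw [← e.symm.sum_comp]
  rfl

theorem sum_range_eq_trace_pow (A : ℕ → ℕ → ℝ)
    (M : Matrix (Fin m → Fin 2) (Fin m → Fin 2) ℂ)
    (hA : ∀ s < 2 ^ (m + 1), ∀ t < 2 ^ (m + 1),
      A s t = realMatrix M (bits (m + 1) s) (bits (m + 1) t)) (N : ℕ) :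
    (∑ x ∈ Finset.range ((2 ^ (m + 1)) ^ (N + 1)),
      if x / (2 ^ (m + 1)) ^ 0 % 2 ^ (m + 1) = x / (2 ^ (m + 1)) ^ N % 2 ^ (m + 1) then
        ∏ i ∈ Finset.range N, A (x / (2 ^ (m + 1)) ^ i % 2 ^ (m + 1))
          (x / (2 ^ (m + 1)) ^ (i + 1) % 2 ^ (m + 1)) else 0) = 2 * (M ^ N).trace.re := by
  rw [← trace_pow_eq_sum_range, ← trace_realMatrix, ← realMatrix_pow, trace_pow_eq_trace_pow_bits]
  congr 2
  ext s t
  exact hA s s.2 t t.2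

end RealMatrix

/-! ### The Hamiltonian as a sum of labelled Pauli strings -/

/-- The Pauli label of the term with number `i` at the vertex `v`. -/
def termLabel (i v : ℕ) : ℕ :=
  -- Shifting by 9 places the three field terms at the end of block 0 and the twelve terms of bath
  -- spin `j` in block `j + 1`. The block number is then the vertex carrying the last Pauli factor.
  if v = (i + 9) / 12 then i % 3 + 1 else if v = 0 then (i + 9) % 12 / 3 else 0

theorem termLabel_lt (i v : ℕ) : termLabel i v < 4 := by
  unfold termLabel; split_ifs <;> omega

/-- The Pauli labels of the term with number `i`. -/
def termLabels (n i : ℕ) : Fin (n + 1) → Fin 4 := fun v => ⟨termLabel i v, termLabel_lt i v⟩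

theorem sum_range_mul {M : Type*} [AddCommMonoid M] (k n : ℕ) (f : ℕ → M) :
    ∑ i ∈ Finset.range (k * n), f i =
      ∑ j ∈ Finset.range n, ∑ r ∈ Finset.range k, f (k * j + r) := by
  induction n with
  | zero => simp
  | succ n ih => rw [Nat.mul_succ, Finset.sum_range_add, ih, Finset.sum_range_succ]

theorem sum_range_terms {M : Type*} [AddCommMonoid M] (n : ℕ) (f : ℕ → M) :
    ∑ i ∈ Finset.range (3 + 12 * n), f i = ∑ α : Fin 3, f α +
      ∑ j : Fin n, ∑ α : Fin 4, ∑ β : Fin 3, f (3 + (12 * j + (3 * α + β))) := by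
  rw [Finset.sum_range_add, Finset.sum_range, sum_range_mul, Finset.sum_range]
  congr 1
  refine Finset.sum_congr rfl fun j _ => ?_
  rw [show 12 = 3 * 4 from rfl, sum_range_mul, Finset.sum_range]
  refine Finset.sum_congr rfl fun α _ => ?_
  rw [Finset.sum_range]

namespace StarIsing

variable {n : ℕ} (I : StarIsing n)

theorem coeff_field (α : Fin 3) : I.coeff α = I.field α := by
  rw [coeff, dif_pos α.2]

theorem coeff_coupling (j : Fin n) (α : Fin 4) (β : Fin 3) :
    I.coeff (3 + (12 * j + (3 * α + β))) = I.coupling j α β := by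
  have h1 : (3 + (12 * (j : ℕ) + (3 * (α : ℕ) + β)) - 3) / 12 = j := by omega
  rw [coeff, dif_neg (by omega), dif_pos (by rw [h1]; exact j.2)]
  have h2 : (3 + (12 * (j : ℕ) + (3 * (α : ℕ) + β)) - 3) % 12 / 3 = α := by omega
  have h3 : (3 + (12 * (j : ℕ) + (3 * (α : ℕ) + β)) - 3) % 3 = β := by omega
  exact congr (congr (congrArg I.coupling (Fin.ext h1)) (Fin.ext h2)) (Fin.ext h3)

theorem hamiltonian_eq_sum_range : I.hamiltonian =
    ∑ i ∈ Finset.range (3 + 12 * n), (I.coeff i : ℝ) • pauliString (termLabels n i) := by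
  rw [sum_range_terms, hamiltonian_eq]
  simp only [coeff_field, coeff_coupling, real_smul_of_ratCast]
  congr 1
  · refine Finset.sum_congr rfl fun α _ => ?_
    rw [spin]
    congr 2
    funext v
    refine Fin.ext ?_
    simp only [termLabels, termLabel]
    rcases eq_or_ne v 0 with rfl | hv
    · rw [Pi.single_eq_same, if_pos (by simp; omega)]; simp; omega
    · have : (v : ℕ) ≠ 0 := fun h => hv (Fin.ext h)
      rw [Pi.single_eq_of_ne hv, if_neg (by omega), if_neg this]; rfl
  · refine Finset.sum_congr rfl fun j _ => Finset.sum_congr rfl fun α _ =>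
      Finset.sum_congr rfl fun β _ => ?_
    rw [spin_mul_spin (Fin.succ_ne_zero j).symm]
    congr 2
    funext v
    refine Fin.ext ?_
    simp only [termLabels, termLabel]
    rcases eq_or_ne v j.succ with rfl | hv
    · rw [Function.update_self, if_pos (by simp; omega)]; simp; omega
    · have h1 : (v : ℕ) ≠ j + 1 := fun h => hv (Fin.ext (by simpa using h))
      rw [Function.update_of_ne hv, if_neg (by omega)]
      rcases eq_or_ne v 0 with rfl | hv0
      · rw [Pi.single_eq_same, if_pos (by simp)]; omega
      · have : (v : ℕ) ≠ 0 := fun h => hv0 (Fin.ext h)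
        rw [Pi.single_eq_of_ne hv0, if_neg this]; rfl

/-- The sum of the absolute values of the coefficients bounds the spectrum. -/
theorem abs_apply_hamiltonian_le {ω : Matrix (Config n) (Config n) ℂ →ₗ[ℝ] ℝ}
    (hω : IsPositiveFunctional ω) :
    |ω I.hamiltonian| ≤ (∑ i ∈ Finset.range (3 + 12 * n), |(I.coeff i : ℝ)|) * ω 1 := by
  rw [hamiltonian_eq_sum_range, map_sum, Finset.sum_mul]
  refine (Finset.abs_sum_le_sum_abs _ _).trans (Finset.sum_le_sum fun i _ => ?_)
  rw [map_smul, smul_eq_mul, abs_mul]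
  exact mul_le_mul_of_nonneg_left
    (hω.abs_apply_le (pauliString_conjTranspose _) (pauliString_mul_self _)) (abs_nonneg _)

end StarIsing

/-! ### Entries of the Hamiltonian as integers -/

/-- The entries of a Pauli matrix, up to a factor `i` for the second one. -/
def pauliFactor (l a b : ℤ) : ℤ :=
  if 0 < l then if 0 < l - 1 then if 0 < l - 2 then 1 - a - b else a - b
    else (a - b) * (a - b) else 1 - (a - b) * (a - b)

theorem pauli_eq_pauliFactor (l : Fin 4) (a b : Fin 2) :
    pauli l a b = Complex.I ^ (if (l : ℕ) = 2 then 1 else 0) *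
      ((pauliFactor (l : ℕ) (a : ℕ) (b : ℕ) : ℤ) : ℂ) := by
  fin_cases l <;> fin_cases a <;> fin_cases b <;> simp [pauli, pauliFactor]

/-- The real two-by-two matrix of `i ^ y`. -/
def phaseEntry (y c d : ℤ) : ℤ :=
  -- For y in {0, 1, 2, 3}, the first summand is the real part, present for even y with sign 1 − y.
  -- The second is the imaginary part, present for odd y with sign 2 − y.
  (y + 1) % 2 * (1 - y) * (1 - (c - d) * (c - d)) + y % 2 * (2 - y) * (c - d)

theorem realBlock_I_pow (y : ℕ) (c d : Fin 2) :
    realBlock (Complex.I ^ y) c d = (phaseEntry ((y : ℤ) % 4) (c : ℕ) (d : ℕ) : ℤ) := by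
  have h1 : Complex.I ^ y = Complex.I ^ (y % 4) := by
    conv_lhs => rw [← Nat.div_add_mod y 4, pow_add, pow_mul, Complex.I_pow_four, one_pow, one_mul]
  have h2 : (y : ℤ) % 4 = ((y % 4 : ℕ) : ℤ) := by push_cast; rfl
  rw [h1, h2]
  have h3 : y % 4 < 4 := Nat.mod_lt _ (by norm_num)
  generalize y % 4 = r at h3
  interval_cases r <;> fin_cases c <;> fin_cases d <;>
    simp [realBlock, phaseEntry, pow_succ]

/-- The real matrix entry of a Pauli string. -/
def stringEntry (n i s t : ℕ) : ℤ :=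
  phaseEntry ((∑ v ∈ Finset.range (n + 1), if termLabel i v = 2 then 1 else 0) % 4)
      ((s / 2 ^ 0 % 2 : ℕ)) ((t / 2 ^ 0 % 2 : ℕ)) *
    ∏ v ∈ Finset.range (n + 1), pauliFactor (termLabel i v)
      ((s / 2 ^ (v + 1) % 2 : ℕ)) ((t / 2 ^ (v + 1) % 2 : ℕ))

/-- Every Y contributes a factor i, and these are collected into one power of i. Only this phase
needs a real block, and the product over the vertices remains an integer. Bit 0 of `s` and `t`
indexes the block, bit v + 1 the spin v. -/
theorem realMatrix_pauliString (n i s t : ℕ) :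
    realMatrix (pauliString (termLabels n i)) (bits (n + 2) s) (bits (n + 2) t) =
      stringEntry n i s t := by
  have h1 : pauliString (termLabels n i) (Fin.tail (bits (n + 2) s)) (Fin.tail (bits (n + 2) t)) =
      ((∏ v ∈ Finset.range (n + 1), pauliFactor (termLabel i v)
        ((s / 2 ^ (v + 1) % 2 : ℕ)) ((t / 2 ^ (v + 1) % 2 : ℕ)) : ℤ) : ℝ) *
      Complex.I ^ (∑ v ∈ Finset.range (n + 1), if termLabel i v = 2 then 1 else 0) := by
    simp only [pauliString, prodMat, pauli_eq_pauliFactor, Finset.prod_mul_distrib,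
      Finset.prod_pow_eq_pow_sum, Finset.sum_range, Finset.prod_range]
    rw [mul_comm]
    push_cast
    rfl
  rw [realMatrix, h1, realBlock_smul, realBlock_I_pow, stringEntry, mul_comm]
  push_cast
  rfl

/-- Sum over closed paths, with the vertices of a path given by the digits of a number. -/
def pathSum (A : ℕ → ℕ → ℤ) (d N : ℕ) : ℤ :=
  ∑ x ∈ Finset.range (d ^ (N + 1)), if x / d ^ 0 % d = x / d ^ N % d then
    ∏ i ∈ Finset.range N, A (x / d ^ i % d) (x / d ^ (i + 1) % d) else 0

/-- The entries of a shifted Hamiltonian with integer coefficients `z`. -/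
def shiftedEntry (n : ℕ) (z : ℕ → ℤ) (s t : ℕ) : ℤ :=
  (if s = t then ∑ i ∈ Finset.range (3 + 12 * n), |z i| else 0) -
    ∑ i ∈ Finset.range (3 + 12 * n), z i * stringEntry n i s t

theorem bits_injOn {m s t : ℕ} (hs : s < 2 ^ m) (ht : t < 2 ^ m) (h : bits m s = bits m t) :
    s = t := by
  have h1 : (finFunctionFinEquiv.symm ⟨s, hs⟩ : Fin m → Fin 2) =
    finFunctionFinEquiv.symm ⟨t, ht⟩ := h
  simpa using finFunctionFinEquiv.symm.injective h1

namespace StarIsing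

variable {n : ℕ} (I : StarIsing n)

/-- The factor `D` clears denominators, and the 2 comes from the real representation. The 2 cancels
in the ratio of two traces. -/
theorem pathSum_shiftedEntry {z : ℕ → ℤ} {D : ℝ} (hD : 0 < D)
    (hz : ∀ i < 3 + 12 * n, (z i : ℝ) = D * I.coeff i) (N : ℕ) :
    (pathSum (shiftedEntry n z) (2 ^ (n + 2)) N : ℝ) =
      2 * ((D • ((∑ i ∈ Finset.range (3 + 12 * n), |(I.coeff i : ℝ)|) • 1 -
        I.hamiltonian)) ^ N).trace.re := by
  set S := ∑ i ∈ Finset.range (3 + 12 * n), |(I.coeff i : ℝ)| with hS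
  have hSz : D * S = ((∑ i ∈ Finset.range (3 + 12 * n), |z i| : ℤ) : ℝ) := by
    rw [hS, Finset.mul_sum]
    push_cast
    refine Finset.sum_congr rfl fun i hi => ?_
    rw [hz i (Finset.mem_range.1 hi), abs_mul, abs_of_pos hD]
  rw [← sum_range_eq_trace_pow (m := n + 1) (fun s t => (shiftedEntry n z s t : ℝ)), pathSum]
  · push_cast
    rfl
  · intro s hs t ht
    have hb : bits (n + 2) s = bits (n + 2) t ↔ s = t :=
      ⟨bits_injOn hs ht, fun h => by rw [h]⟩
    have hM : (D • (S • 1 - I.hamiltonian) : Matrix (Config n) (Config n) ℂ) =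
        (D * S) • 1 - ∑ i ∈ Finset.range (3 + 12 * n),
          (z i : ℝ) • pauliString (termLabels n i) := by
      rw [smul_sub, smul_smul, hamiltonian_eq_sum_range, Finset.smul_sum]
      congr 1
      refine Finset.sum_congr rfl fun i hi => ?_
      rw [smul_smul, hz i (Finset.mem_range.1 hi)]
    have h1 : realMatrix (D • (S • 1 - I.hamiltonian)) (bits (n + 2) s) (bits (n + 2) t) =
        D * S * (1 : Matrix _ _ ℝ) (bits (n + 2) s) (bits (n + 2) t) -
          ∑ i ∈ Finset.range (3 + 12 * n), (z i : ℝ) * stringEntry n i s t := by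
      simp only [← realMatrix_pauliString, ← realMatrix_one]
      rw [hM]
      simp only [realMatrix, Matrix.sub_apply, Matrix.smul_apply, Matrix.sum_apply,
        realBlock_sub, realBlock_sum, Complex.real_smul, realBlock_smul]
    rw [h1, Matrix.one_apply]
    simp only [hb, shiftedEntry, hSz]
    push_cast
    split_ifs <;> simp

/-- Needed because the power method gives S − λ with a small relative error: the shift S must not be
much larger than |λ| for λ itself to inherit such an error. -/
theorem sum_abs_coeff_le {lam a b : ℝ} (ha : 0 < a)
    (hb : ∀ j α β, |(I.coupling j α β : ℝ)| ≤ b) (hb0 : 0 ≤ b)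
    (ha' : ∀ j, ∃ α β, a ≤ |(I.coupling j α β : ℝ)|)
    (hpsd : (I.hamiltonian - lam • 1).PosSemidef) :
    ∑ i ∈ Finset.range (3 + 12 * n), |(I.coeff i : ℝ)| ≤ (3 + 36 * (b / a)) * |lam| := by
  have hlam0 : lam ≤ 0 := (I.le_neg_abs_field hpsd 0).trans (neg_nonpos.2 (abs_nonneg _))
  have hnl : n * b ≤ 3 * (b / a) * |lam| := by
    have h5 : n * a ≤ 3 * |lam| := by
      rw [abs_of_nonpos hlam0]
      linarith [I.le_neg_mul_of_coupling hpsd ha']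
    calc n * b = b / a * (n * a) := by field_simp
      _ ≤ b / a * (3 * |lam|) := by gcongr
      _ = _ := by ring
  rw [sum_range_terms]
  simp only [coeff_field, coeff_coupling]
  have h1 : ∑ α, |(I.field α : ℝ)| ≤ 3 * |lam| := by
    rw [Fin.sum_univ_three, abs_of_nonpos hlam0]
    linarith [I.le_neg_abs_field hpsd 0, I.le_neg_abs_field hpsd 1, I.le_neg_abs_field hpsd 2]
  have h2 : ∑ j : Fin n, ∑ α, ∑ β, |(I.coupling j α β : ℝ)| ≤ n * (12 * b) := by
    refine (Finset.sum_le_sum fun j _ => Finset.sum_le_sum fun α _ =>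
      Finset.sum_le_sum fun β _ => hb j α β).trans_eq ?_
    simp only [Finset.sum_const, Finset.card_univ, Fintype.card_fin, nsmul_eq_mul]
    push_cast
    ring
  linarith

/-- The ratio of consecutive traces of powers of a shifted Hamiltonian approximates the ground
energy. -/
theorem trace_ratio_error {a b : ℝ} (ha : 0 < a) (hn : 0 < n)
    (hb : ∀ j α β, |(I.coupling j α β : ℝ)| ≤ b) (ha' : ∀ j, ∃ α β, a ≤ |(I.coupling j α β : ℝ)|)
    {z : ℕ → ℤ} {D : ℤ} (hD : 0 < D) (hz : ∀ i < 3 + 12 * n, (z i : ℝ) = D * I.coeff i)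
    {q : ℕ} (hq : 0 < q) {μ : Config n → ℝ} {s₀ : Config n} (hmin : ∀ s, μ s₀ ≤ μ s)
    (hpsd : (I.hamiltonian - μ s₀ • 1).PosSemidef)
    (htr : ∀ c d : ℝ, ∀ N : ℕ, ((d • (c • 1 - I.hamiltonian)) ^ N).trace =
      ((∑ s, (d * (c - μ s)) ^ N : ℝ) : ℂ))
    (hst : ∀ s, ∃ ω : Matrix (Config n) (Config n) ℂ →ₗ[ℝ] ℝ, IsPositiveFunctional ω ∧ 0 < ω 1 ∧
      ω I.hamiltonian = μ s * ω 1) :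
    0 < pathSum (shiftedEntry n z) (2 ^ (n + 2)) (q * (n + 1 + q)) ∧
    |(((∑ i ∈ Finset.range (3 + 12 * n), |z i|) *
        pathSum (shiftedEntry n z) (2 ^ (n + 2)) (q * (n + 1 + q)) -
        pathSum (shiftedEntry n z) (2 ^ (n + 2)) (q * (n + 1 + q) + 1) : ℤ) : ℝ) /
      ((D * pathSum (shiftedEntry n z) (2 ^ (n + 2)) (q * (n + 1 + q)) : ℤ) : ℝ) - μ s₀| ≤
      (4 + 36 * (b / a)) / q * |μ s₀| := by
  have hb0 : 0 ≤ b := (abs_nonneg _).trans (hb ⟨0, hn⟩ 0 0)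
  have hD' : (0 : ℝ) < D := by exact_mod_cast hD
  have hq' : (0 : ℝ) < q := by exact_mod_cast hq
  have hn' : (0 : ℝ) < n := by exact_mod_cast hn
  set S := ∑ i ∈ Finset.range (3 + 12 * n), |(I.coeff i : ℝ)| with hS
  have hSz : ((∑ i ∈ Finset.range (3 + 12 * n), |z i| : ℤ) : ℝ) = D * S := by
    rw [hS, Finset.mul_sum]
    push_cast
    refine Finset.sum_congr rfl fun i hi => ?_
    rw [hz i (Finset.mem_range.1 hi), abs_mul, abs_of_pos hD']
  have hlam : μ s₀ < 0 := by
    have h1 := I.le_neg_mul_of_coupling hpsd ha'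
    have h2 : 0 < n * a / 3 := by positivity
    linarith
  have hS0 : 0 ≤ S := Finset.sum_nonneg fun i _ => abs_nonneg _
  have hμS : ∀ s, μ s ≤ S := by
    intro s
    obtain ⟨ω, hω, h1, h2⟩ := hst s
    have h3 := (le_abs_self _).trans (I.abs_apply_hamiltonian_le hω)
    rw [h2] at h3
    exact le_of_mul_le_mul_right h3 h1
  set x : Config n → ℝ := fun s => D * (S - μ s) with hx
  set N := q * (n + 1 + q) with hN
  -- `c = n + 1` because there are 2^(n+1) eigenvalues.
  obtain ⟨h1, h2, h3⟩ := power_sum_ratio x s₀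
    (fun s => mul_nonneg hD'.le (sub_nonneg.2 (hμS s)))
    (fun s => mul_le_mul_of_nonneg_left (by linarith [hmin s]) hD'.le)
    (mul_pos hD' (by linarith)) (c := n + 1) hq (by simp)
  rw [← hN] at h1 h2 h3
  have hT : ∀ N, (pathSum (shiftedEntry n z) (2 ^ (n + 2)) N : ℝ) = 2 * ∑ s, x s ^ N := by
    intro N
    rw [I.pathSum_shiftedEntry hD' hz, htr, Complex.ofReal_re]
  have hpos : 0 < pathSum (shiftedEntry n z) (2 ^ (n + 2)) N := by
    have : (0 : ℝ) < pathSum (shiftedEntry n z) (2 ^ (n + 2)) N := by rw [hT]; linarith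
    exact_mod_cast this
  refine ⟨hpos, ?_⟩
  push_cast [hT]
  have hSz' : ∑ i ∈ Finset.range (3 + 12 * n), |(z i : ℝ)| = D * S := by
    rw [← hSz]; push_cast; rfl
  rw [hSz']
  set A := ∑ s, x s ^ N with hA
  set B := ∑ s, x s ^ (N + 1) with hB
  have hx0 : x s₀ = D * (S - μ s₀) := rfl
  have e : (D * S * (2 * A) - 2 * B) / (D * (2 * A)) - μ s₀ = (x s₀ * A - B) / (D * A) := by
    rw [hx0]; field_simp; ring
  rw [e, abs_of_nonneg (div_nonneg (by linarith) (by positivity)), div_le_iff₀ (by positivity)]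
  have h4 : x s₀ * A - B ≤ 1 / q * (D * (S - μ s₀)) * A := by
    rw [← hx0]; linarith
  refine h4.trans ?_
  have h5 : S - μ s₀ ≤ (4 + 36 * (b / a)) * |μ s₀| := by
    have := I.sum_abs_coeff_le ha hb hb0 ha' hpsd
    rw [abs_of_neg hlam] at this ⊢
    linarith
  have h6 : (4 + 36 * (b / a)) / q * |μ s₀| * (D * A) =
      1 / q * (D * ((4 + 36 * (b / a)) * |μ s₀|)) * A := by ring
  rw [h6]
  gcongr

end StarIsing

/-! ### Terms for the two algorithms -/

theorem FoldOp.iter_congr (o : FoldOp) {f g : ℕ → ℤ} {N : ℕ} (h : ∀ i < N, f i = g i) :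
    o.iter f N = o.iter g N := by
  induction N with
  | zero => rfl
  | succ N ih =>
    rw [iter, iter, ih fun i hi => h i (hi.trans N.lt_succ_self), h N N.lt_succ_self]

namespace Tm

instance : Add Tm := ⟨bin .plus⟩
instance : Sub Tm := ⟨bin .minus⟩
instance : Mul Tm := ⟨bin .times⟩
instance : Div Tm := ⟨bin .quot⟩

/-- The term `e` has the value `v`, and its evaluation only involves ranges of length at most
`T`. -/
def Computes (inp : Store) (T : ℕ) (e : Tm) (env : ℕ → ℤ) (v : ℤ) : Prop :=
  eval inp e env = v ∧ LoopsLE inp T e env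

section Computes

variable {inp : Store} {T : ℕ} {env : ℕ → ℤ} {e f c N : Tm} {v w u : ℤ}

theorem Computes.congr (h : Computes inp T e env v) (hvw : v = w) : Computes inp T e env w :=
  hvw ▸ h

theorem computes_const (z : ℤ) : Computes inp T (const z) env z := ⟨rfl, trivial⟩

theorem computes_var (x : ℕ) : Computes inp T (var x) env (env x) := ⟨rfl, trivial⟩

theorem computes_var_of_eq {x : ℕ} (h : env x = v) : Computes inp T (var x) env v := ⟨h, trivial⟩

theorem Computes.readInput {a : Fin 3} {m : ℕ} (h : Computes inp T e env m) :
    Computes inp T (.inp a e) env (inp a m) := by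
  refine ⟨?_, h.2⟩
  rw [eval, h.1, Int.toNat_natCast]

theorem Computes.add (he : Computes inp T e env v) (hf : Computes inp T f env w) :
    Computes inp T (e + f) env (v + w) :=
  ⟨congrArg₂ (· + ·) he.1 hf.1, he.2, hf.2⟩

theorem Computes.sub (he : Computes inp T e env v) (hf : Computes inp T f env w) :
    Computes inp T (e - f) env (v - w) :=
  ⟨congrArg₂ (· - ·) he.1 hf.1, he.2, hf.2⟩

theorem Computes.mul (he : Computes inp T e env v) (hf : Computes inp T f env w) :
    Computes inp T (e * f) env (v * w) :=
  ⟨congrArg₂ (· * ·) he.1 hf.1, he.2, hf.2⟩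

theorem Computes.div (he : Computes inp T e env v) (hf : Computes inp T f env w) :
    Computes inp T (e / f) env (v / w) :=
  ⟨congrArg₂ (· / ·) he.1 hf.1, he.2, hf.2⟩

theorem Computes.ite (hc : Computes inp T c env u) (he : 0 < u → Computes inp T e env v)
    (hf : ¬ 0 < u → Computes inp T f env w) :
    Computes inp T (.ite c e f) env (if 0 < u then v else w) := by
  obtain ⟨rfl, hcl⟩ := hc
  refine ⟨?_, hcl, fun h => (he h).2, fun h => (hf h).2⟩
  rw [eval]
  split_ifs with h
  · exact (he h).1
  · exact (hf h).1

theorem Computes.fold (o : FoldOp) (x : ℕ) {m : ℕ} {F : ℕ → ℤ} (hN : Computes inp T N env m)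
    (hm : m ≤ T) (he : ∀ i < m, Computes inp T e (Function.update env x i) (F i)) :
    Computes inp T (.fold o x N e) env (o.iter F m) := by
  have h : (eval inp N env).toNat = m := by rw [hN.1, Int.toNat_natCast]
  refine ⟨?_, hN.2, by rwa [h], fun i hi => (he i (h ▸ hi)).2⟩
  rw [eval, h]
  exact o.iter_congr fun i hi => (he i hi).1

theorem Computes.foldSum (x : ℕ) {m : ℕ} {F : ℕ → ℤ} (hN : Computes inp T N env m)
    (hm : m ≤ T) (he : ∀ i < m, Computes inp T e (Function.update env x i) (F i)) :
    Computes inp T (.fold .sum x N e) env (∑ i ∈ Finset.range m, F i) :=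
  (Computes.fold .sum x hN hm he).congr (FoldOp.iter_sum F m)

theorem Computes.foldProd (x : ℕ) {m : ℕ} {F : ℕ → ℤ} (hN : Computes inp T N env m)
    (hm : m ≤ T) (he : ∀ i < m, Computes inp T e (Function.update env x i) (F i)) :
    Computes inp T (.fold .prod x N e) env (∏ i ∈ Finset.range m, F i) :=
  (Computes.fold .prod x hN hm he).congr (FoldOp.iter_prod F m)

/-- Remainder. -/
def modulo (e f : Tm) : Tm := e - f * (e / f)

theorem Computes.modulo (he : Computes inp T e env v) (hf : Computes inp T f env w) :
    Computes inp T (modulo e f) env (v % w) :=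
  (he.sub (hf.mul (he.div hf))).congr (Int.emod_def v w).symm

/-- Powers, with `x` as auxiliary variable. -/
def power (x : ℕ) (b e : Tm) : Tm := .fold .prod x e b

/-- The base is evaluated inside the loop, with `x` overwritten, so its value must not depend on
`x`. To avoid capture, auxiliary loops use variables from 80 on and the main loops use 1 to 5. -/
theorem Computes.power (x : ℕ) {m : ℕ} (he : Computes inp T e env m) (hm : m ≤ T)
    (hf : ∀ i : ℕ, Computes inp T f (Function.update env x i) v) :
    Computes inp T (power x f e) env (v ^ m) :=
  (Computes.foldProd x he hm fun i _ => hf i).congr (by simp)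

/-- Case distinction by an equality. -/
def ifEq (e f a b : Tm) : Tm := .ite (const 1 - (e - f) * (e - f)) a b

theorem Computes.ifEq {a b : Tm} {s t : ℤ} (he : Computes inp T e env v)
    (hf : Computes inp T f env w) (ha : v = w → Computes inp T a env s)
    (hb : v ≠ w → Computes inp T b env t) :
    Computes inp T (ifEq e f a b) env (if v = w then s else t) := by
  have key : 0 < 1 - (v - w) * (v - w) ↔ v = w := by
    constructor
    · intro h
      by_contra hne
      have : 0 < (v - w) * (v - w) := mul_self_pos.2 (sub_ne_zero.2 hne)
      omega
    · rintro rfl; simp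
  refine (Computes.ite ((computes_const 1).sub ((he.sub hf).mul (he.sub hf)))
    (fun h => ha (key.1 h)) (fun h => hb fun h' => h (key.2 h'))).congr ?_
  simp only [key]

end Computes

/-! ### Reading the input -/

/-- The number of bath spins. -/
def numBath : Tm := .inp 0 (const 0)

/-- The number of coefficients. -/
def numTerms : Tm := const 3 + const 12 * numBath

/-- The product of the denominators. -/
def denominator : Tm := .fold .prod 90 numTerms (.inp 2 (var 90))

/-- The coefficients, multiplied by the product of the denominators. -/
def coefficient (e : Tm) : Tm := .inp 1 e * (denominator / .inp 2 e)

/-- The sum of the absolute values of the scaled coefficients. -/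
def absSum : Tm := .fold .sum 80 numTerms
  (.ite (coefficient (var 80)) (coefficient (var 80)) (const 0 - coefficient (var 80)))

/-- A multiple of the accuracy parameter. -/
def resolution (Q : ℕ) : Tm := const Q * .inp 0 (const 1)

end Tm

/-! ### Integer coefficients over a common denominator -/

namespace StarIsing

variable {n : ℕ} (I : StarIsing n)

/-- The product of the denominators of the coefficients. -/
def commonDen : ℤ := ∏ i ∈ Finset.range (3 + 12 * n), ((I.coeff i).den : ℤ)

/-- The coefficients, multiplied by the product of their denominators. -/
def scaledCoeff (i : ℕ) : ℤ := I.input 0 1 i * (I.commonDen / I.input 0 2 i)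

theorem commonDen_pos : 0 < I.commonDen :=
  Finset.prod_pos fun i _ => by exact_mod_cast (I.coeff i).den_pos

theorem input_one (k : ℕ) {i : ℕ} (hi : i < 3 + 12 * n) : I.input k 1 i = (I.coeff i).num := by
  simp [input, hi]

theorem input_two (k : ℕ) {i : ℕ} (hi : i < 3 + 12 * n) : I.input k 2 i = (I.coeff i).den := by
  simp [input, hi]

/-- Each denominator divides the product of all of them, so the integer division is exact. -/
theorem scaledCoeff_eq {i : ℕ} (hi : i < 3 + 12 * n) :
    (I.scaledCoeff i : ℝ) = I.commonDen * I.coeff i := by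
  have hdvd : ((I.coeff i).den : ℤ) ∣ I.commonDen :=
    Finset.dvd_prod_of_mem _ (Finset.mem_range.2 hi)
  have hd : ((I.coeff i).den : ℝ) ≠ 0 := by exact_mod_cast (I.coeff i).den_ne_zero
  rw [scaledCoeff, input_one I 0 hi, input_two I 0 hi, Int.cast_mul, Int.cast_div hdvd
    (by exact_mod_cast (I.coeff i).den_ne_zero)]
  have h : ((I.coeff i : ℚ) : ℝ) = (I.coeff i).num / (I.coeff i).den := by
    conv_lhs => rw [← Rat.num_div_den (I.coeff i)]
    push_cast; rfl
  rw [h]; push_cast; field_simp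

end StarIsing

namespace Tm

section Input

variable {n : ℕ} (I : StarIsing n) {k T : ℕ} {env : ℕ → ℤ} {e : Tm}

theorem computes_numBath : Computes (I.input k) T numBath env (n : ℕ) :=
  (Computes.readInput (m := 0) (computes_const _)).congr rfl

theorem computes_resolution (Q : ℕ) :
    Computes (I.input k) T (resolution Q) env ((Q * k : ℕ) : ℤ) :=
  ((computes_const (Q : ℤ)).mul (Computes.readInput (m := 1) (computes_const _))).congr (by
    push_cast; rfl)

theorem computes_numTerms : Computes (I.input k) T numTerms env ((3 + 12 * n : ℕ) : ℤ) :=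
  ((computes_const 3).add ((computes_const 12).mul (computes_numBath I))).congr (by push_cast; rfl)

theorem computes_denominator (hT : 3 + 12 * n ≤ T) :
    Computes (I.input k) T denominator env I.commonDen :=
  Computes.foldProd 90 (computes_numTerms I) hT fun i hi => by
    have h : Computes (I.input k) T (var 90) (Function.update env 90 (i : ℤ)) i :=
      computes_var_of_eq (Function.update_self _ _ _)
    exact h.readInput.congr (I.input_two k hi)

theorem computes_coefficient (hT : 3 + 12 * n ≤ T) {i : ℕ}
    (he : Computes (I.input k) T e env i) :
    Computes (I.input k) T (coefficient e) env (I.scaledCoeff i) :=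
  (he.readInput.mul ((computes_denominator I hT).div he.readInput)).congr (by
    have h1 : I.input k 1 i = I.input 0 1 i := by simp [StarIsing.input]
    have h2 : I.input k 2 i = I.input 0 2 i := by simp [StarIsing.input]
    rw [StarIsing.scaledCoeff, ← h1, ← h2]; rfl)

theorem computes_absSum (hT : 3 + 12 * n ≤ T) :
    Computes (I.input k) T absSum env (∑ i ∈ Finset.range (3 + 12 * n), |I.scaledCoeff i|) :=
  Computes.foldSum 80 (computes_numTerms I) hT fun i _ => by
    have h := computes_coefficient I (k := k) hT (computes_var_of_eq
      (Function.update_self 80 (i : ℤ) env))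
    refine (h.ite (fun _ => h) fun _ => (computes_const 0).sub h).congr ?_
    split_ifs with hz
    · exact (abs_of_pos hz).symm
    · rw [abs_of_nonpos (not_lt.1 hz), zero_sub]

end Input

/-! ### Minimization over a grid -/

/-- The number of grid points on a line. -/
def gridWidth (Q : ℕ) : Tm := const 2 * resolution Q + const 1

/-- A coordinate of a grid point. -/
def coordinate (Q : ℕ) (y a : Tm) : Tm :=
  modulo (y / power 91 (gridWidth Q) a) (gridWidth Q) - resolution Q

/-- The value of `e` if the grid point `y` is in the unit ball, and zero otherwise. -/
def ifInBall (Q y : ℕ) (e : Tm) : Tm :=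
  .ite (resolution Q * resolution Q + const 1 -
    .fold .sum 93 (const 3) (coordinate Q (var y) (var 93) * coordinate Q (var y) (var 93)))
    e (const 0)

/-- The number of grid points in the cube. -/
def gridSize (Q : ℕ) : Tm := gridWidth Q * gridWidth Q * gridWidth Q

/-- The energy of the bath spin `2` for the Bloch vectors `1` of the central spin and `3` of the
bath spin. -/
def bathEnergy (Q : ℕ) : Tm :=
  .fold .sum 4 (const 3) ((resolution Q * coefficient (const 3 + (const 12 * var 2 + var 4)) +
    .fold .sum 5 (const 3) (coefficient (const 3 + (const 12 * var 2 +
      (const 3 * (var 5 + const 1) + var 4))) * coordinate Q (var 1) (var 5))) *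
    coordinate Q (var 3) (var 4))

/-- The minimum of the energy over the grid. -/
def gridMinimum (Q : ℕ) : Tm :=
  .fold .min 1 (gridSize Q) (ifInBall Q 1
    (resolution Q * .fold .sum 5 (const 3) (coefficient (var 5) * coordinate Q (var 1) (var 5)) +
      .fold .sum 2 numBath (.fold .min 3 (gridSize Q) (ifInBall Q 3 (bathEnergy Q)))))

end Tm

/-- A coordinate of a grid point with given number. -/
def gridCoord (G p a : ℕ) : ℤ := ((p / (2 * G + 1) ^ a % (2 * G + 1) : ℕ) : ℤ) - (G : ℤ)

/-- The value `v` if a grid point is in the ball, and zero otherwise. -/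
def gridCut (G p : ℕ) (v : ℤ) : ℤ :=
  if 0 < (G : ℤ) * (G : ℤ) + 1 - ∑ a ∈ Finset.range 3, gridCoord G p a * gridCoord G p a then v
  else 0

/-- The energy of a bath spin. -/
def gridBath (z : ℕ → ℤ) (G p j p' : ℕ) : ℤ :=
  ∑ b ∈ Finset.range 3, ((G : ℤ) * z (3 + (12 * j + b)) + ∑ a ∈ Finset.range 3,
    z (3 + (12 * j + (3 * (a + 1) + b))) * gridCoord G p a) * gridCoord G p' b

/-- The minimum of the energy over the grid. -/
def gridMin (z : ℕ → ℤ) (n G : ℕ) : ℤ :=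
  FoldOp.min.iter (fun p => gridCut G p ((G : ℤ) * ∑ a ∈ Finset.range 3, z a * gridCoord G p a +
    ∑ j ∈ Finset.range n, FoldOp.min.iter (fun p' => gridCut G p' (gridBath z G p j p'))
      ((2 * G + 1) ^ 3))) ((2 * G + 1) ^ 3)

namespace Tm

section Grid

variable {n : ℕ} (I : StarIsing n) {k T : ℕ} {env : ℕ → ℤ} {e y a : Tm} (Q : ℕ)

theorem computes_gridWidth :
    Computes (I.input k) T (gridWidth Q) env ((2 * (Q * k) + 1 : ℕ) : ℤ) :=
  (((computes_const 2).mul (computes_resolution I Q)).add (computes_const 1)).congr (by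
    push_cast; rfl)

theorem computes_gridSize :
    Computes (I.input k) T (gridSize Q) env (((2 * (Q * k) + 1) ^ 3 : ℕ) : ℤ) :=
  (((computes_gridWidth I Q).mul (computes_gridWidth I Q)).mul (computes_gridWidth I Q)).congr (by
    push_cast; ring)

theorem computes_coordinate {p i : ℕ} (hy : Computes (I.input k) T y env p)
    (ha : Computes (I.input k) T a env i) (hi : i ≤ T) :
    Computes (I.input k) T (coordinate Q y a) env (gridCoord (Q * k) p i) :=
  (((hy.div (ha.power 91 hi fun _ => computes_gridWidth I Q)).modulo
    (computes_gridWidth I Q)).sub (computes_resolution I Q)).congr (by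
      rw [gridCoord]; push_cast; rfl)

theorem computes_ifInBall {x p : ℕ} {v : ℤ} (hx : x ≠ 93) (hT : 3 ≤ T) (hp : env x = p)
    (he : Computes (I.input k) T e env v) :
    Computes (I.input k) T (ifInBall Q x e) env (gridCut (Q * k) p v) :=
  (Computes.ite ((((computes_resolution I Q).mul (computes_resolution I Q)).add
    (computes_const 1)).sub (Computes.foldSum 93 (m := 3) (computes_const 3) hT fun i hi => by
      have h := computes_coordinate I (k := k) (T := T) (env := Function.update env 93 (i : ℤ)) Q
        (computes_var_of_eq (x := x) (by rw [Function.update_of_ne hx, hp]))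
        (computes_var_of_eq (Function.update_self _ _ _)) (hi.le.trans hT)
      exact h.mul h)) (fun _ => he) (fun _ => computes_const 0)).congr rfl

theorem computes_bathEnergy (hT : 3 + 12 * n ≤ T) {p j p' : ℕ} (h1 : env 1 = p) (h2 : env 2 = j)
    (h3 : env 3 = p') :
    Computes (I.input k) T (bathEnergy Q) env (gridBath I.scaledCoeff (Q * k) p j p') := by
  refine Computes.foldSum 4 (m := 3) (computes_const 3) (by omega) fun b hb => ?_
  refine Computes.mul (Computes.add (Computes.mul (computes_resolution I Q)
    (computes_coefficient I hT ?_)) (Computes.foldSum 5 (m := 3) (computes_const 3) (by omega)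
      fun a ha => Computes.mul (computes_coefficient I hT ?_) (computes_coordinate I Q ?_ ?_ ?_)))
    (computes_coordinate I Q ?_ ?_ ?_)
  · refine ((computes_const 3).add (((computes_const 12).mul (computes_var 2)).add
      (computes_var 4))).congr ?_
    simp [h2]
  · refine ((computes_const 3).add (((computes_const 12).mul (computes_var 2)).add
      (((computes_const 3).mul ((computes_var 5).add (computes_const 1))).add
      (computes_var 4)))).congr ?_
    simp [h2]
  · exact computes_var_of_eq (by simp [h1])
  · exact computes_var_of_eq (by simp)
  · omega
  · exact computes_var_of_eq (by simp [h3])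
  · exact computes_var_of_eq (by simp)
  · omega

theorem computes_gridMinimum (hT : 3 + 12 * n ≤ T) (hW : (2 * (Q * k) + 1) ^ 3 ≤ T) :
    Computes (I.input k) T (gridMinimum Q) env (gridMin I.scaledCoeff n (Q * k)) := by
  refine Computes.fold .min 1 (computes_gridSize I Q) hW fun p hp => ?_
  refine computes_ifInBall I Q (by norm_num) (by omega) (Function.update_self _ _ _) ?_
  refine Computes.add (Computes.mul (computes_resolution I Q) (Computes.foldSum 5 (m := 3)
    (computes_const 3) (by omega) fun a ha => Computes.mul (computes_coefficient I hT ?_)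
      (computes_coordinate I Q ?_ ?_ ?_))) (Computes.foldSum 2 (computes_numBath I) (by omega)
      fun j hj => Computes.fold .min 3 (computes_gridSize I Q) hW fun p' hp' =>
        computes_ifInBall I Q (by norm_num) (by omega) ?_ (computes_bathEnergy I Q hT ?_ ?_ ?_))
  · exact computes_var_of_eq (by simp)
  · exact computes_var_of_eq (by simp)
  · exact computes_var_of_eq (by simp)
  · omega
  · simp
  · simp
  · simp
  · simp

end Grid

/-! ### Traces of powers -/

/-- The dimension of the real representation. -/
def dimension : Tm := power 81 (const 2) (numBath + const 2)

/-- A digit of the number of a path. -/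
def digit (i : Tm) : Tm := modulo (var 1 / power 82 dimension i) dimension

/-- A bit of a number. -/
def bit (s v : Tm) : Tm := modulo (s / power 83 (const 2) v) (const 2)

/-- The Pauli label of the term `3` at the vertex `4`. -/
def label : Tm := ifEq (var 4) ((var 3 + const 9) / const 12) (modulo (var 3) (const 3) + const 1)
  (ifEq (var 4) (const 0) (modulo (var 3 + const 9) (const 12) / const 3) (const 0))

/-- The entries of Pauli matrices. -/
def factor (l a b : Tm) : Tm :=
  .ite l (.ite (l - const 1) (.ite (l - const 2) (const 1 - a - b) (a - b)) ((a - b) * (a - b)))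
    (const 1 - (a - b) * (a - b))

/-- The entries of powers of the imaginary unit. -/
def phase (y c d : Tm) : Tm :=
  modulo (y + const 1) (const 2) * (const 1 - y) * (const 1 - (c - d) * (c - d)) +
    modulo y (const 2) * (const 2 - y) * (c - d)

/-- The entries of the Pauli string of the term `3`. -/
def pauliEntry (s t : Tm) : Tm :=
  phase (modulo (.fold .sum 4 (numBath + const 1) (ifEq label (const 2) (const 1) (const 0)))
      (const 4)) (bit s (const 0)) (bit t (const 0)) *
    .fold .prod 4 (numBath + const 1)
      (factor label (bit s (var 4 + const 1)) (bit t (var 4 + const 1)))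

/-- The entries of the shifted Hamiltonian. -/
def entry (s t : Tm) : Tm :=
  ifEq s t absSum (const 0) - .fold .sum 3 numTerms (coefficient (var 3) * pauliEntry s t)

/-- The trace of a power of the shifted Hamiltonian. -/
def tracePower (N : Tm) : Tm :=
  .fold .sum 1 (power 84 dimension (N + const 1)) (ifEq (digit (const 0)) (digit N)
    (.fold .prod 2 N (entry (digit (var 2)) (digit (var 2 + const 1)))) (const 0))

section Trace

variable {n : ℕ} (I : StarIsing n) {k T : ℕ} {env : ℕ → ℤ} {s t N : Tm}

theorem computes_dimension (hT : n + 2 ≤ T) :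
    Computes (I.input k) T dimension env ((2 ^ (n + 2) : ℕ) : ℤ) :=
  (Computes.power 81 (m := n + 2) (((computes_numBath I).add (computes_const 2)).congr (by
    push_cast; rfl)) hT fun _ => computes_const 2).congr (by push_cast; rfl)

theorem computes_digit (hT : n + 2 ≤ T) {x m : ℕ} {i : Tm} (hx : env 1 = x)
    (hi : Computes (I.input k) T i env m) (hm : m ≤ T) :
    Computes (I.input k) T (digit i) env
      ((x / (2 ^ (n + 2)) ^ m % 2 ^ (n + 2) : ℕ) : ℤ) :=
  (((computes_var_of_eq hx).div (hi.power 82 hm fun _ => computes_dimension I hT)).modulo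
    (computes_dimension I hT)).congr (by push_cast; rfl)

theorem computes_bit {x m : ℕ} {v : Tm} (hs : Computes (I.input k) T s env x)
    (hv : Computes (I.input k) T v env m) (hm : m ≤ T) :
    Computes (I.input k) T (bit s v) env ((x / 2 ^ m % 2 : ℕ) : ℤ) :=
  ((hs.div (hv.power 83 hm fun _ => computes_const 2)).modulo (computes_const 2)).congr (by
    push_cast; rfl)

theorem computes_label {i v : ℕ} (hi : env 3 = i) (hv : env 4 = v) :
    Computes (I.input k) T label env (termLabel i v : ℕ) := by
  have h3 : Computes (I.input k) T (var 3) env i := computes_var_of_eq hi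
  have h4 : Computes (I.input k) T (var 4) env v := computes_var_of_eq hv
  refine (h4.ifEq ((h3.add (computes_const 9)).div (computes_const 12))
    (fun _ => (h3.modulo (computes_const 3)).add (computes_const 1))
    (fun _ => h4.ifEq (computes_const 0) (fun _ => ((h3.add (computes_const 9)).modulo
      (computes_const 12)).div (computes_const 3)) (fun _ => computes_const 0))).congr ?_
  rw [termLabel]
  push_cast
  congr 1
  · norm_cast
  · congr 1; norm_cast

theorem computes_factor {l a b : Tm} {x y z : ℤ} (hl : Computes (I.input k) T l env x)
    (ha : Computes (I.input k) T a env y) (hb : Computes (I.input k) T b env z) :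
    Computes (I.input k) T (factor l a b) env (pauliFactor x y z) :=
  hl.ite (fun _ => (hl.sub (computes_const 1)).ite (fun _ => (hl.sub (computes_const 2)).ite
    (fun _ => ((computes_const 1).sub ha).sub hb) (fun _ => ha.sub hb))
    (fun _ => (ha.sub hb).mul (ha.sub hb)))
    (fun _ => (computes_const 1).sub ((ha.sub hb).mul (ha.sub hb)))

theorem computes_phase {l a b : Tm} {x y z : ℤ} (hl : Computes (I.input k) T l env x)
    (ha : Computes (I.input k) T a env y) (hb : Computes (I.input k) T b env z) :
    Computes (I.input k) T (phase l a b) env (phaseEntry x y z) :=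
  ((((hl.add (computes_const 1)).modulo (computes_const 2)).mul ((computes_const 1).sub hl)).mul
    ((computes_const 1).sub ((ha.sub hb).mul (ha.sub hb)))).add
    (((hl.modulo (computes_const 2)).mul ((computes_const 2).sub hl)).mul (ha.sub hb))

/-- The row and column terms `s` and `t` depend only on variable 1 (the path) and variable 2 (the
position on it). They are therefore assumed to keep their values in every environment agreeing
there, so that loops over other variables may enclose them. -/
theorem computes_pauliEntry (hT : n + 2 ≤ T) {i x y : ℕ} (hi : env 3 = i)
    (hs : ∀ env', env' 1 = env 1 → env' 2 = env 2 → Computes (I.input k) T s env' x)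
    (ht : ∀ env', env' 1 = env 1 → env' 2 = env 2 → Computes (I.input k) T t env' y) :
    Computes (I.input k) T (pauliEntry s t) env (stringEntry n i x y) := by
  have hn : Computes (I.input k) T (numBath + const 1) env ((n + 1 : ℕ) : ℤ) :=
    ((computes_numBath I).add (computes_const 1)).congr (by push_cast; rfl)
  have hlab : ∀ v : ℕ, Computes (I.input k) T label (Function.update env 4 (v : ℤ))
      (termLabel i v : ℕ) := fun v =>
    computes_label I (by simp [hi]) (by simp)
  have hv : ∀ v : ℕ, Computes (I.input k) T (var 4 + const 1) (Function.update env 4 (v : ℤ))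
      ((v + 1 : ℕ) : ℤ) := fun v =>
    ((computes_var_of_eq (Function.update_self _ _ _)).add (computes_const 1)).congr (by
      push_cast; rfl)
  refine (Computes.mul (computes_phase I (Computes.modulo (Computes.foldSum 4 hn (by omega)
    fun v hvn => (hlab v).ifEq (computes_const 2) (fun _ => computes_const 1)
      (fun _ => computes_const 0)) (computes_const 4))
    (computes_bit I (m := 0) (hs _ rfl rfl) (computes_const 0) (by omega))
    (computes_bit I (m := 0) (ht _ rfl rfl) (computes_const 0) (by omega)))
    (Computes.foldProd 4 hn (by omega) fun v hvn => computes_factor I (hlab v)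
      (computes_bit I (hs _ (by simp) (by simp))
        (hv v) (by omega))
      (computes_bit I (ht _ (by simp) (by simp))
        (hv v) (by omega)))).congr ?_
  rw [stringEntry]
  congr 3
  refine Finset.sum_congr rfl fun v _ => ?_
  norm_cast

theorem computes_entry (hT : 3 + 12 * n ≤ T) {x y : ℕ}
    (hs : ∀ env', env' 1 = env 1 → env' 2 = env 2 → Computes (I.input k) T s env' x)
    (ht : ∀ env', env' 1 = env 1 → env' 2 = env 2 → Computes (I.input k) T t env' y) :
    Computes (I.input k) T (entry s t) env (shiftedEntry n I.scaledCoeff x y) := by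
  refine (Computes.sub ((hs _ rfl rfl).ifEq (ht _ rfl rfl) (fun _ => computes_absSum I hT)
    (fun _ => computes_const 0)) (Computes.foldSum 3 (computes_numTerms I) hT fun i hi =>
      (computes_coefficient I hT (computes_var_of_eq (Function.update_self _ _ _))).mul
      (computes_pauliEntry I (by omega) (Function.update_self _ _ _)
        (fun env' h1 h2 => hs env' (by simpa [Function.update_apply] using h1)
          (by simpa [Function.update_apply] using h2))
        (fun env' h1 h2 => ht env' (by simpa [Function.update_apply] using h1)
          (by simpa [Function.update_apply] using h2))))).congr ?_
  rw [shiftedEntry]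
  norm_cast

theorem computes_tracePower (hT : 3 + 12 * n ≤ T) {m : ℕ}
    (hN : ∀ env, Computes (I.input k) T N env m) (hm : (2 ^ (n + 2)) ^ (m + 1) ≤ T) :
    Computes (I.input k) T (tracePower N) env
      (pathSum (shiftedEntry n I.scaledCoeff) (2 ^ (n + 2)) m) := by
  have hmT : m + 1 ≤ T := by
    refine le_trans ?_ hm
    have h1 : m + 1 < 2 ^ (m + 1) := Nat.lt_two_pow_self
    have h2 : 2 ^ (m + 1) ≤ (2 ^ (n + 2)) ^ (m + 1) :=
      Nat.pow_le_pow_left (Nat.le_self_pow (by omega) 2) _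
    omega
  have hT2 : n + 2 ≤ T := by omega
  refine (Computes.foldSum 1 (m := (2 ^ (n + 2)) ^ (m + 1)) ((Computes.power 84 (m := m + 1)
    (((hN _).add (computes_const 1)).congr (by push_cast; rfl)) hmT
      fun _ => computes_dimension I hT2).congr (by push_cast; rfl)) hm fun x hx =>
    (computes_digit I hT2 (Function.update_self _ _ _) (computes_const ((0 : ℕ) : ℤ))
      (by omega)).ifEq
    (computes_digit I hT2 (Function.update_self _ _ _) (hN _) (by omega))
    (fun _ => Computes.foldProd 2 (hN _) (by omega) fun i hi => computes_entry I hT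
      (fun env' h1 h2 => computes_digit I hT2 (x := x) (m := i)
        (by rw [h1]; simp)
        (computes_var_of_eq (by rw [h2]; simp)) (by omega))
      (fun env' h1 h2 => computes_digit I hT2 (x := x) (m := i + 1)
        (by rw [h1]; simp)
        (((computes_var_of_eq (v := i) (by rw [h2]; simp)).add (computes_const 1)).congr (by
          push_cast; rfl)) (by omega)))
    (fun _ => computes_const 0)).congr ?_
  rw [pathSum]
  refine Finset.sum_congr rfl fun x _ => ?_
  norm_cast

end Trace

end Tm

/-! ### Correctness of the grid minimization -/

theorem exists_gridCoord_eq {G : ℕ} {g : Fin 3 → ℤ} (hg : ∑ α, g α ^ 2 ≤ (G : ℤ) ^ 2) :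
    ∃ p < (2 * G + 1) ^ 3, ∀ α : Fin 3, gridCoord G p α = g α := by
  have h1 : ∀ α, |g α| ≤ G := by
    intro α
    have h2 := (Finset.single_le_sum (fun β _ => sq_nonneg (g β)) (Finset.mem_univ α)).trans hg
    exact abs_le_of_sq_le_sq h2 (by positivity)
  have h2 : ∀ α, (g α + G).toNat < 2 * G + 1 := fun α => by
    have := abs_le.1 (h1 α); omega
  set p : Fin ((2 * G + 1) ^ 3) := finFunctionFinEquiv fun α => ⟨(g α + G).toNat, h2 α⟩ with hp
  refine ⟨p, p.2, fun α => ?_⟩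
  have h3 : (p : ℕ) / (2 * G + 1) ^ (α : ℕ) % (2 * G + 1) = (g α + G).toNat := by
    have h4 : finFunctionFinEquiv.symm p α = ⟨(g α + G).toNat, h2 α⟩ := by
      rw [hp, Equiv.symm_apply_apply]
    exact congrArg Fin.val h4
  have := abs_le.1 (h1 α)
  rw [gridCoord, h3]; omega

theorem gridCut_of_le {G p : ℕ} {v : ℤ}
    (h : ∑ α : Fin 3, gridCoord G p α ^ 2 ≤ (G : ℤ) ^ 2) : gridCut G p v = v := by
  rw [gridCut, if_pos]
  simp only [Finset.sum_range, ← pow_two]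
  omega

theorem gridCut_cases (G p : ℕ) (v : ℤ) : gridCut G p v = 0 ∨
    (∑ α : Fin 3, gridCoord G p α ^ 2 ≤ (G : ℤ) ^ 2 ∧ gridCut G p v = v) := by
  rw [gridCut]
  simp only [Finset.sum_range, ← pow_two]
  split_ifs with h
  · exact Or.inr ⟨by omega, rfl⟩
  · exact Or.inl rfl

namespace StarIsing

variable {n : ℕ} (I : StarIsing n)

theorem scaledCoeff_field (α : Fin 3) :
    (I.scaledCoeff α : ℝ) = I.commonDen * I.field α := by
  rw [scaledCoeff_eq I (by omega), coeff_field]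

theorem scaledCoeff_coupling (j : Fin n) (α : Fin 4) (β : Fin 3) :
    (I.scaledCoeff (3 + (12 * j + (3 * α + β))) : ℝ) = I.commonDen * I.coupling j α β := by
  rw [scaledCoeff_eq I (by omega), coeff_coupling]

/-- One factor G is consumed by each Bloch vector in a term. Linear terms contain only one and
therefore keep a factor G. -/
theorem classicalEnergy_grid {G : ℕ} (hG : 0 < G) (g : Fin 3 → ℤ) (f : Fin n → Fin 3 → ℤ) :
    (I.commonDen * G ^ 2 : ℝ) *
      I.classicalEnergy (fun α => (g α : ℝ) / G) (fun j α => (f j α : ℝ) / G) =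
    ((G * ∑ α : Fin 3, I.scaledCoeff α * g α + ∑ j : Fin n, ∑ b : Fin 3,
      ((G : ℤ) * I.scaledCoeff (3 + (12 * j + b)) + ∑ a : Fin 3,
        I.scaledCoeff (3 + (12 * j + (3 * (a + 1) + b))) * g a) * f j b : ℤ) : ℝ) := by
  have hG' : (G : ℝ) ≠ 0 := by exact_mod_cast hG.ne'
  have h1 : ∀ (j : Fin n) (b : Fin 3), (I.scaledCoeff (3 + (12 * j + b)) : ℝ) =
      I.commonDen * I.coupling j 0 b := fun j b => by
    rw [← scaledCoeff_coupling]; simp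
  have h2 : ∀ (j : Fin n) (a b : Fin 3),
      (I.scaledCoeff (3 + (12 * j + (3 * (a + 1) + b))) : ℝ) =
      I.commonDen * I.coupling j a.succ b := fun j a b => by
    rw [← scaledCoeff_coupling]; simp
  push_cast
  simp only [h1, h2, scaledCoeff_field]
  rw [classicalEnergy, mul_add]
  simp only [Finset.mul_sum, Finset.sum_mul, add_mul, mul_add]
  congr 1
  · refine Finset.sum_congr rfl fun α _ => ?_
    field_simp
  · refine Finset.sum_congr rfl fun j _ => Finset.sum_congr rfl fun b _ => ?_
    congr 1
    · field_simp
    · refine Finset.sum_congr rfl fun a _ => ?_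
      field_simp

theorem gridBath_eq (G p p' j : ℕ) (z : ℕ → ℤ) : gridBath z G p j p' = ∑ b : Fin 3,
    ((G : ℤ) * z (3 + (12 * j + b)) + ∑ a : Fin 3,
      z (3 + (12 * j + (3 * (a + 1) + b))) * gridCoord G p a) * gridCoord G p' b := by
  simp only [gridBath, Finset.sum_range]

/-- Once the central grid point is fixed, the energy is a sum over bath spins, so separate minima
for each bath spin bound every joint choice `f`. -/
theorem gridMin_le {G : ℕ} (hG : 0 < G) (g : Fin 3 → ℤ) (f : Fin n → Fin 3 → ℤ)
    (hg : ∑ α, g α ^ 2 ≤ (G : ℤ) ^ 2) (hf : ∀ j, ∑ α, f j α ^ 2 ≤ (G : ℤ) ^ 2) :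
    (gridMin I.scaledCoeff n G : ℝ) / (I.commonDen * (G * G) : ℤ) ≤
      I.classicalEnergy (fun α => (g α : ℝ) / G) (fun j α => (f j α : ℝ) / G) := by
  have hD : (0 : ℝ) < I.commonDen := by exact_mod_cast I.commonDen_pos
  have hG' : (0 : ℝ) < G := by exact_mod_cast hG
  obtain ⟨p, hp, hpg⟩ := exists_gridCoord_eq hg
  choose p' hp' hpf using fun j => exists_gridCoord_eq (hf j)
  push_cast
  rw [div_le_iff₀ (by positivity), mul_comm, ← pow_two, classicalEnergy_grid I hG]
  have h1 : ∀ (p : ℕ) (g : Fin 3 → ℤ), (∀ α : Fin 3, gridCoord G p α = g α) →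
      ∑ α, g α ^ 2 ≤ (G : ℤ) ^ 2 → ∑ α : Fin 3, gridCoord G p α ^ 2 ≤ (G : ℤ) ^ 2 := by
    intro p g h hg; simpa only [h] using hg
  have h2 := FoldOp.iter_min_le (fun p => gridCut G p ((G : ℤ) * ∑ a ∈ Finset.range 3,
    I.scaledCoeff a * gridCoord G p a + ∑ j ∈ Finset.range n, FoldOp.min.iter
      (fun p' => gridCut G p' (gridBath I.scaledCoeff G p j p')) ((2 * G + 1) ^ 3))) hp
  rw [gridCut_of_le (h1 p g hpg hg)] at h2
  have h3 : gridMin I.scaledCoeff n G ≤ G * ∑ α : Fin 3, I.scaledCoeff α * g α +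
      ∑ j : Fin n, ∑ b : Fin 3, ((G : ℤ) * I.scaledCoeff (3 + (12 * j + b)) + ∑ a : Fin 3,
        I.scaledCoeff (3 + (12 * j + (3 * (a + 1) + b))) * g a) * f j b := by
    refine h2.trans ?_
    simp only [Finset.sum_range, hpg]
    refine add_le_add le_rfl (Finset.sum_le_sum fun j _ => ?_)
    have h4 := FoldOp.iter_min_le (fun p' => gridCut G p' (gridBath I.scaledCoeff G p j p'))
      (hp' j)
    rw [gridCut_of_le (h1 _ _ (hpf j) (hf j)), gridBath_eq] at h4
    simpa only [hpg, hpf] using h4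
  exact_mod_cast h3

/-- An outer minimum of 0, whether initial value or excluded point, is fine since λ ≤ 0. Any other
value is attained by a product state, where an inner minimum of 0 is realised by the zero Bloch
vector. -/
theorem le_gridMin {G : ℕ} (hG : 0 < G) {lam : ℝ} (hpsd : (I.hamiltonian - lam • 1).PosSemidef) :
    lam ≤ (gridMin I.scaledCoeff n G : ℝ) / (I.commonDen * (G * G) : ℤ) := by
  have hD : (0 : ℝ) < I.commonDen := by exact_mod_cast I.commonDen_pos
  have hG' : (0 : ℝ) < G := by exact_mod_cast hG
  have hlam0 : lam ≤ 0 := (I.le_neg_abs_field hpsd 0).trans (neg_nonpos.2 (abs_nonneg _))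
  push_cast
  rw [le_div_iff₀ (by positivity)]
  have hzero : lam * (I.commonDen * (G * G)) ≤ ((0 : ℤ) : ℝ) := by
    rw [Int.cast_zero]
    exact mul_nonpos_of_nonpos_of_nonneg hlam0 (by positivity)
  rcases FoldOp.iter_min_mem (fun p => gridCut G p ((G : ℤ) * ∑ a ∈ Finset.range 3,
    I.scaledCoeff a * gridCoord G p a + ∑ j ∈ Finset.range n, FoldOp.min.iter
      (fun p' => gridCut G p' (gridBath I.scaledCoeff G p j p')) ((2 * G + 1) ^ 3)))
    ((2 * G + 1) ^ 3) with h | ⟨p, hp, h⟩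
  · rw [gridMin, h]; exact hzero
  rcases gridCut_cases G p ((G : ℤ) * ∑ a ∈ Finset.range 3,
    I.scaledCoeff a * gridCoord G p a + ∑ j ∈ Finset.range n, FoldOp.min.iter
      (fun p' => gridCut G p' (gridBath I.scaledCoeff G p j p')) ((2 * G + 1) ^ 3))
    with h0 | ⟨hball, h0⟩
  · rw [gridMin, h, h0]; exact hzero
  rw [gridMin, h, h0]
  have hex : ∀ j : Fin n, ∃ f : Fin 3 → ℤ, ∑ α, f α ^ 2 ≤ (G : ℤ) ^ 2 ∧
      FoldOp.min.iter (fun p' => gridCut G p' (gridBath I.scaledCoeff G p j p'))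
        ((2 * G + 1) ^ 3) = ∑ b : Fin 3,
      ((G : ℤ) * I.scaledCoeff (3 + (12 * j + b)) + ∑ a : Fin 3,
        I.scaledCoeff (3 + (12 * j + (3 * (a + 1) + b))) * gridCoord G p a) * f b := by
    intro j
    rcases FoldOp.iter_min_mem (fun p' => gridCut G p' (gridBath I.scaledCoeff G p j p'))
      ((2 * G + 1) ^ 3) with h | ⟨p', hp', h⟩
    · exact ⟨0, by simp, by rw [h]; simp⟩
    rcases gridCut_cases G p' (gridBath I.scaledCoeff G p j p') with h1 | ⟨h1, h2⟩
    · exact ⟨0, by simp, by rw [h, h1]; simp⟩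
    · exact ⟨fun α => gridCoord G p' α, h1, by rw [h, h2, gridBath_eq]⟩
  choose f hf hfe using hex
  have h1 := I.le_classicalEnergy hpsd _ _ (sum_div_sq_le_one hG hball)
    fun j => sum_div_sq_le_one hG (hf j)
  have h2 := I.classicalEnergy_grid hG (fun α => gridCoord G p α) f
  have h3 : (G : ℤ) * ∑ a ∈ Finset.range 3, I.scaledCoeff a * gridCoord G p a +
      ∑ j ∈ Finset.range n, FoldOp.min.iter
        (fun p' => gridCut G p' (gridBath I.scaledCoeff G p j p')) ((2 * G + 1) ^ 3) =
      G * ∑ α : Fin 3, I.scaledCoeff α * gridCoord G p α + ∑ j : Fin n, ∑ b : Fin 3,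
      ((G : ℤ) * I.scaledCoeff (3 + (12 * j + b)) + ∑ a : Fin 3,
        I.scaledCoeff (3 + (12 * j + (3 * (a + 1) + b))) * gridCoord G p a) * f j b := by
    simp only [Finset.sum_range, hfe]
  rw [h3, ← h2, mul_comm lam, ← pow_two]
  gcongr

end StarIsing

/-! ### The program -/

namespace Tm

/-- The exponent of the traces. -/
def numSteps (Q : ℕ) : Tm := resolution Q * (numBath + const 1 + resolution Q)

/-- Positive if the number of bath spins is at least the cube of the resolution. -/
def isLarge (Q : ℕ) : Tm :=
  numBath + const 1 - resolution Q * resolution Q * resolution Q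

/-- The numerator of the approximation to the ground energy. -/
def energyNum (Q : ℕ) : Tm :=
  .ite (isLarge Q) (gridMinimum Q)
    (absSum * tracePower (numSteps Q) - tracePower (numSteps Q + const 1))

/-- The denominator of the approximation to the ground energy. -/
def energyDen (Q : ℕ) : Tm :=
  .ite (isLarge Q) (denominator * (resolution Q * resolution Q))
    (denominator * tracePower (numSteps Q))

variable {n : ℕ} (I : StarIsing n) {k T : ℕ} {env : ℕ → ℤ} (Q : ℕ)

theorem computes_numSteps :
    Computes (I.input k) T (numSteps Q) env ((Q * k * (n + 1 + Q * k) : ℕ) : ℤ) :=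
  ((computes_resolution I Q).mul (((computes_numBath I).add (computes_const 1)).add
    (computes_resolution I Q))).congr (by push_cast; rfl)

theorem computes_isLarge :
    Computes (I.input k) T (isLarge Q) env ((n : ℤ) + 1 - ((Q * k) ^ 3 : ℕ)) :=
  (((computes_numBath I).add (computes_const 1)).sub (((computes_resolution I Q).mul
    (computes_resolution I Q)).mul (computes_resolution I Q))).congr (by push_cast; ring)

theorem computes_energyNum (hT : 3 + 12 * n ≤ T) (hW : (2 * (Q * k) + 1) ^ 3 ≤ T)
    (hm : n < (Q * k) ^ 3 → (2 ^ (n + 2)) ^ (Q * k * (n + 1 + Q * k) + 1 + 1) ≤ T) :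
    Computes (I.input k) T (energyNum Q) env (if (Q * k) ^ 3 ≤ n then
      gridMin I.scaledCoeff n (Q * k) else
      (∑ i ∈ Finset.range (3 + 12 * n), |I.scaledCoeff i|) *
        pathSum (shiftedEntry n I.scaledCoeff) (2 ^ (n + 2)) (Q * k * (n + 1 + Q * k)) -
        pathSum (shiftedEntry n I.scaledCoeff) (2 ^ (n + 2)) (Q * k * (n + 1 + Q * k) + 1)) := by
  have hiff : (0 : ℤ) < (n : ℤ) + 1 - ((Q * k) ^ 3 : ℕ) ↔ (Q * k) ^ 3 ≤ n := by omega
  simp only [← hiff]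
  refine (computes_isLarge I Q).ite (fun _ => computes_gridMinimum I Q hT hW) fun h => ?_
  have hm' := hm (by omega)
  exact ((computes_absSum I hT).mul (computes_tracePower I hT (fun _ => computes_numSteps I Q)
    ((Nat.pow_le_pow_right (by positivity) (by omega)).trans hm'))).sub
    (computes_tracePower I hT (fun _ => ((computes_numSteps I Q).add (computes_const 1)).congr
      (by push_cast; rfl)) hm')

theorem computes_energyDen (hT : 3 + 12 * n ≤ T)
    (hm : n < (Q * k) ^ 3 → (2 ^ (n + 2)) ^ (Q * k * (n + 1 + Q * k) + 1 + 1) ≤ T) :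
    Computes (I.input k) T (energyDen Q) env (if (Q * k) ^ 3 ≤ n then
      I.commonDen * (((Q * k : ℕ) : ℤ) * ((Q * k : ℕ) : ℤ)) else I.commonDen *
        pathSum (shiftedEntry n I.scaledCoeff) (2 ^ (n + 2)) (Q * k * (n + 1 + Q * k))) := by
  have hiff : (0 : ℤ) < (n : ℤ) + 1 - ((Q * k) ^ 3 : ℕ) ↔ (Q * k) ^ 3 ≤ n := by omega
  simp only [← hiff]
  refine (computes_isLarge I Q).ite (fun _ => (computes_denominator I hT).mul
    ((computes_resolution I Q).mul (computes_resolution I Q))) fun h => ?_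
  exact (computes_denominator I hT).mul (computes_tracePower I hT
    (fun _ => computes_numSteps I Q)
    ((Nat.pow_le_pow_right (by positivity) (by omega)).trans (hm (by omega))))

end Tm

/-! ### Bounds for the loops and the input -/

/-- Because n + 1 ≥ 2, any quantity up to 2^(20 G^7) is admissible. For n < G³ the number of paths
has binary exponent at most 2G³ · 4G⁴. Only the number of coefficients needs the growth of n + 1
itself. -/
theorem loop_bounds {n G E : ℕ} (hn : 1 ≤ n) (hG : 1 ≤ G) (hE : 20 * G ^ 7 ≤ E) :
    2 ≤ (n + 1) ^ E ∧ G ≤ (n + 1) ^ E ∧ 3 + 12 * n ≤ (n + 1) ^ E ∧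
      (2 * G + 1) ^ 3 ≤ (n + 1) ^ E ∧
      (n < G ^ 3 → (2 ^ (n + 2)) ^ (G * (n + 1 + G) + 1 + 1) ≤ (n + 1) ^ E) := by
  have h2 : ∀ e, e ≤ 20 * G ^ 7 → 2 ^ e ≤ (n + 1) ^ E := fun e he =>
    (Nat.pow_le_pow_left (by omega) e).trans (Nat.pow_le_pow_right (by omega) (he.trans hE))
  have h7 : G ≤ G ^ 7 := Nat.le_self_pow (by norm_num) G
  refine ⟨h2 1 (by omega), Nat.lt_two_pow_self.le.trans (h2 G (by omega)), ?_, ?_, fun h => ?_⟩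
  · calc 3 + 12 * n ≤ 2 ^ 4 * (n + 1) := by omega
      _ ≤ (n + 1) ^ 4 * (n + 1) := by gcongr; omega
      _ = (n + 1) ^ 5 := by ring
      _ ≤ _ := Nat.pow_le_pow_right (by omega) (by omega)
  · calc (2 * G + 1) ^ 3 ≤ (2 ^ (2 * G + 1)) ^ 3 := by gcongr; exact Nat.lt_two_pow_self.le
      _ = 2 ^ (3 * (2 * G + 1)) := by rw [← pow_mul, mul_comm]
      _ ≤ _ := h2 _ (by omega)
  · rw [← pow_mul]
    refine h2 _ ?_
    have h4 : G ^ 2 ≤ G ^ 4 := Nat.pow_le_pow_right hG (by norm_num)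
    have h3 : 1 ≤ G ^ 3 := Nat.one_le_pow _ _ hG
    have h5 : 1 ≤ G ^ 4 := Nat.one_le_pow _ _ hG
    have h6 : G * (n + 1 + G) ≤ G ^ 4 + G ^ 2 := by
      calc G * (n + 1 + G) ≤ G * (G ^ 3 + G) := by gcongr; omega
        _ = _ := by ring
    calc (n + 2) * (G * (n + 1 + G) + 1 + 1) ≤ (2 * G ^ 3) * (4 * G ^ 4) := by
          gcongr <;> omega
      _ ≤ 20 * G ^ 7 := by ring_nf; omega

namespace StarIsing

variable {n : ℕ} (I : StarIsing n)

theorem ratBits_coeff {m : ℕ} (h : I.HasBits m) {i : ℕ} (hi : i < 3 + 12 * n) :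
    RatBits m (I.coeff i) := by
  rw [coeff]
  split_ifs with h1 h2
  · exact h.1 _
  · exact h.2 _ _ _
  · omega

theorem HasBits.one_le {m : ℕ} (h : I.HasBits m) : 1 ≤ m :=
  le_trans (Nat.size_pos.2 (I.field 0).den_pos) (h.1 0).2

theorem bitLen_input_le {m k B : ℕ} (h : I.HasBits m) (hm : m ≤ B) (hn : n ≤ B) (hk : k ≤ B)
    (a i : ℕ) : bitLen (I.input k a i) ≤ B := by
  rw [input]
  split_ifs with h0 h1 h2 h3 h4
  · exact (bitLen_natCast_le n).trans hn
  · exact (bitLen_natCast_le k).trans hk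
  · exact Nat.zero_le _
  · exact (I.ratBits_coeff h h3.2).1.trans hm
  · exact (I.ratBits_coeff h h4.2).2.trans hm
  · exact Nat.zero_le _

end StarIsing

end StarGroundEnergy

theorem theorem3 (a b : ℝ) (ha : 0 < a) (hab : a ≤ b) :
    ∃ (P : RamProg) (C : ℕ), ∀ ε : ℝ, 0 < ε → ε ≤ 1 / 2 →
      ∀ (n m : ℕ) (I : StarIsing n), 1 ≤ n → I.HasBits m →
        (∀ j, a ≤ l2OpNorm (I.interaction j) ∧ l2OpNorm (I.interaction j) ≤ b) →
        ∃ (t : ℕ) (s : Store), RamRun P (I.input ⌈1 / ε⌉₊) t s ∧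
          (t : ℝ) ≤ (m : ℝ) ^ C * ((n : ℝ) + 1) ^ ((1 / ε) ^ C) ∧
          0 < s 3 1 ∧
          ∃ lam : ℝ, I.IsGroundEnergy lam ∧
            |(s 3 0 : ℝ) / (s 3 1 : ℝ) - lam| ≤ ε * |lam| := by
  have hb : 0 < b := ha.trans_le hab
  -- The norm bounds a and b become a/12 and 4b for coefficients, and 4 + 126r dominates both error
  -- constants 3 + 126r and 4 + 36r. Dividing by G = Qk then leaves at most 1/k ≤ ε.
  obtain ⟨Q, hQ⟩ : ∃ Q : ℕ, 4 + 126 * (4 * b / (a / 12)) ≤ Q := exists_nat_ge _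
  have hba : 0 < 4 * b / (a / 12) := by positivity
  have hQ1 : 1 ≤ Q := by
    have : (0 : ℝ) < Q := by linarith
    exact_mod_cast this
  obtain ⟨C, hC⟩ := exists_time_exponent (20 * Q ^ 7)
    (Tm.weight (Tm.energyNum Q) + Tm.weight (Tm.energyDen Q) + 4)
  refine ⟨Tm.toProg (Tm.energyNum Q) (Tm.energyDen Q), C, fun ε hε hε2 n m I hn hbits hnorm => ?_⟩
  set k := ⌈1 / ε⌉₊ with hk
  have hk1 : 1 ≤ k := Nat.one_le_ceil_iff.2 (by positivity)
  have hkε : 1 / ε ≤ k := Nat.le_ceil _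
  have hG1 : 1 ≤ Q * k := Nat.mul_pos hQ1 hk1
  have hm1 := hbits.one_le
  have hA : 7 ≤ 20 * Q ^ 7 := by have := Nat.one_le_pow 7 Q hQ1; omega
  -- The exponent is enlarged from 20(Qk)^7 to the form A·k^A with A = 20Q^7 expected by
  -- `exists_time_exponent`.
  obtain ⟨hT2, hTG, hTn, hTW, hTm⟩ := loop_bounds (n := n) (G := Q * k)
    (E := 20 * Q ^ 7 * k ^ (20 * Q ^ 7)) hn hG1 (by
      rw [mul_pow, ← mul_assoc]
      exact Nat.mul_le_mul_left _ (Nat.pow_le_pow_right hk1 hA))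
  set T := (n + 1) ^ (20 * Q ^ 7 * k ^ (20 * Q ^ 7)) with hT
  have hkT : k ≤ T := (Nat.le_mul_of_pos_left k hQ1).trans hTG
  have hTB : T ≤ m * T := Nat.le_mul_of_pos_left T hm1
  have hmB : m ≤ m * T := Nat.le_mul_of_pos_right m (by omega)
  have hnum := Tm.computes_energyNum I (k := k) (env := fun _ => I.input k 0 0) Q hTn hTW hTm
  have hden := Tm.computes_energyDen I (k := k) (env := fun _ => I.input k 0 0) Q hTn hTm
  obtain ⟨t, s, hrun, hs0, hs1, ht⟩ := Tm.run_toProg (I.input k) hT2 hTB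
    (fun a _ i => I.bitLen_input_le hbits hmB (by omega) (hkT.trans hTB) a i) _ _ hnum.2 hden.2
  rw [hnum.1] at hs0
  rw [hden.1] at hs1
  obtain ⟨μ, s₀, hmin, hground, hpsd, htr, hst⟩ := I.exists_spectrum
  have hpsd' := hpsd _ hmin
  have hcb : ∀ j α β, |(I.coupling j α β : ℝ)| ≤ 4 * b := fun j α β =>
    (I.abs_coupling_le j α β).trans (by linarith [(hnorm j).2])
  have hca : ∀ j, ∃ α β, a / 12 ≤ |(I.coupling j α β : ℝ)| := fun j => by
    obtain ⟨α, β, h⟩ := I.exists_le_abs_coupling j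
    exact ⟨α, β, by linarith [(hnorm j).1]⟩
  have hrel : ∀ x : ℝ, x ≤ 4 + 126 * (4 * b / (a / 12)) →
      x / ((Q * k : ℕ) : ℝ) * |μ s₀| ≤ ε * |μ s₀| := fun x hx => by
    refine mul_le_mul_of_nonneg_right ?_ (abs_nonneg _)
    have hk0 : (0 : ℝ) < k := by exact_mod_cast hk1
    have hQ0 : (0 : ℝ) < Q := by exact_mod_cast hQ1
    push_cast
    rw [div_le_iff₀ (by positivity)]
    have h1 : 1 ≤ k * ε := (div_le_iff₀ hε).1 hkε
    calc x ≤ Q * 1 := by linarith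
      _ ≤ Q * (k * ε) := by gcongr
      _ = _ := by ring
  refine ⟨t, s, hrun, hC ε hε hε2 n m hm1 t ht, ?_⟩
  rw [hs0, hs1]
  split_ifs with hlarge
  · refine ⟨mul_pos I.commonDen_pos (by positivity), μ s₀, hground, ?_⟩
    have h1 := I.grid_minimum_error (by positivity) hG1 hlarge hcb hca hpsd' (hst s₀)
      fun g f hg hf => I.gridMin_le hG1 g f hg hf
    rw [abs_of_nonneg (sub_nonneg.2 (I.le_gridMin hG1 hpsd'))]
    exact h1.trans (hrel _ (by linarith))
  · obtain ⟨h1, h2⟩ := I.trace_ratio_error (by positivity) hn hcb hca I.commonDen_pos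
      (fun i hi => I.scaledCoeff_eq hi) hG1 hmin hpsd' htr hst
    exact ⟨mul_pos I.commonDen_pos h1, μ s₀, hground, h2.trans (hrel _ (by linarith))⟩
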